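/- **Setup.** For each $n$ let $W_i=(Y_i,T_i,X_i,Z_i)$, $i\in[n]$, be an i.i.d. sample with real outcome $Y_i$, real (e.g. binary) treatment $T_i$, running variable $X_i\in\mathbb R$ with cutoff $0$ and covariates $Z_i\in\mathbb R^{d_n}$. The law of $X_i$ is fixed; $d_n$ and the conditional law of $(Y_i,T_i,Z_i)$ given $X_i=x$ (a Markov kernel, used to define all $\mathbb E,\mathbb V,\mathrm{Cov}[\cdot|X_i=x]$) may depend on $n$, which is left implicit. $\mathcal X$ is the support of $X_i$, $\mathcal X_h=\mathcal X\cap[-h,h]$, and $g(0^\pm)$ are one-sided limits. Let $$\tau_Y=\mathbb E[Y_i|X_i=0^+]-\mathbb E[Y_i|X_i=0^-],\quad \tau_T=\mathbb E[T_i|X_i=0^+]-\mathbb E[T_i|X_i=0^-],\quad \theta=\tau_Y/\tau_T .$$ **Estimator.** The sample is split, independently of the data, into $S$ folds $I_1,\dots,I_S$ of equal size (up to one observation); $s(i)$ is the fold of $i$, and $\widehat\eta_{Y,s},\widehat\eta_{T,s}$ are real functions on $\mathbb R^{d_n}$ computed by (measurable) first-stage procedures from the data outside $I_s$. With a kernel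 $K$, bandwidth $h=h_n>0$, $K_h(v)=K(v/h)/h$, $K_h^+(v)=K_h(v)1\{v\ge0\}$, $K_h^-(v)=K_h(v)1\{v<0\}$, $\widetilde X_i=(1,X_i)^\top$ and $e_0=(1,0)^\top$, $$w_i(h)=w_i^+(h)-w_i^-(h),\quad w_i^\star(h)=e_0^\top\Big(\sum_{j=1}^nK_h^\star(X_j)\widetilde X_j\widetilde X_j^\top\Big)^{-1}K_h^\star(X_i)\widetilde X_i,\qquad \widehat\theta(h;\widehat\eta_Y,\widehat\eta_T)=\frac{\sum_iw_i(h)(Y_i-\widehat\eta_{Y,s(i)}(Z_i))}{\sum_iw_i(h)(T_i-\widehat\eta_{T,s(i)}(Z_i))}.$$ **Assumptions.** Let $\mathcal E$ be the set of measurable $\eta$ for which $\mathbb E[\eta(Z_i)|X_i=x]$ exists and is twice continuously differentiable around $0$. (A1–2) For $P\in\{Y,T\}$ there are sets $\mathcal T_n\subset\mathcal E$, $\bar\eta_P\in\mathcal T_n$ and sequences $r_n,v_{1,n},v_{2,n}\to0$ with $\mathbb P(\widehat\eta_{P,s}\in\mathcal T_n)\to1$ for each $s$, $\sup_{\eta\in\mathcal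 T_n}\sup_{x\in\mathcal X_h}\mathbb E[(\eta(Z_i)-\bar\eta_P(Z_i))^2|X_i=x]=O(r_n^2)$, and, for $j=1,2$, $\partial_x^j\mathbb E[\eta(Z_i)-\bar\eta_P(Z_i)|X_i=x]$ exists for $x\in\mathcal X_h\setminus\{0\}$ and is $O(v_{j,n})$ uniformly over $\eta\in\mathcal T_n$ and such $x$. (A3) $X_i$ has a density $f_X$ that is continuous and bounded away from zero on an open neighbourhood of $0$; $K$ is a bounded symmetric probability density, continuous on its support and zero outside $[-1,1]$; $h\to0$, $nh\to\infty$. (A4) There are constants $C>0$, $L$, $q>2$, independent of $n$, such that for $M=Y_i-\bar\eta_Y(Z_i)$ and for $M=T_i-\bar\eta_T(Z_i)$: (i) $\mathbb E[M|X_i=x]$ exists and is twice continuously differentiable on $\mathcal X\setminus\{0\}$, its second derivative being bounded by $C$ and $L$-Lipschitz on each side of $0$; (ii) $\mathbb E[|M-\mathbb E[M|X_i]|^q|X_i=x]\le C$ on $\mathcal X$; (iii) $\mathbb V[M|X_i=x]$ is $L$-Lipschitz on each side of $0$ and at least $1/C$ on $\mathcal X\setminus\{0\}$. (A5) $|\tau_T|$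 is bounded away from $0$ and $|\theta|$ is bounded, uniformly in $n$; and (A4)(iii) also holds with $M=U_i(\bar\eta_Y,\bar\eta_T)$, where $$U_i(\eta_Y,\eta_T)=\big(Y_i-\theta T_i-(\eta_Y(Z_i)-\theta\eta_T(Z_i))\big)/\tau_T .$$ **Constants.** $\bar\nu_j=\int_0^\infty v^jK(v)dv$, $\ \bar\nu=\dfrac{\bar\nu_2^2-\bar\nu_1\bar\nu_3}{\bar\nu_2\bar\nu_0-\bar\nu_1^2}$, $\ \bar\kappa=\dfrac{\int_0^\infty(K(v)(\bar\nu_1v-\bar\nu_2))^2dv}{(\bar\nu_2\bar\nu_0-\bar\nu_1^2)^2}$, and $$V_\theta(\eta_Y,\eta_T)=\frac{\bar\kappa}{f_X(0)}\Big(\mathbb V[U_i(\eta_Y,\eta_T)|X_i=0^+]+\mathbb V[U_i(\eta_Y,\eta_T)|X_i=0^-]\Big).$$ **Proposition.** Assume (A1)–(A5). (i) All one-sided limits appearing in $\theta$, in the next two displays and in $V_\theta(\bar\eta_Y,\bar\eta_T)$ exist, $V_\theta(\bar\eta_Y,\bar\eta_T)>0$, and there are random variables $B_{\theta,n}$ with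 $$B_{\theta,n}=\frac{\bar\nu}{2\tau_T}\Big(\partial_x^2\mathbb E[Y_i-\theta T_i|X_i=x]\big|_{x=0^+}-\partial_x^2\mathbb E[Y_i-\theta T_i|X_i=x]\big|_{x=0^-}\Big)+o_P(1)$$ such that $$\sqrt{nh}\,V_\theta(\bar\eta_Y,\bar\eta_T)^{-1/2}\big(\widehat\theta(h;\widehat\eta_Y,\widehat\eta_T)-\theta-B_{\theta,n}h^2\big)\xrightarrow{d}\mathcal N(0,1).$$ (ii) Fix $n$. Suppose additionally that $\mathbb E[Y_i^2|X_i=x]$ and $\mathbb E[T_i^2|X_i=x]$ are bounded over $x\in\mathcal X$ and that the limits $\mathbb V[Y_i-\theta T_i|X_i=0^\pm]$ exist. For $P\in\{Y,T\}$ let $\mu_P^\pm(z)=\mathbb E[P_i|X_i=0^\pm,Z_i=z]$ be the limits, as $x\to0^\pm$, of a version $\mu_P(x,z)$ of $\mathbb E[P_i|X_i=x,Z_i=z]$, pointwise in $z$ and in the sense that $\mathbb E[(\mu_P(x,Z_i)-\mu_P^\pm(Z_i))^2|X_i=x]\to0$; let $\mathbb E[\mu_P^\pm(Z_i)^2|X_i=x]<\infty$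 on $\mathcal X$, and $\eta_{P,0}=(\mu_P^++\mu_P^-)/2$. Let $\mathcal V$ be the set of measurable $\eta$ for which $\mathbb V[\eta(Z_i)|X_i=x]$ and $\mathrm{Cov}[\eta(Z_i),\mu_P^\pm(Z_i)|X_i=x]$, $P\in\{Y,T\}$, are finite and continuous on $\mathcal X$, and suppose $\eta_{Y,0},\eta_{T,0}\in\mathcal V$. Call a pair $\eta_Y,\eta_T\in\mathcal V$ regular if $\mathrm{Cov}[\eta_Y(Z_i),\eta_T(Z_i)|X_i=x]$ is continuous on $\mathcal X$. Then the limits in $V_\theta(\eta_Y,\eta_T)$ exist for every regular pair; for all regular pairs $(\eta_Y^{(a)},\eta_T^{(a)})$ and $(\eta_Y^{(b)},\eta_T^{(b)})$, $$\begin{aligned}V_\theta(\eta_Y^{(a)},\eta_T^{(a)})-V_\theta(\eta_Y^{(b)},\eta_T^{(b)})=\frac{2\bar\kappa}{\tau_T^2f_X(0)}\Big(&\mathbb V[\eta_{Y,0}(Z_i)-\theta\eta_{T,0}(Z_i)-(\eta_Y^{(a)}(Z_i)-\theta\eta_T^{(a)}(Z_i))|X_i=0]\\&-\mathbb V[\eta_{Y,0}(Z_i)-\theta\eta_{T,0}(Z_i)-(\eta_Y^{(b)}(Z_i)-\theta\eta_T^{(b)}(Z_i))|X_i=0]\Big);\end{aligned}$$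 and $(\eta_{Y,0},\eta_{T,0})$ is itself a regular pair and minimizes $V_\theta$ over all regular pairs. -/

import Mathlib

open MeasureTheory ProbabilityTheory Filter Topology Set

namespace FuzzyRD

noncomputable section

/-! ### Observations, conditional moments and one-sided limits -/

/-- The part `(Y, T, Z)` of an observation, with `d` covariates. -/
abbrev Obs (d : ℕ) : Type := ℝ × ℝ × (Fin d → ℝ)

/-- A full observation `W = (X, (Y, T, Z))`; the first coordinate is the running variable. -/
abbrev Datum (d : ℕ) : Type := ℝ × Obs d

/-- The outcome `Y`. -/
def outY {d : ℕ} (w : Obs d) : ℝ := w.1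

/-- The treatment `T`. -/
def outT {d : ℕ} (w : Obs d) : ℝ := w.2.1

/-- The covariates `Z`. -/
def covs {d : ℕ} (w : Obs d) : Fin d → ℝ := w.2.2

/-- The random variable `η(Z)`. -/
def onCovs {d : ℕ} (η : (Fin d → ℝ) → ℝ) (w : Obs d) : ℝ := η (covs w)

/-- The adjusted outcome `M(η) = y - η(Z)`, for an outcome `y` (either `Y` or `T`). -/
def adjusted {d : ℕ} (y : Obs d → ℝ) (η : (Fin d → ℝ) → ℝ) (w : Obs d) : ℝ := y w - onCovs η w

/-- `E[g | X = x]`, where `κ x` is the conditional law of `(Y, T, Z)` given `X = x`. -/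
def condMean {d : ℕ} (κ : Kernel ℝ (Obs d)) (g : Obs d → ℝ) (x : ℝ) : ℝ := ∫ w, g w ∂(κ x)

/-- `V[g | X = x]`. -/
def condVar {d : ℕ} (κ : Kernel ℝ (Obs d)) (g : Obs d → ℝ) (x : ℝ) : ℝ := variance g (κ x)

/-- `Cov[g₁, g₂ | X = x]`. -/
def condCov {d : ℕ} (κ : Kernel ℝ (Obs d)) (g₁ g₂ : Obs d → ℝ) (x : ℝ) : ℝ :=
  covariance g₁ g₂ (κ x)

/-- `f(0⁺)`. -/
def limPlus (f : ℝ → ℝ) : ℝ := Function.rightLim f 0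

/-- `f(0⁻)`. -/
def limMinus (f : ℝ → ℝ) : ℝ := Function.leftLim f 0

/-- Both one-sided limits of `f` at the cutoff exist (and then equal `limPlus f`, `limMinus f`). -/
def HasOneSidedLimits (f : ℝ → ℝ) : Prop :=
  Tendsto f (𝓝[>] 0) (𝓝 (limPlus f)) ∧ Tendsto f (𝓝[<] 0) (𝓝 (limMinus f))

/-- The sharp RD estimand `E[y | X = 0⁺] - E[y | X = 0⁻]`, i.e. `τ_Y` or `τ_T`. -/
def rdJump {d : ℕ} (κ : Kernel ℝ (Obs d)) (y : Obs d → ℝ) : ℝ :=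
  limPlus (condMean κ y) - limMinus (condMean κ y)

/-- The fuzzy RD estimand `θ = τ_Y / τ_T`. -/
def fuzzyParam {d : ℕ} (κ : Kernel ℝ (Obs d)) : ℝ := rdJump κ outY / rdJump κ outT

/-- `Y - θ T`. -/
def fuzzyOutcome {d : ℕ} (κ : Kernel ℝ (Obs d)) (w : Obs d) : ℝ :=
  outY w - fuzzyParam κ * outT w

/-- `U(η_Y, η_T) = (Y - θ T - (η_Y(Z) - θ η_T(Z))) / τ_T`. -/
def fuzzyU {d : ℕ} (κ : Kernel ℝ (Obs d)) (ηY ηT : (Fin d → ℝ) → ℝ) (w : Obs d) : ℝ :=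
  (outY w - fuzzyParam κ * outT w - (onCovs ηY w - fuzzyParam κ * onCovs ηT w)) / rdJump κ outT

/-! ### Kernel constants, leading bias and variance -/

/-- `ν̄_j = ∫₀^∞ v^j K(v) dv`. -/
def nuMoment (K : ℝ → ℝ) (j : ℕ) : ℝ := ∫ v in Ioi (0 : ℝ), v ^ j * K v

/-- `ν̄`. -/
def nuBar (K : ℝ → ℝ) : ℝ :=
  (nuMoment K 2 ^ 2 - nuMoment K 1 * nuMoment K 3) /
    (nuMoment K 2 * nuMoment K 0 - nuMoment K 1 ^ 2)

/-- `κ̄`. -/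
def kappaBar (K : ℝ → ℝ) : ℝ :=
  (∫ v in Ioi (0 : ℝ), (K v * (nuMoment K 1 * v - nuMoment K 2)) ^ 2) /
    (nuMoment K 2 * nuMoment K 0 - nuMoment K 1 ^ 2) ^ 2

/-- The leading term of the bias constant `B_θ`. -/
def biasLead {d : ℕ} (K : ℝ → ℝ) (κ : Kernel ℝ (Obs d)) : ℝ :=
  nuBar K / (2 * rdJump κ outT) *
    (limPlus (iteratedDeriv 2 (condMean κ (fuzzyOutcome κ))) -
      limMinus (iteratedDeriv 2 (condMean κ (fuzzyOutcome κ))))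

/-- `V_θ(η_Y, η_T)`; here `fX` is the density of the running variable. -/
def asympVar {d : ℕ} (K fX : ℝ → ℝ) (κ : Kernel ℝ (Obs d)) (ηY ηT : (Fin d → ℝ) → ℝ) : ℝ :=
  kappaBar K / fX 0 *
    (limPlus (condVar κ (fuzzyU κ ηY ηT)) + limMinus (condVar κ (fuzzyU κ ηY ηT)))

/-! ### The cross-fitted estimator -/

/-- `K_h^+(v) = K(v / h) / h · 1{v ≥ 0}`. -/
def kernPlus (K : ℝ → ℝ) (h v : ℝ) : ℝ := if 0 ≤ v then K (v / h) / h else 0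

/-- `K_h^-(v) = K(v / h) / h · 1{v < 0}`. -/
def kernMinus (K : ℝ → ℝ) (h v : ℝ) : ℝ := if v < 0 then K (v / h) / h else 0

/-- Local linear intercept weights
`e₀ᵀ (∑ⱼ k(xⱼ) (1, xⱼ)(1, xⱼ)ᵀ)⁻¹ k(xᵢ) (1, xᵢ)` for the kernel weights `k`. -/
def sideWeight {n : ℕ} (k : ℝ → ℝ) (x : Fin n → ℝ) (i : Fin n) : ℝ :=
  ((Matrix.of fun a b : Fin 2 => ∑ j, k (x j) * (x j ^ (a : ℕ) * x j ^ (b : ℕ)))⁻¹.mulVec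
    (fun a : Fin 2 => k (x i) * x i ^ (a : ℕ))) 0

/-- The local linear RD weights `wᵢ(h)`. -/
def rdWeight {n : ℕ} (K : ℝ → ℝ) (h : ℝ) (x : Fin n → ℝ) (i : Fin n) : ℝ :=
  sideWeight (kernPlus K h) x i - sideWeight (kernMinus K h) x i

/-- A first-stage procedure for sample size `n`: it turns any subsample `{Wᵢ}_{i ∈ A}` into an
adjustment function. -/
abbrev FirstStage (d n : ℕ) : Type :=
  (A : Finset (Fin n)) → (A → Datum d) → (Fin d → ℝ) → ℝ

/-- `η̂_s`, computed from the data outside fold `s`; observation `i` belongs to fold `σ i`. -/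
def crossFit {d n S : ℕ} (est : FirstStage d n) (σ : Fin n → Fin S) (s : Fin S)
    (W : Fin n → Datum d) : (Fin d → ℝ) → ℝ :=
  est (Finset.univ.filter fun i => σ i ≠ s) (fun i => W i)

/-- The adjusted sharp RD estimator `τ̂_y(h; η̂) = ∑ᵢ wᵢ(h) (yᵢ - η̂_{s(i)}(Zᵢ))`. -/
def sharpEst {d n S : ℕ} (K : ℝ → ℝ) (h : ℝ) (y : Obs d → ℝ) (est : FirstStage d n)
    (σ : Fin n → Fin S) (W : Fin n → Datum d) : ℝ :=
  ∑ i, rdWeight K h (fun j => (W j).1) i * adjusted y (crossFit est σ (σ i) W) (W i).2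

/-- `θ̂(h; η̂_Y, η̂_T)`. -/
def fuzzyEst {d n S : ℕ} (K : ℝ → ℝ) (h : ℝ) (estY estT : FirstStage d n)
    (σ : Fin n → Fin S) (W : Fin n → Datum d) : ℝ :=
  sharpEst K h outY estY σ W / sharpEst K h outT estT σ W

/-- The folds have equal size (up to one observation if `S` does not divide `n`). -/
def BalancedSplit {n S : ℕ} (σ : Fin n → Fin S) : Prop :=
  ∀ s : Fin S, n / S ≤ (Finset.univ.filter fun i => σ i = s).card ∧
    (Finset.univ.filter fun i => σ i = s).card ≤ n / S + 1

/-- The joint law of the random split (with law `ρ`) and of an independent i.i.d. sample of size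
`n` whose running variable has law `PX` and for which `κ` is the conditional law of `(Y, T, Z)`
given the running variable. -/
def sampleLaw {d n S : ℕ} (ρ : Measure (Fin n → Fin S)) (PX : Measure ℝ)
    (κ : Kernel ℝ (Obs d)) : Measure ((Fin n → Fin S) × (Fin n → Datum d)) :=
  ρ.prod (Measure.pi fun _ => PX ⊗ₘ κ)

instance instIsProbabilityMeasureSampleLaw {d n S : ℕ} (ρ : Measure (Fin n → Fin S))
    [IsProbabilityMeasure ρ] (PX : Measure ℝ) [IsProbabilityMeasure PX] (κ : Kernel ℝ (Obs d))
    [IsMarkovKernel κ] : IsProbabilityMeasure (sampleLaw ρ PX κ) := by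
  unfold sampleLaw; infer_instance

/-! ### Assumptions -/

/-- The class `𝓔` of admissible adjustment functions: `E[η(Z) | X = x]` exists and is twice
continuously differentiable around the cutoff. -/
def admissible {d : ℕ} (κ : Kernel ℝ (Obs d)) : Set ((Fin d → ℝ) → ℝ) :=
  {η | Measurable η ∧ ∃ ε > 0, (∀ x ∈ Ioo (-ε) ε, Integrable (onCovs η) (κ x)) ∧
    ContDiffOn ℝ 2 (condMean κ (onCovs η)) (Ioo (-ε) ε)}

/-- `𝒳_h = 𝒳 ∩ [-h, h]`, with `𝒳` the support of the running variable. -/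
def localSupport (PX : Measure ℝ) (h : ℝ) : Set ℝ := PX.support ∩ Icc (-h) h

/-- The two assumptions on the first stage: the cross-fitted functions lie, with probability
approaching one, in sets `𝒯 n ⊆ 𝓔` that contain `ηbar n` and contract around it in conditional mean
square, and the first two derivatives of `x ↦ E[η(Z) - ηbar(Z) | X = x]` exist and are uniformly
small for `η ∈ 𝒯 n`. -/
def FirstStageAssumption {S : ℕ} {d : ℕ → ℕ} (PX : Measure ℝ) (h : ℕ → ℝ)
    (κ : ∀ n, Kernel ℝ (Obs (d n))) (ρ : ∀ n, Measure (Fin n → Fin S))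
    (est : ∀ n, FirstStage (d n) n) (ηbar : ∀ n, (Fin (d n) → ℝ) → ℝ) : Prop :=
  ∃ (𝒯 : ∀ n, Set ((Fin (d n) → ℝ) → ℝ)) (r : ℕ → ℝ) (v : ℕ → ℕ → ℝ),
    (∀ n, 𝒯 n ⊆ admissible (κ n)) ∧ (∀ n, ηbar n ∈ 𝒯 n) ∧
    (∀ s : Fin S, Tendsto (fun n => sampleLaw (ρ n) PX (κ n)
      {p | crossFit (est n) p.1 s p.2 ∉ 𝒯 n}) atTop (𝓝 0)) ∧
    Tendsto r atTop (𝓝 0) ∧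
    (∃ c : ℝ, ∀ᶠ n in atTop, ∀ η ∈ 𝒯 n, ∀ x ∈ localSupport PX (h n),
      Integrable (fun w => onCovs (η - ηbar n) w ^ 2) (κ n x) ∧
      condMean (κ n) (fun w => onCovs (η - ηbar n) w ^ 2) x ≤ c * r n ^ 2) ∧
    Tendsto (v 1) atTop (𝓝 0) ∧ Tendsto (v 2) atTop (𝓝 0) ∧
    (∃ c : ℝ, ∀ᶠ n in atTop, ∀ η ∈ 𝒯 n, ∀ x ∈ localSupport PX (h n) \ {0},
      DifferentiableAt ℝ (condMean (κ n) (onCovs (η - ηbar n))) x ∧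
      DifferentiableAt ℝ (deriv (condMean (κ n) (onCovs (η - ηbar n)))) x ∧
      ∀ j ∈ ({1, 2} : Set ℕ),
        |iteratedDeriv j (condMean (κ n) (onCovs (η - ηbar n))) x| ≤ c * |v j n|)

/-- The assumption on the running variable, the kernel and the bandwidth. -/
structure DesignAssumption (PX : Measure ℝ) (fX K : ℝ → ℝ) (h : ℕ → ℝ) : Prop where
  density_measurable : Measurable fX
  density_nonneg : ∀ x, 0 ≤ fX x
  density : PX = volume.withDensity fun x => ENNReal.ofReal (fX x)
  density_cutoff : ∃ U : Set ℝ, IsOpen U ∧ (0 : ℝ) ∈ U ∧ ContinuousOn fX U ∧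
    ∃ c > 0, ∀ x ∈ U, c ≤ fX x
  kernel_measurable : Measurable K
  kernel_nonneg : ∀ v, 0 ≤ K v
  kernel_integral : ∫ v, K v = 1
  kernel_symm : ∀ v, K (-v) = K v
  kernel_bounded : ∃ b, ∀ v, K v ≤ b
  kernel_continuousOn : ContinuousOn K (Function.support K)
  kernel_zero : ∀ v ∉ Icc (-1 : ℝ) 1, K v = 0
  bandwidth_pos : ∀ n, 0 < h n
  bandwidth_zero : Tendsto h atTop (𝓝 0)
  bandwidth_rate : Tendsto (fun n => n * h n) atTop atTop

/-- `g` is `L`-Lipschitz on the part of `A` to the right, and on the part to the left, of `0`. -/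
def SidedLipschitz (L : ℝ) (g : ℝ → ℝ) (A : Set ℝ) : Prop :=
  ∀ x ∈ A, ∀ y ∈ A, 0 < x * y → |g x - g y| ≤ L * |x - y|

/-- `E[m | X = x]` exists and is twice continuously differentiable away from the cutoff, with
bounded and (on each side) Lipschitz second derivative. -/
def SmoothMean {d : ℕ} (PX : Measure ℝ) (C L : ℝ) (κ : Kernel ℝ (Obs d)) (m : Obs d → ℝ) : Prop :=
  (∀ x ∈ PX.support, Integrable m (κ x)) ∧
  ContDiffOn ℝ 2 (condMean κ m) (interior PX.support \ {0}) ∧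
  (∀ x ∈ interior PX.support \ {0}, |iteratedDeriv 2 (condMean κ m) x| ≤ C) ∧
  SidedLipschitz L (iteratedDeriv 2 (condMean κ m)) (interior PX.support \ {0})

/-- The centred conditional absolute moment of order `q` exists and is bounded by `C`. -/
def BoundedMoment {d : ℕ} (PX : Measure ℝ) (C q : ℝ) (κ : Kernel ℝ (Obs d)) (m : Obs d → ℝ) :
    Prop :=
  ∀ x ∈ PX.support, Integrable (fun w => |m w - condMean κ m x| ^ q) (κ x) ∧
    condMean κ (fun w => |m w - condMean κ m x| ^ q) x ≤ C

/-- `V[m | X = x]` is Lipschitz on each side of the cutoff and bounded from below by `1 / C`. -/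
def RegularVariance {d : ℕ} (PX : Measure ℝ) (C L : ℝ) (κ : Kernel ℝ (Obs d)) (m : Obs d → ℝ) :
    Prop :=
  SidedLipschitz L (condVar κ m) (PX.support \ {0}) ∧
  ∀ x ∈ PX.support \ {0}, 1 / C ≤ condVar κ m x

/-- The regularity assumption on the adjusted outcome `m n = M(ηbar n)`; the constants do not depend
on the sample size. -/
def OutcomeAssumption {d : ℕ → ℕ} (PX : Measure ℝ) (κ : ∀ n, Kernel ℝ (Obs (d n)))
    (m : ∀ n, Obs (d n) → ℝ) : Prop :=
  ∃ C L q : ℝ, 0 < C ∧ 2 < q ∧ ∀ n, SmoothMean PX C L (κ n) (m n) ∧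
    BoundedMoment PX C q (κ n) (m n) ∧ RegularVariance PX C L (κ n) (m n)

/-! ### Long regressions and the class `𝓥` -/

/-- `μp` and `μm` are the limits `E[y | X = 0⁺, Z = ·]` and `E[y | X = 0⁻, Z = ·]` of a version `μ`
of the long regression `E[y | X = x, Z = z]`: pointwise in `z`, and in conditional mean square. -/
def IsLongLimit {d : ℕ} (PX : Measure ℝ) (κ : Kernel ℝ (Obs d)) (y : Obs d → ℝ)
    (μp μm : (Fin d → ℝ) → ℝ) : Prop :=
  Measurable μp ∧ Measurable μm ∧
  (∀ x ∈ PX.support, MemLp (onCovs μp) 2 (κ x) ∧ MemLp (onCovs μm) 2 (κ x)) ∧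
  ∃ μ : ℝ → (Fin d → ℝ) → ℝ,
    (∀ x, Measurable (μ x)) ∧
    (∀ x ∈ PX.support,
      onCovs (μ x) =ᵐ[κ x] (κ x)[y | MeasurableSpace.comap covs inferInstance]) ∧
    (∀ z, Tendsto (fun x => μ x z) (𝓝[>] 0) (𝓝 (μp z))) ∧
    (∀ z, Tendsto (fun x => μ x z) (𝓝[<] 0) (𝓝 (μm z))) ∧
    Tendsto (fun x => eLpNorm (onCovs (μ x - μp)) 2 (κ x)) (𝓝[>] 0) (𝓝 0) ∧
    Tendsto (fun x => eLpNorm (onCovs (μ x - μm)) 2 (κ x)) (𝓝[<] 0) (𝓝 0)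

/-- The optimal adjustment `η₀ = (μ⁺ + μ⁻) / 2`. -/
def optAdj {d : ℕ} (μp μm : (Fin d → ℝ) → ℝ) (z : Fin d → ℝ) : ℝ := (μp z + μm z) / 2

/-- The class `𝓥`: adjustment functions `η` such that `V[η(Z) | X = x]` and the conditional
covariances of `η(Z)` with `μ_Y^±(Z)` and `μ_T^±(Z)` exist and are continuous in `x`. -/
def varClass {d : ℕ} (PX : Measure ℝ) (κ : Kernel ℝ (Obs d))
    (μYp μYm μTp μTm : (Fin d → ℝ) → ℝ) : Set ((Fin d → ℝ) → ℝ) :=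
  {η | Measurable η ∧ (∀ x ∈ PX.support, MemLp (onCovs η) 2 (κ x)) ∧
    ContinuousOn (condVar κ (onCovs η)) PX.support ∧
    ContinuousOn (condCov κ (onCovs η) (onCovs μYp)) PX.support ∧
    ContinuousOn (condCov κ (onCovs η) (onCovs μYm)) PX.support ∧
    ContinuousOn (condCov κ (onCovs η) (onCovs μTp)) PX.support ∧
    ContinuousOn (condCov κ (onCovs η) (onCovs μTm)) PX.support}

/-- The pairs `(η_Y, η_T)` of functions in `𝓥` whose conditional covariance given `X = x` is
continuous in `x`. -/
def varPair {d : ℕ} (PX : Measure ℝ) (κ : Kernel ℝ (Obs d))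
    (μYp μYm μTp μTm ηY ηT : (Fin d → ℝ) → ℝ) : Prop :=
  ηY ∈ varClass PX κ μYp μYm μTp μTm ∧ ηT ∈ varClass PX κ μYp μYm μTp μTm ∧
    ContinuousOn (condCov κ (onCovs ηY) (onCovs ηT)) PX.support

/-- The conditional second moment of `y` is bounded uniformly in `x`. -/
def BoundedSecondMoment {d : ℕ} (PX : Measure ℝ) (κ : Kernel ℝ (Obs d)) (y : Obs d → ℝ) : Prop :=
  ∃ C : ℝ, ∀ x ∈ PX.support, Integrable (fun w => y w ^ 2) (κ x) ∧
    condMean κ (fun w => y w ^ 2) x ≤ C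

/-- `η_{Y,0}(Z) - θ η_{T,0}(Z) - (η_Y(Z) - θ η_T(Z))`, where `ηY0`, `ηT0` are the optimal
adjustments. -/
def adjGap {d : ℕ} (κ : Kernel ℝ (Obs d)) (ηY0 ηT0 ηY ηT : (Fin d → ℝ) → ℝ) (w : Obs d) : ℝ :=
  onCovs ηY0 w - fuzzyParam κ * onCovs ηT0 w - (onCovs ηY w - fuzzyParam κ * onCovs ηT w)

end

end FuzzyRD

/-! Part (i). On each side of the cutoff the local linear weights reproduce constants and annihilate
linear functions exactly. Fitted to the adjusted outcome at the target `ηbar`, the one-sided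
estimator is therefore its boundary value, plus a curvature term of order h², plus a weighted
average of the residuals `M - E[M | X]`. The empirical kernel moments converge in probability, so
the random weights in that average can be replaced by the deterministic equivalent kernel
(`DesignAssumption.side_expansion`).

The estimated adjustment enters through the gap between the cross-fitted function and `ηbar`. Given
the observations outside a fold this gap is a fixed function and the fold is i.i.d. Chebyshev's
inequality then replaces the fold average by its conditional mean, with an error of order r_n
(nh)^{-1/2} (`DesignAssumption.littleOP_fold`). The map from x to the conditional mean of the gap is
smooth through the cutoff and has small curvature on the window. Its contribution is thus its value
at 0 up to o_P(h² + (nh)^{-1/2}) (`DesignAssumption.side_firstStage`). That value is the same for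
the left and the right fit, so it cancels in the difference (`DesignAssumption.sharp_expansion`):
this is why no rate is required of the first stage.

Since τ_Y = θ τ_T, the error of the ratio is [(τ̂_Y - τ_Y) - θ(τ̂_T - τ_T)] / τ̂_T, and replacing
τ̂_T by τ_T costs only a negligible term (`DesignAssumption.fuzzy_expansion`). What remains is a
kernel-weighted i.i.d. sum of centred copies of U. It obeys a Lyapunov theorem for triangular
arrays, proved with characteristic functions (`tendstoInDistribution_row_sum_add`). Nothing relates
h² to (nh)^{-1/2}, so the remainder o_P(h² + (nh)^{-1/2}) cannot be assigned to one of the two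
scales in advance. It is split by clipping: one piece is a null sequence times h² and joins the
random bias B, the other is o_P((nh)^{-1/2}) and vanishes after standardization
(`abs_sub_clip_mul_le`).

Part (ii). Write g = η_Y - θ η_T. Conditioning on Z, the covariance of Y - θT with g(Z) tends to
that of μ_Y^± - θ μ_T^± with g(Z) at the cutoff (`tendsto_condCov_long`). Summing both sides gives a
constant, minus 4 Cov(g₀, g), plus 2 Var(g), where g₀ is the average of the two long regressions.
Completing the square yields a constant plus 2 Var(g₀ - g) (`varPair.asympVar_eq`), and both the
difference formula and the optimality of g₀ can be read off. -/

namespace FuzzyRD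

/-! ### Stochastic order symbols; only monotonicity and subadditivity are used for the bad events,
which need not be measurable. -/

section StochasticOrder

variable {Ω : ℕ → Type*} [∀ n, MeasurableSpace (Ω n)] {μ : ∀ n, Measure (Ω n)}

/-- `P n` holds with probability approaching one. -/
def Whp (μ : ∀ n, Measure (Ω n)) (P : ∀ n, Ω n → Prop) : Prop :=
  Tendsto (fun n => μ n {p | ¬ P n p}) atTop (𝓝 0)

/-- `R n = o_P(a n)`. -/
def LittleOP (μ : ∀ n, Measure (Ω n)) (R : ∀ n, Ω n → ℝ) (a : ℕ → ℝ) : Prop :=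
  ∀ ε > 0, Whp μ fun n p => |R n p| ≤ ε * a n

/-- `R n = O_P(a n)`. -/
def BigOP (μ : ∀ n, Measure (Ω n)) (R : ∀ n, Ω n → ℝ) (a : ℕ → ℝ) : Prop :=
  ∀ η : ENNReal, 0 < η → ∃ C > 0, ∀ᶠ n in atTop, μ n {p | ¬ |R n p| ≤ C * a n} ≤ η

theorem Whp.of_eventually {P : ∀ n, Ω n → Prop} (h : ∀ᶠ n in atTop, ∀ p, P n p) : Whp μ P := by
  refine tendsto_const_nhds.congr' ?_
  filter_upwards [h] with n hn
  simp [hn]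

theorem Whp.mono_eventually {P Q : ∀ n, Ω n → Prop} (hP : Whp μ P)
    (h : ∀ᶠ n in atTop, ∀ p, P n p → Q n p) : Whp μ Q := by
  refine tendsto_of_tendsto_of_tendsto_of_le_of_le' tendsto_const_nhds hP
    (Eventually.of_forall fun _ => zero_le) ?_
  filter_upwards [h] with n hn
  exact measure_mono fun p hp hq => hp (hn p hq)

theorem Whp.mono {P Q : ∀ n, Ω n → Prop} (hP : Whp μ P) (h : ∀ n p, P n p → Q n p) : Whp μ Q :=
  hP.mono_eventually (Eventually.of_forall h)

theorem Whp.and {P Q : ∀ n, Ω n → Prop} (hP : Whp μ P) (hQ : Whp μ Q) :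
    Whp μ fun n p => P n p ∧ Q n p := by
  have := hP.add hQ
  rw [add_zero] at this
  refine tendsto_of_tendsto_of_tendsto_of_le_of_le tendsto_const_nhds this
    (fun _ => zero_le) fun n => ?_
  refine (measure_mono ?_).trans (measure_union_le _ _)
  intro p hp
  simp only [mem_ofPred_eq, mem_union] at *
  tauto

theorem LittleOP.of_whp_le {R R' : ∀ n, Ω n → ℝ} {a : ℕ → ℝ} (hR : LittleOP μ R' a)
    (h : Whp μ fun n p => |R n p| ≤ |R' n p|) : LittleOP μ R a := fun ε hε =>
  ((hR ε hε).and h).mono fun _ _ hp => hp.2.trans hp.1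

theorem LittleOP.of_whp_eq {R R' : ∀ n, Ω n → ℝ} {a : ℕ → ℝ} (hR : LittleOP μ R' a)
    (h : Whp μ fun n p => R n p = R' n p) : LittleOP μ R a :=
  hR.of_whp_le (h.mono fun _ _ hp => by rw [hp])

theorem LittleOP.add {R S : ∀ n, Ω n → ℝ} {a : ℕ → ℝ} (hR : LittleOP μ R a)
    (hS : LittleOP μ S a) : LittleOP μ (fun n p => R n p + S n p) a := fun ε hε =>
  ((hR (ε / 2) (half_pos hε)).and (hS (ε / 2) (half_pos hε))).mono fun n p hp => by
    have := abs_add_le (R n p) (S n p)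
    linarith [hp.1, hp.2]

theorem LittleOP.neg {R : ∀ n, Ω n → ℝ} {a : ℕ → ℝ} (hR : LittleOP μ R a) :
    LittleOP μ (fun n p => -R n p) a := by
  simpa [LittleOP] using hR

theorem LittleOP.sub {R S : ∀ n, Ω n → ℝ} {a : ℕ → ℝ} (hR : LittleOP μ R a)
    (hS : LittleOP μ S a) : LittleOP μ (fun n p => R n p - S n p) a := by
  simpa [sub_eq_add_neg] using hR.add hS.neg

theorem LittleOP.zero {a : ℕ → ℝ} (ha : ∀ n, 0 ≤ a n) : LittleOP μ (fun _ _ => 0) a :=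
  fun ε hε => .of_eventually (Eventually.of_forall fun n _ => by
    rw [abs_zero]; exact mul_nonneg hε.le (ha n))

theorem LittleOP.sum {ι : Type*} (s : Finset ι) {R : ι → ∀ n, Ω n → ℝ} {a : ℕ → ℝ}
    (ha : ∀ n, 0 ≤ a n) (hR : ∀ i ∈ s, LittleOP μ (R i) a) :
    LittleOP μ (fun n p => ∑ i ∈ s, R i n p) a := by
  classical
  induction s using Finset.induction_on with
  | empty => simpa using LittleOP.zero ha
  | insert i s hi ih =>
    simp only [Finset.sum_insert hi]
    exact (hR i (by simp)).add (ih fun j hj => hR j (by simp [hj]))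

theorem LittleOP.mono_rate {R : ∀ n, Ω n → ℝ} {a b : ℕ → ℝ} {C : ℝ} (hR : LittleOP μ R a)
    (hC : 0 < C) (h : ∀ᶠ n in atTop, a n ≤ C * b n) : LittleOP μ R b := fun ε hε =>
  (hR (ε / C) (div_pos hε hC)).mono_eventually (h.mono fun n hn p hp => hp.trans (by
    calc ε / C * a n ≤ ε / C * (C * b n) := by gcongr
      _ = ε * b n := by field_simp))

theorem LittleOP.of_le_null {R : ∀ n, Ω n → ℝ} {a : ℕ → ℝ} {e : ℕ → ℝ} (he : Tendsto e atTop (𝓝 0))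
    (ha : ∀ n, 0 ≤ a n) (h : Whp μ fun n p => |R n p| ≤ e n * a n) : LittleOP μ R a := by
  intro ε hε
  refine h.mono_eventually ?_
  filter_upwards [he.eventually (ge_mem_nhds hε)] with n hn p hp
  exact hp.trans (by gcongr; exact ha n)

theorem LittleOP.bigOP {R : ∀ n, Ω n → ℝ} {a : ℕ → ℝ} (hR : LittleOP μ R a) : BigOP μ R a :=
  fun η hη => ⟨1, one_pos, (ENNReal.tendsto_nhds_zero.1 (hR 1 one_pos)) η hη⟩

theorem BigOP.of_whp_le {R R' : ∀ n, Ω n → ℝ} {a : ℕ → ℝ} (hR : BigOP μ R' a)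
    (h : Whp μ fun n p => |R n p| ≤ |R' n p|) : BigOP μ R a := by
  intro η hη
  obtain ⟨C, hC, h1⟩ := hR (η / 2) (ENNReal.half_pos hη.ne')
  refine ⟨C, hC, ?_⟩
  filter_upwards [h1, (ENNReal.tendsto_nhds_zero.1 h) (η / 2) (ENNReal.half_pos hη.ne')]
    with n h1 h2
  calc _ ≤ μ n ({p | ¬ |R' n p| ≤ C * a n} ∪ {p | ¬ |R n p| ≤ |R' n p|}) :=
        measure_mono fun p hp => by
          by_contra hc
          simp only [mem_union, mem_ofPred_eq, not_or, not_not] at hc hp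
          exact hp (hc.2.trans hc.1)
    _ ≤ η / 2 + η / 2 := (measure_union_le _ _).trans (add_le_add h1 h2)
    _ = η := ENNReal.add_halves η

theorem BigOP.of_bounded {R : ∀ n, Ω n → ℝ} {a : ℕ → ℝ} {C : ℝ} (hC : 0 < C)
    (h : Whp μ fun n p => |R n p| ≤ C * a n) : BigOP μ R a :=
  fun η hη => ⟨C, hC, (ENNReal.tendsto_nhds_zero.1 h) η hη⟩

theorem BigOP.add {R S : ∀ n, Ω n → ℝ} {a : ℕ → ℝ} (hR : BigOP μ R a) (hS : BigOP μ S a) :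
    BigOP μ (fun n p => R n p + S n p) a := by
  intro η hη
  obtain ⟨C, hC, h1⟩ := hR (η / 2) (ENNReal.half_pos hη.ne')
  obtain ⟨D, hD, h2⟩ := hS (η / 2) (ENNReal.half_pos hη.ne')
  refine ⟨C + D, by positivity, ?_⟩
  filter_upwards [h1, h2] with n h1 h2
  calc _ ≤ μ n ({p | ¬ |R n p| ≤ C * a n} ∪ {p | ¬ |S n p| ≤ D * a n}) :=
        measure_mono fun p hp => by
          by_contra hc
          simp only [mem_union, mem_ofPred_eq, not_or, not_not] at hc hp
          have := abs_add_le (R n p) (S n p)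
          exact hp (by linarith [hc.1, hc.2])
    _ ≤ η / 2 + η / 2 := (measure_union_le _ _).trans (add_le_add h1 h2)
    _ = η := ENNReal.add_halves η

theorem BigOP.sub {R S : ∀ n, Ω n → ℝ} {a : ℕ → ℝ} (hR : BigOP μ R a) (hS : BigOP μ S a) :
    BigOP μ (fun n p => R n p - S n p) a := by
  have : BigOP μ (fun n p => -S n p) a := fun η hη => by simpa only [abs_neg] using hS η hη
  simpa only [sub_eq_add_neg] using hR.add this

theorem BigOP.mono_rate {R : ∀ n, Ω n → ℝ} {a b : ℕ → ℝ} (hR : BigOP μ R a)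
    (hab : ∀ n, a n ≤ b n) : BigOP μ R b := by
  intro η hη
  obtain ⟨C, hC, h1⟩ := hR η hη
  refine ⟨C, hC, ?_⟩
  filter_upwards [h1] with n hn
  refine (measure_mono fun p hp => ?_).trans hn
  exact fun hc => hp (hc.trans (mul_le_mul_of_nonneg_left (hab n) hC.le))

theorem BigOP.mul {R S : ∀ n, Ω n → ℝ} {a b : ℕ → ℝ} (hR : BigOP μ R a) (hS : BigOP μ S b) :
    BigOP μ (fun n p => R n p * S n p) (fun n => a n * b n) := by
  intro η hη
  obtain ⟨C, hC, h1⟩ := hR (η / 2) (ENNReal.half_pos hη.ne')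
  obtain ⟨D, hD, h2⟩ := hS (η / 2) (ENNReal.half_pos hη.ne')
  refine ⟨C * D, by positivity, ?_⟩
  filter_upwards [h1, h2] with n h1 h2
  calc _ ≤ μ n ({p | ¬ |R n p| ≤ C * a n} ∪ {p | ¬ |S n p| ≤ D * b n}) :=
        measure_mono fun p hp => by
          by_contra hc
          simp only [mem_union, mem_ofPred_eq, not_or, not_not] at hc hp
          refine hp ?_
          rw [abs_mul]
          calc _ ≤ (C * a n) * (D * b n) := mul_le_mul hc.1 hc.2 (abs_nonneg _)
                ((abs_nonneg _).trans hc.1)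
            _ = _ := by ring
    _ ≤ η / 2 + η / 2 := (measure_union_le _ _).trans (add_le_add h1 h2)
    _ = η := ENNReal.add_halves η

theorem BigOP.littleOP {R : ∀ n, Ω n → ℝ} {a b : ℕ → ℝ} (hR : BigOP μ R a)
    (h : ∀ ε > 0, ∀ᶠ n in atTop, a n ≤ ε * b n) : LittleOP μ R b := by
  intro ε hε
  refine ENNReal.tendsto_nhds_zero.2 fun η hη => ?_
  obtain ⟨C, hC, h1⟩ := hR η hη
  filter_upwards [h1, h (ε / C) (by positivity)] with n h1 h2
  refine (measure_mono ?_).trans h1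
  intro p hp hc
  refine hp (hc.trans ?_)
  calc C * a n ≤ C * (ε / C * b n) := by gcongr
    _ = ε * b n := by field_simp

theorem LittleOP.mul_bigOP {R S : ∀ n, Ω n → ℝ} {a b : ℕ → ℝ} (hR : LittleOP μ R a)
    (hS : BigOP μ S b) : LittleOP μ (fun n p => R n p * S n p) (fun n => a n * b n) := by
  intro ε hε
  refine ENNReal.tendsto_nhds_zero.2 fun η hη => ?_
  obtain ⟨D, hD, h2⟩ := hS (η / 2) (ENNReal.half_pos hη.ne')
  filter_upwards [h2, (ENNReal.tendsto_nhds_zero.1 (hR (ε / D) (by positivity))) (η / 2)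
    (ENNReal.half_pos hη.ne')] with n h2 h1
  calc _ ≤ μ n ({p | ¬ |R n p| ≤ ε / D * a n} ∪ {p | ¬ |S n p| ≤ D * b n}) :=
        measure_mono fun p hp => by
          by_contra hc
          simp only [mem_union, mem_ofPred_eq, not_or, not_not] at hc hp
          refine hp ?_
          rw [abs_mul]
          calc _ ≤ (ε / D * a n) * (D * b n) := mul_le_mul hc.1 hc.2 (abs_nonneg _)
                ((abs_nonneg _).trans hc.1)
            _ = _ := by field_simp
    _ ≤ η / 2 + η / 2 := (measure_union_le _ _).trans (add_le_add h1 h2)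
    _ = η := ENNReal.add_halves η

theorem BigOP.const {c : ℕ → ℝ} {C : ℝ} (h : ∀ n, |c n| ≤ C) :
    BigOP μ (fun n _ => c n) (fun _ => 1) := by
  refine .of_bounded (C := |C| + 1) (by positivity) (.of_eventually (Eventually.of_forall ?_))
  intro n _
  linarith [h n, le_abs_self C]

theorem LittleOP.const_mul {R : ∀ n, Ω n → ℝ} {a : ℕ → ℝ} (hR : LittleOP μ R a)
    {c : ℕ → ℝ} {C : ℝ} (h : ∀ n, |c n| ≤ C) : LittleOP μ (fun n p => c n * R n p) a := by
  simpa [mul_comm] using hR.mul_bigOP (BigOP.const h)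

theorem LittleOP.of_tendsto {c : ℕ → ℝ} (h : Tendsto c atTop (𝓝 0)) :
    LittleOP μ (fun n _ => c n) (fun _ => 1) := fun ε hε =>
  .of_eventually (by
    filter_upwards [(tendsto_zero_iff_abs_tendsto_zero c).1 h |>.eventually (ge_mem_nhds hε)]
      with n hn p
    simpa using hn)

theorem LittleOP.bigOP_of_sub {R : ∀ n, Ω n → ℝ} {c : ℕ → ℝ} {C : ℝ}
    (hR : LittleOP μ (fun n p => R n p - c n) (fun _ => 1)) (h : ∀ n, |c n| ≤ C) :
    BigOP μ R (fun _ => 1) := by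
  simpa using hR.bigOP.add (BigOP.const h)

theorem LittleOP.mul_sub {R S : ∀ n, Ω n → ℝ} {c d : ℕ → ℝ} {C D : ℝ}
    (hR : LittleOP μ (fun n p => R n p - c n) (fun _ => 1)) (hc : ∀ n, |c n| ≤ C)
    (hS : LittleOP μ (fun n p => S n p - d n) (fun _ => 1)) (hd : ∀ n, |d n| ≤ D) :
    LittleOP μ (fun n p => R n p * S n p - c n * d n) (fun _ => 1) := by
  have h1 := hR.mul_bigOP (hS.bigOP_of_sub hd)
  have h2 := hS.const_mul hc
  simp only [mul_one] at h1
  convert h1.add h2 using 3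
  ring

theorem LittleOP.inv_sub {R : ∀ n, Ω n → ℝ} {c : ℕ → ℝ} {c₀ : ℝ} (hc₀ : 0 < c₀)
    (hR : LittleOP μ (fun n p => R n p - c n) (fun _ => 1)) (hc : ∀ n, c₀ ≤ |c n|) :
    LittleOP μ (fun n p => (R n p)⁻¹ - (c n)⁻¹) (fun _ => 1) := by
  intro ε hε
  -- Being within c₀/2 of c keeps |R| above c₀/2. Then 1/R - 1/c = (c - R)/(Rc) has a denominator of
  -- size at least c₀²/2, which fixes the second tolerance.
  refine ((hR (c₀ / 2) (by positivity)).and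
    (hR (ε * (c₀ * c₀ / 2)) (by positivity))).mono fun n p hp => ?_
  obtain ⟨h1, h2⟩ := hp
  simp only [mul_one] at h1 h2 ⊢
  have hcn := hc n
  have hRn : c₀ / 2 ≤ |R n p| := by
    have := abs_sub_abs_le_abs_sub (c n) (R n p)
    rw [abs_sub_comm] at this
    linarith
  have e1 : c n ≠ 0 := fun h => by rw [h, abs_zero] at hcn; linarith
  have e2 : R n p ≠ 0 := fun h => by rw [h, abs_zero] at hRn; linarith
  rw [inv_sub_inv e2 e1, abs_div, abs_mul, abs_sub_comm, div_le_iff₀ (by positivity)]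
  refine h2.trans ?_
  have : c₀ * c₀ / 2 ≤ |R n p| * |c n| := by nlinarith
  gcongr

theorem LittleOP.whp_ne_zero {R : ∀ n, Ω n → ℝ} {c : ℕ → ℝ} {c₀ : ℝ} (hc₀ : 0 < c₀)
    (hR : LittleOP μ (fun n p => R n p - c n) (fun _ => 1)) (hc : ∀ n, c₀ ≤ |c n|) :
    Whp μ fun n p => R n p ≠ 0 :=
  (hR (c₀ / 2) (by positivity)).mono fun n p hp h0 => by
    have := hc n
    simp only [mul_one] at hp
    rw [h0, zero_sub, abs_neg] at hp
    linarith

/-- A remainder that is `o_P(a n)` is bounded, with probability approaching one, by `e n * a n` for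
a deterministic null sequence `e`. -/
theorem LittleOP.exists_rate [∀ n, IsProbabilityMeasure (μ n)] {R : ∀ n, Ω n → ℝ} {a : ℕ → ℝ}
    (ha : ∀ n, 0 ≤ a n) (hR : LittleOP μ R a) :
    ∃ e : ℕ → ℝ, (∀ n, 0 ≤ e n) ∧ Tendsto e atTop (𝓝 0) ∧
      Whp μ fun n p => |R n p| ≤ e n * a n := by
  let A : ℕ → Set ℝ := fun n => {e | 0 ≤ e ∧ μ n {p | ¬ |R n p| ≤ e * a n} ≤ ENNReal.ofReal e}
  have hne : ∀ n, (A n).Nonempty := fun n => ⟨1, zero_le_one, by simpa using prob_le_one⟩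
  have hbdd : ∀ n, BddBelow (A n) := fun n => ⟨0, fun _ h => h.1⟩
  have hup : ∀ n, ∀ x ∈ A n, ∀ y, x ≤ y → y ∈ A n := fun n x hx y hxy =>
    ⟨hx.1.trans hxy, by
      refine le_trans (measure_mono ?_) (hx.2.trans (ENNReal.ofReal_le_ofReal hxy))
      intro p hp hc
      exact hp (hc.trans (mul_le_mul_of_nonneg_right hxy (ha n)))⟩
  have hpos : ∀ n, 0 ≤ sInf (A n) := fun n => le_csInf (hne n) fun _ h => h.1
  have hlim : Tendsto (fun n => sInf (A n)) atTop (𝓝 0) := by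
    refine tendsto_order.2 ⟨fun x hx => Eventually.of_forall fun n => hx.trans_le (hpos n),
      fun x hx => ?_⟩
    have := (ENNReal.tendsto_nhds_zero.1 (hR (x / 2) (by positivity))) (ENNReal.ofReal (x / 2))
      (by simpa using hx)
    filter_upwards [this] with n hn
    exact (csInf_le (hbdd n) ⟨by positivity, hn⟩).trans_lt (by linarith)
  have hlim' : Tendsto (fun n : ℕ => sInf (A n) + 1 / ((n : ℝ) + 1)) atTop (𝓝 0) := by
    simpa using hlim.add tendsto_one_div_add_atTop_nhds_zero_nat
  have hmem : ∀ n : ℕ, sInf (A n) + 1 / ((n : ℝ) + 1) ∈ A n := fun n => by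
    obtain ⟨x, hx, hlt⟩ := exists_lt_of_csInf_lt (hne n)
      (show sInf (A n) < sInf (A n) + 1 / ((n : ℝ) + 1) by
        have : (0 : ℝ) < 1 / ((n : ℝ) + 1) := by positivity
        linarith)
    exact hup n x hx _ hlt.le
  refine ⟨_, fun n => (hmem n).1, hlim', ?_⟩
  refine tendsto_of_tendsto_of_tendsto_of_le_of_le tendsto_const_nhds
    (by simpa using (ENNReal.tendsto_ofReal hlim')) (fun _ => zero_le) fun n => (hmem n).2

end StochasticOrder

/-! ### A Lyapunov central limit theorem for i.i.d. rows -/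

section CentralLimit

/-- For |x| ≤ 1 the cubic Taylor remainder is at most |x|^q because q ≤ 3. For |x| > 1 the terms are
bounded separately, each being at most a multiple of |x|^q because q > 2. Moments of any order above
two thus suffice in the limit theorem. -/
theorem norm_exp_mul_I_sub_quadratic_le (x q : ℝ) (hq2 : 2 < q) (hq3 : q ≤ 3) :
    ‖Complex.exp (x * Complex.I) - (1 + x * Complex.I - x ^ 2 / 2)‖ ≤ 4 * |x| ^ q := by
  rcases le_or_gt |x| 1 with hx | hx
  · have h1 : ‖(x * Complex.I : ℂ)‖ ≤ 1 := by simpa using hx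
    have h := Complex.exp_bound h1 (n := 3) (by norm_num)
    have e : ∑ m ∈ Finset.range 3, (x * Complex.I : ℂ) ^ m / (m.factorial : ℂ) =
        1 + x * Complex.I - x ^ 2 / 2 := by
      simp [Finset.sum_range_succ, Nat.factorial, mul_pow]
      ring
    rw [e] at h
    have h3 : |x| ^ 3 ≤ |x| ^ q := by
      rw [← Real.rpow_natCast]
      exact Real.rpow_le_rpow_of_exponent_ge_of_imp (abs_nonneg x) hx (by simpa using hq3)
        (by intro h; simp)
    have h4 : ‖(x * Complex.I : ℂ)‖ = |x| := by simp
    rw [h4] at h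
    refine h.trans ?_
    have : (0 : ℝ) ≤ |x| ^ 3 := by positivity
    norm_num [Nat.factorial]
    linarith
  · have h1 : ‖Complex.exp (x * Complex.I)‖ = 1 := Complex.norm_exp_ofReal_mul_I x
    have h2 : ‖(1 + x * Complex.I - x ^ 2 / 2 : ℂ)‖ ≤ 1 + |x| + |x| ^ 2 / 2 := by
      refine (norm_sub_le _ _).trans (add_le_add ((norm_add_le _ _).trans ?_) ?_)
      · simp
      · simp
    have h3 : |x| ^ 2 ≤ |x| ^ q := by
      rw [← Real.rpow_natCast]
      exact Real.rpow_le_rpow_of_exponent_le hx.le (by simpa using hq2.le)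
    refine (norm_sub_le _ _).trans ?_
    rw [h1]
    nlinarith

/-- The pointwise quadratic bound is integrated; the linear term drops out because ξ has mean zero.
-/
theorem norm_integral_exp_sub_le {D : Type*} [MeasurableSpace D] {P : Measure D}
    [IsProbabilityMeasure P] {ξ : D → ℝ} {q : ℝ} (hq2 : 2 < q) (hq3 : q ≤ 3) (hξ : MemLp ξ 2 P)
    (hξq : Integrable (fun w => |ξ w| ^ q) P) (h0 : ∫ w, ξ w ∂P = 0) (t : ℝ) :
    ‖(∫ w, Complex.exp (t * ξ w * Complex.I) ∂P) - (1 - t ^ 2 / 2 * ∫ w, ξ w ^ 2 ∂P)‖ ≤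
      4 * |t| ^ q * ∫ w, |ξ w| ^ q ∂P := by
  have i1 : Integrable ξ P := hξ.integrable (by norm_num)
  have i2 : Integrable (fun w => ξ w ^ 2) P := hξ.integrable_sq
  have ie : Integrable (fun w => Complex.exp (t * ξ w * Complex.I)) P := by
    refine Integrable.of_bound (C := 1) ?_ (Eventually.of_forall fun w => ?_)
    · have := i1.aestronglyMeasurable.aemeasurable
      exact AEMeasurable.aestronglyMeasurable (by fun_prop)
    · have := Complex.norm_exp_ofReal_mul_I (t * ξ w)
      push_cast at this
      exact this.le
  have key : (∫ w, (1 + (t * ξ w : ℝ) * Complex.I - ((t * ξ w : ℝ) : ℂ) ^ 2 / 2) ∂P) =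
      1 - t ^ 2 / 2 * ((∫ w, ξ w ^ 2 ∂P : ℝ) : ℂ) := by
    have e1 : (fun w => (1 + (t * ξ w : ℝ) * Complex.I - ((t * ξ w : ℝ) : ℂ) ^ 2 / 2)) =
        fun w => (1 : ℂ) + (t * Complex.I) * (ξ w : ℂ) - (t ^ 2 / 2 : ℂ) * ((ξ w ^ 2 : ℝ) : ℂ) := by
      funext w; push_cast; ring
    rw [e1, integral_sub, integral_add, integral_const_mul, integral_const_mul,
      integral_complex_ofReal, integral_complex_ofReal, h0]
    · simp
    · exact integrable_const _
    · exact i1.ofReal.const_mul _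
    · exact (integrable_const _).add (i1.ofReal.const_mul _)
    · exact i2.ofReal.const_mul _
  have iq : Integrable (fun w => (1 + (t * ξ w : ℝ) * Complex.I -
      ((t * ξ w : ℝ) : ℂ) ^ 2 / 2)) P := by
    have e1 : (fun w => (1 + (t * ξ w : ℝ) * Complex.I - ((t * ξ w : ℝ) : ℂ) ^ 2 / 2)) =
        fun w => (1 : ℂ) + (t * Complex.I) * (ξ w : ℂ) - (t ^ 2 / 2 : ℂ) * ((ξ w ^ 2 : ℝ) : ℂ) := by
      funext w; push_cast; ring
    rw [e1]
    exact ((integrable_const _).add (i1.ofReal.const_mul _)).sub (i2.ofReal.const_mul _)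
  rw [← key, ← integral_sub ie iq, ← integral_const_mul]
  refine norm_integral_le_of_norm_le (hξq.const_mul _) (Eventually.of_forall fun w => ?_)
  have := norm_exp_mul_I_sub_quadratic_le (t * ξ w) q hq2 hq3
  rw [abs_mul, Real.mul_rpow (abs_nonneg _) (abs_nonneg _), ← mul_assoc] at this
  push_cast at this ⊢
  exact this

variable {D : ℕ → Type*} [∀ n, MeasurableSpace (D n)] {Ω : ℕ → Type*}
  [∀ n, MeasurableSpace (Ω n)]

theorem charFun_map_row_sum {D : Type*} [MeasurableSpace D] {n : ℕ} (P : Measure D)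
    [IsProbabilityMeasure P] {ξ : D → ℝ} (hξ : Measurable ξ) (t : ℝ) :
    charFun ((Measure.pi fun _ : Fin n => P).map fun w => ∑ i, ξ (w i)) t =
      (∫ w, Complex.exp (t * ξ w * Complex.I) ∂P) ^ n := by
  have : IsProbabilityMeasure (P.map ξ) := Measure.isProbabilityMeasure_map hξ.aemeasurable
  have h := congrFun (charFun_map_sum_pi_eq_prod (fun _ : Fin n => P.map ξ)) t
  rw [← Measure.pi_map_pi (fun _ => hξ.aemeasurable),
    Measure.map_map (by fun_prop) (by fun_prop)] at h
  rw [Finset.prod_const, Finset.card_univ, Fintype.card_fin, Pi.pow_apply,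
    charFun_apply_real (μ := P.map ξ), integral_map hξ.aemeasurable] at h
  · exact h
  · exact Measurable.aestronglyMeasurable (by fun_prop)

/-- Lyapunov central limit theorem for arrays whose rows are i.i.d., with an asymptotically
negligible remainder. -/
theorem tendstoInDistribution_row_sum_add (P : ∀ n, Measure (D n)) [∀ n, IsProbabilityMeasure (P n)]
    (μ : ∀ n, Measure (Ω n)) [∀ n, IsProbabilityMeasure (μ n)] (π : ∀ n, Ω n → Fin n → D n)
    (hπ : ∀ n, MeasurePreserving (π n) (μ n) (Measure.pi fun _ => P n))
    {ξ : ∀ n, D n → ℝ} {q : ℝ} (hq2 : 2 < q) (hq3 : q ≤ 3) (hξm : ∀ n, Measurable (ξ n))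
    (hξ : ∀ᶠ n in atTop, MemLp (ξ n) 2 (P n))
    (hξq : ∀ᶠ n in atTop, Integrable (fun w => |ξ n w| ^ q) (P n))
    (h0 : ∀ᶠ n in atTop, ∫ w, ξ n w ∂(P n) = 0)
    (hvar : Tendsto (fun n : ℕ => n * ∫ w, ξ n w ^ 2 ∂(P n)) atTop (𝓝 1))
    (hlyap : Tendsto (fun n : ℕ => n * ∫ w, |ξ n w| ^ q ∂(P n)) atTop (𝓝 0))
    {X : ∀ n, Ω n → ℝ} (hX : ∀ n, Measurable (X n))
    (hR : LittleOP μ (fun n p => X n p - ∑ i, ξ n (π n p i)) fun _ => 1) :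
    TendstoInDistribution X atTop id μ (gaussianReal 0 1) := by
  refine ⟨fun n => (hX n).aemeasurable, aemeasurable_id, ?_⟩
  refine ProbabilityMeasure.tendsto_iff_tendsto_charFun.2 fun t => ?_
  simp only [ProbabilityMeasure.coe_mk, Measure.map_id]
  rw [charFun_gaussianReal]
  have hS : ∀ n, Measurable fun p => ∑ i, ξ n (π n p i) := fun n =>
    Finset.measurable_sum _ fun i _ => (hξm n).comp
      ((measurable_pi_apply i).comp (hπ n).measurable)
  have hmain : Tendsto (fun n => charFun ((μ n).map fun p => ∑ i, ξ n (π n p i)) t) atTop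
      (𝓝 (Complex.exp (t * (0 : ℝ) * Complex.I - (1 : NNReal) * t ^ 2 / 2))) := by
    -- With each factor written as 1 + z_n, it suffices that n z_n converges, and no complex
    -- logarithm is needed. The limit of n z_n comes from the variance condition, and the Taylor
    -- error is controlled by the Lyapunov condition.
    have e : ∀ n, charFun ((μ n).map fun p => ∑ i, ξ n (π n p i)) t =
        (1 + ((∫ w, Complex.exp (t * ξ n w * Complex.I) ∂(P n)) - 1)) ^ n := fun n => by
      rw [add_sub_cancel, ← charFun_map_row_sum (P n) (hξm n), ← (hπ n).map_eq,
        Measure.map_map _ (hπ n).measurable]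
      · rfl
      · exact Finset.measurable_sum _ fun i _ => (hξm n).comp (measurable_pi_apply i)
    simp_rw [e]
    refine Complex.tendsto_one_add_pow_exp_of_tendsto ?_
    have lim1 : Tendsto (fun n : ℕ => -(t ^ 2 / 2 : ℂ) *
        ((n * ∫ w, ξ n w ^ 2 ∂(P n) : ℝ) : ℂ)) atTop (𝓝 (-(t ^ 2 / 2 : ℂ) * ((1 : ℝ) : ℂ))) :=
      ((Complex.continuous_ofReal.tendsto 1).comp hvar).const_mul _
    have lim2 : Tendsto (fun n : ℕ => (n : ℂ) * ((∫ w, Complex.exp (t * ξ n w * Complex.I) ∂(P n)) -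
        (1 - t ^ 2 / 2 * ∫ w, ξ n w ^ 2 ∂(P n)))) atTop (𝓝 0) := by
      refine squeeze_zero_norm' (a := fun n : ℕ => 4 * |t| ^ q * (n * ∫ w, |ξ n w| ^ q ∂(P n)))
        ?_ (by simpa using hlyap.const_mul (4 * |t| ^ q))
      filter_upwards [hξ, hξq, h0] with n h1 h2 h3
      have := norm_integral_exp_sub_le hq2 hq3 h1 h2 h3 t
      rw [norm_mul, Complex.norm_natCast]
      calc _ ≤ (n : ℝ) * (4 * |t| ^ q * ∫ w, |ξ n w| ^ q ∂(P n)) :=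
            mul_le_mul_of_nonneg_left this (by positivity)
        _ = _ := by ring
    convert lim1.add lim2 using 2
    · push_cast; ring
    · push_cast; ring_nf
  have hdiff : Tendsto (fun n => charFun ((μ n).map (X n)) t -
      charFun ((μ n).map fun p => ∑ i, ξ n (π n p i)) t) atTop (𝓝 0) := by
    rw [Metric.tendsto_atTop']
    intro ε hε
    -- Off the bad event the two exponentials differ by at most |t| times this threshold, hence by
    -- at most ε/4. On it they differ by at most 2, and its probability is at most ε/8. Together
    -- this is ε/2.
    have hδ : 0 < ε / (4 * (|t| + 1)) := by positivity
    have hev := (ENNReal.tendsto_nhds_zero.1 (hR _ hδ)) (ENNReal.ofReal (ε / 8)) (by simpa using hε)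
    obtain ⟨N, hN⟩ := eventually_atTop.1 hev
    refine ⟨N, fun n hn => ?_⟩
    have hb := hN n hn.le
    simp only [mul_one] at hb
    rw [dist_zero_right]
    rw [charFun_apply_real, charFun_apply_real, integral_map (hX n).aemeasurable
      (Measurable.aestronglyMeasurable (by fun_prop)), integral_map (hS n).aemeasurable
      (Measurable.aestronglyMeasurable (by fun_prop))]
    have hint : ∀ Y : Ω n → ℝ, Measurable Y →
        Integrable (fun p => Complex.exp (t * Y p * Complex.I)) (μ n) := fun Y hY => by
      refine Integrable.of_bound (C := 1) (Measurable.aestronglyMeasurable (by fun_prop))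
        (Eventually.of_forall fun p => ?_)
      have := Complex.norm_exp_ofReal_mul_I (t * Y p)
      push_cast at this
      exact this.le
    rw [← integral_sub (hint _ (hX n)) (hint _ (hS n))]
    set B := {p | ¬ |X n p - ∑ i, ξ n (π n p i)| ≤ ε / (4 * (|t| + 1))} with hB
    have hBm : MeasurableSet B := by
      have : Measurable fun p => |X n p - ∑ i, ξ n (π n p i)| := ((hX n).sub (hS n)).abs
      exact (measurableSet_le this measurable_const).compl
    have hbound : ∀ p, ‖Complex.exp (t * X n p * Complex.I) -
        Complex.exp (t * (∑ i, ξ n (π n p i) : ℝ) * Complex.I)‖ ≤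
        ε / 4 + B.indicator (fun _ => 2) p := fun p => by
      have hn1 : ∀ y : ℝ, ‖Complex.exp (t * y * Complex.I)‖ = 1 := fun y => by
        have := Complex.norm_exp_ofReal_mul_I (t * y)
        push_cast at this
        exact this
      by_cases hp : p ∈ B
      · rw [indicator_of_mem hp]
        refine (norm_sub_le _ _).trans ?_
        rw [hn1, hn1]
        linarith
      · rw [indicator_of_notMem hp, add_zero]
        simp only [hB, mem_ofPred_eq, not_not] at hp
        have e : Complex.exp (t * X n p * Complex.I) -
            Complex.exp (t * (∑ i, ξ n (π n p i) : ℝ) * Complex.I) =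
            Complex.exp (t * (∑ i, ξ n (π n p i) : ℝ) * Complex.I) *
            (Complex.exp (Complex.I * ((t * (X n p - ∑ i, ξ n (π n p i)) : ℝ))) - 1) := by
          rw [mul_sub, ← Complex.exp_add, mul_one]
          congr 2
          push_cast
          ring
        rw [e, norm_mul, hn1, one_mul]
        refine (Real.norm_exp_I_mul_ofReal_sub_one_le).trans ?_
        rw [Real.norm_eq_abs, abs_mul]
        calc |t| * _ ≤ (|t| + 1) * (ε / (4 * (|t| + 1))) := by gcongr; linarith
          _ = ε / 4 := by field_simp
    have : ‖∫ p, (Complex.exp (t * X n p * Complex.I) -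
        Complex.exp (t * (∑ i, ξ n (π n p i) : ℝ) * Complex.I)) ∂(μ n)‖ ≤
        ∫ p, (ε / 4 + B.indicator (fun _ => 2) p) ∂(μ n) :=
      norm_integral_le_of_norm_le ((integrable_const _).add
        ((integrable_const _).indicator hBm)) (Eventually.of_forall hbound)
    refine this.trans_lt ?_
    rw [integral_add (integrable_const _) ((integrable_const _).indicator hBm),
      integral_indicator_const _ hBm]
    have : (μ n).real B ≤ ε / 8 := ENNReal.toReal_le_of_le_ofReal (by positivity) hb
    simp
    linarith
  simpa using hdiff.add hmain

end CentralLimit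

/-! ### Chebyshev bound for i.i.d. sums -/

section SecondMoment

/-- Chebyshev's inequality for i.i.d. sums. -/
theorem pi_sum_sub_le {D ι : Type*} [MeasurableSpace D] [Fintype ι] (P : Measure D)
    [IsProbabilityMeasure P] {f : D → ℝ} (hf : MemLp f 2 P) {B t : ℝ}
    (hB : ∫ w, f w ^ 2 ∂P ≤ B) (ht : 0 < t) :
    (Measure.pi fun _ : ι => P) {w | ¬ |∑ i, f (w i) - Fintype.card ι * ∫ w, f w ∂P| ≤ t} ≤
      ENNReal.ofReal (Fintype.card ι * B / t ^ 2) := by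
  have hmem : ∀ i : ι, MemLp (fun w : ι → D => f (w i)) 2 (Measure.pi fun _ : ι => P) := fun i =>
    hf.comp_measurePreserving (measurePreserving_eval _ i)
  have hsum : MemLp (∑ i, fun w : ι → D => f (w i)) 2 (Measure.pi fun _ : ι => P) :=
    memLp_finsetSum' _ fun i _ => hmem i
  have hE : ∫ w, (∑ i, fun w : ι → D => f (w i)) w ∂(Measure.pi fun _ : ι => P) =
      Fintype.card ι * ∫ w, f w ∂P := by
    simp only [Finset.sum_apply]
    rw [integral_finsetSum _ fun i _ => (hmem i).integrable (by norm_num)]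
    have : ∀ i : ι, ∫ w : ι → D, f (w i) ∂(Measure.pi fun _ : ι => P) = ∫ w, f w ∂P := fun i => by
      have h := (measurePreserving_eval (fun _ : ι => P) i)
      conv_rhs => rw [← h.map_eq]
      rw [integral_map h.measurable.aemeasurable]
      rw [h.map_eq]; exact hf.aestronglyMeasurable
    simp [this]
  have h1 := meas_ge_le_variance_div_sq hsum ht
  rw [hE, variance_sum_pi (fun _ => hf)] at h1
  refine (measure_mono ?_).trans (h1.trans (ENNReal.ofReal_le_ofReal ?_))
  · intro w hw
    simp only [mem_ofPred_eq, not_le, Finset.sum_apply] at hw ⊢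
    exact hw.le
  · have : Var[f; P] ≤ B := (variance_le_expectation_sq hf.aestronglyMeasurable).trans hB
    simp only [Finset.sum_const, Finset.card_univ, nsmul_eq_mul]
    gcongr

end SecondMoment

/-! ### One-sided Taylor expansions -/

section Calculus

theorem iteratedDeriv_two_eq (f : ℝ → ℝ) : iteratedDeriv 2 f = deriv (deriv f) := by
  rw [show (2 : ℕ) = 1 + 1 from rfl, iteratedDeriv_succ, iteratedDeriv_one]

/-- A Lipschitz function on (0, ε) extends continuously to the end point, and letting y tend to 0 in
the hypothesis turns L x^k (x - y) into L x^{k+1}. The weight x^k lets the lemma be iterated with k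
= 0, 1, 2, each use gaining one order. -/
theorem exists_right_limit_of_pow_lipschitz {g : ℝ → ℝ} {ε L : ℝ} (hε : 0 < ε) (hL : 0 ≤ L) (k : ℕ)
    (hg : ∀ x ∈ Ioo 0 ε, ∀ y ∈ Ioo 0 ε, y < x → |g x - g y| ≤ L * x ^ k * (x - y)) :
    ∃ l, Tendsto g (𝓝[>] 0) (𝓝 l) ∧ ∀ x ∈ Ioo 0 ε, |g x - l| ≤ L * x ^ (k + 1) := by
  have hmem : Ioo (0 : ℝ) ε ∈ 𝓝[>] (0 : ℝ) := Ioo_mem_nhdsGT hε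
  have hlip : LipschitzOnWith (L * ε ^ k).toNNReal g (Ioo 0 ε) := by
    have aux : ∀ x ∈ Ioo 0 ε, ∀ y ∈ Ioo 0 ε, y < x → |g x - g y| ≤ L * ε ^ k * (x - y) :=
      fun x hx y hy hyx => (hg x hx y hy hyx).trans (by
        have := pow_le_pow_left₀ hx.1.le hx.2.le k
        have := sub_nonneg.2 hyx.le
        gcongr)
    refine LipschitzOnWith.of_dist_le_mul fun x hx y hy => ?_
    rw [Real.coe_toNNReal _ (by positivity), Real.dist_eq, Real.dist_eq]
    rcases lt_trichotomy x y with hxy | hxy | hxy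
    · rw [abs_sub_comm (g x), abs_sub_comm x, abs_of_pos (sub_pos.2 hxy)]
      exact aux y hy x hx hxy
    · simp [hxy]
    · rw [abs_of_pos (sub_pos.2 hxy)]
      exact aux x hx y hy hxy
  obtain ⟨G, hG, hGe⟩ := hlip.extend_real
  have hlim : Tendsto g (𝓝[>] 0) (𝓝 (G 0)) := by
    refine ((hG.continuous.tendsto 0).mono_left nhdsWithin_le_nhds).congr' ?_
    filter_upwards [hmem] with x hx
    exact (hGe hx).symm
  refine ⟨G 0, hlim, fun x hx => ?_⟩
  refine le_of_tendsto ((tendsto_const_nhds.sub hlim).abs) ?_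
  filter_upwards [Ioo_mem_nhdsGT hx.1] with y hy
  refine (hg x hx y ⟨hy.1, hy.2.trans hx.2⟩ hy.2).trans ?_
  rw [pow_succ, ← mul_assoc]
  have : 0 ≤ L * x ^ k := mul_nonneg hL (pow_nonneg hx.1.le k)
  gcongr
  linarith [hy.1]

theorem pow_lipschitz_of_deriv_le {g : ℝ → ℝ} {ε L : ℝ} (hL : 0 ≤ L) (k : ℕ)
    (hd : ∀ x ∈ Ioo 0 ε, DifferentiableAt ℝ g x) (hb : ∀ x ∈ Ioo 0 ε, |deriv g x| ≤ L * x ^ k) :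
    ∀ x ∈ Ioo 0 ε, ∀ y ∈ Ioo 0 ε, y < x → |g x - g y| ≤ L * x ^ k * (x - y) := by
  intro x hx y hy hyx
  have h := Convex.norm_image_sub_le_of_norm_deriv_le (f := g) (s := Icc y x) (x := y) (y := x)
    (C := L * x ^ k) (fun z hz => hd z ⟨hy.1.trans_le hz.1, hz.2.trans_lt hx.2⟩)
    (fun z hz => (hb z ⟨hy.1.trans_le hz.1, hz.2.trans_lt hx.2⟩).trans (by
      have := pow_le_pow_left₀ (hy.1.trans_le hz.1).le hz.2 k
      gcongr)) (convex_Icc y x) (left_mem_Icc.2 hyx.le) (right_mem_Icc.2 hyx.le)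
  simpa [Real.norm_eq_abs, abs_of_pos (sub_pos.2 hyx)] using h

/-- Second-order expansion at the right end point. -/
theorem exists_right_expansion {f : ℝ → ℝ} {ε L : ℝ} (hε : 0 < ε) (hL : 0 ≤ L)
    (h1 : ∀ x ∈ Ioo 0 ε, DifferentiableAt ℝ f x)
    (h2 : ∀ x ∈ Ioo 0 ε, DifferentiableAt ℝ (deriv f) x)
    (hlip : ∀ x ∈ Ioo 0 ε, ∀ y ∈ Ioo 0 ε,
      |iteratedDeriv 2 f x - iteratedDeriv 2 f y| ≤ L * |x - y|) :
    ∃ a b s, Tendsto f (𝓝[>] 0) (𝓝 a) ∧ Tendsto (iteratedDeriv 2 f) (𝓝[>] 0) (𝓝 s) ∧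
      ∀ x ∈ Ioo 0 ε, |f x - a - b * x - s / 2 * x ^ 2| ≤ L * |x| ^ 3 := by
  -- The Taylor coefficients are found from the top down: f'' has a limit s with error O(x), then f'
  -- - s x has a limit b with error O(x²), then f - b x - s x²/2 has a limit a with error O(x³).
  -- Factorials are not tracked, so L is not the sharp constant.
  obtain ⟨s, hs, hsb⟩ := exists_right_limit_of_pow_lipschitz hε hL 0
    (g := iteratedDeriv 2 f) fun x hx y hy hyx => by
      simpa [abs_of_pos (sub_pos.2 hyx)] using hlip x hx y hy
  rw [iteratedDeriv_two_eq] at hs hsb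
  have hF1 : ∀ x ∈ Ioo 0 ε, HasDerivAt (fun x => deriv f x - s * x) (deriv (deriv f) x - s) x :=
    fun x hx => by
      simpa using (h2 x hx).hasDerivAt.fun_sub ((hasDerivAt_id' x).const_mul s)
  obtain ⟨b, -, hbb⟩ := exists_right_limit_of_pow_lipschitz hε hL 1
    (g := fun x => deriv f x - s * x) (pow_lipschitz_of_deriv_le hL 1
      (fun x hx => (hF1 x hx).differentiableAt)
      fun x hx => by rw [(hF1 x hx).deriv]; exact hsb x hx)
  have hF0 : ∀ x ∈ Ioo 0 ε, HasDerivAt (fun x => f x - b * x - s / 2 * x ^ 2)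
      (deriv f x - s * x - b) x := fun x hx => by
    have := ((h1 x hx).hasDerivAt.fun_sub ((hasDerivAt_id' x).const_mul b)).fun_sub
      ((hasDerivAt_pow 2 x).const_mul (s / 2))
    refine this.congr_deriv ?_
    norm_num
    ring
  obtain ⟨a, ha, hab⟩ := exists_right_limit_of_pow_lipschitz hε hL 2
    (g := fun x => f x - b * x - s / 2 * x ^ 2) (pow_lipschitz_of_deriv_le hL 2
      (fun x hx => (hF0 x hx).differentiableAt)
      fun x hx => by rw [(hF0 x hx).deriv]; exact hbb x hx)
  refine ⟨a, b, s, ?_, by rwa [iteratedDeriv_two_eq], fun x hx => ?_⟩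
  · have hp : Tendsto (fun x : ℝ => b * x + s / 2 * x ^ 2) (𝓝[>] 0) (𝓝 0) := by
      have : Continuous fun x : ℝ => b * x + s / 2 * x ^ 2 := by fun_prop
      simpa using (this.tendsto 0).mono_left nhdsWithin_le_nhds
    convert ha.add hp using 2
    · ring
    · ring
  · rw [abs_of_pos hx.1]
    convert hab x hx using 2
    ring

/-- Second-order expansion at the left end point. -/
theorem exists_left_expansion {f : ℝ → ℝ} {ε L : ℝ} (hε : 0 < ε) (hL : 0 ≤ L)
    (h1 : ∀ x ∈ Ioo (-ε) 0, DifferentiableAt ℝ f x)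
    (h2 : ∀ x ∈ Ioo (-ε) 0, DifferentiableAt ℝ (deriv f) x)
    (hlip : ∀ x ∈ Ioo (-ε) 0, ∀ y ∈ Ioo (-ε) 0,
      |iteratedDeriv 2 f x - iteratedDeriv 2 f y| ≤ L * |x - y|) :
    ∃ a b s, Tendsto f (𝓝[<] 0) (𝓝 a) ∧ Tendsto (iteratedDeriv 2 f) (𝓝[<] 0) (𝓝 s) ∧
      ∀ x ∈ Ioo (-ε) 0, |f x - a - b * x - s / 2 * x ^ 2| ≤ L * |x| ^ 3 := by
  have hneg : ∀ x ∈ Ioo 0 ε, -x ∈ Ioo (-ε) 0 := fun x hx => ⟨by linarith [hx.2], by linarith [hx.1]⟩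
  have hneg' : ∀ x ∈ Ioo (-ε) 0, -x ∈ Ioo 0 ε := fun x hx =>
    ⟨by linarith [hx.2], by linarith [hx.1]⟩
  have d1 : deriv (fun x => f (-x)) = fun x => -deriv f (-x) := funext fun x => deriv_comp_neg f x
  have d2 : iteratedDeriv 2 (fun x => f (-x)) = fun x => iteratedDeriv 2 f (-x) := by
    funext x
    rw [iteratedDeriv_comp_neg]
    simp
  have hn : Tendsto (fun x : ℝ => -x) (𝓝[<] 0) (𝓝[>] 0) := by
    refine tendsto_nhdsWithin_iff.2 ⟨?_, ?_⟩
    · simpa using (continuous_neg.tendsto (0 : ℝ)).mono_left nhdsWithin_le_nhds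
    · filter_upwards [self_mem_nhdsWithin] with x hx
      simpa using hx
  -- Reflection reduces the left side to the right one. It reverses the slope and preserves the
  -- second derivative, hence the witnesses a, -b, s below.
  obtain ⟨a, b, s, ha, hs, hb⟩ := exists_right_expansion (f := fun x => f (-x)) hε hL
    (fun x hx => (differentiableAt_comp_neg).2 (h1 _ (hneg x hx)))
    (fun x hx => by
      rw [d1]
      exact ((differentiableAt_comp_neg).2 (h2 _ (hneg x hx))).neg)
    (fun x hx y hy => by
      rw [d2]
      refine (hlip _ (hneg x hx) _ (hneg y hy)).trans_eq ?_
      rw [← abs_neg]; ring_nf)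
  refine ⟨a, -b, s, by simpa [Function.comp_def] using ha.comp hn, ?_, fun x hx => ?_⟩
  · rw [d2] at hs
    simpa [Function.comp_def] using hs.comp hn
  · have := hb _ (hneg' x hx)
    simp only [neg_neg, abs_neg] at this
    convert this using 2
    ring

/-- First-order expansion with a bound on the second derivative away from the centre. -/
theorem abs_sub_linear_le {g : ℝ → ℝ} {h M : ℝ}
    (h1 : ∀ x ∈ Icc (-h) h, DifferentiableAt ℝ g x) (hc : ContinuousAt (deriv g) 0)
    (h2 : ∀ x ∈ Icc (-h) h \ {0}, DifferentiableAt ℝ (deriv g) x)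
    (hb : ∀ x ∈ Icc (-h) h \ {0}, |deriv (deriv g) x| ≤ M) :
    ∀ x ∈ Icc (-h) h, |g x - g 0 - deriv g 0 * x| ≤ M * x ^ 2 := by
  -- At 0 the second derivative need not be controlled. Continuity of g' there is enough, because
  -- the mean value theorem, applied to g and then to g', evaluates g'' only at interior points of
  -- intervals that end at 0.
  have hc' : ∀ x ∈ Icc (-h) h, ContinuousAt (deriv g) x := fun x hx => by
    by_cases h0 : x = 0
    · rwa [h0]
    · exact (h2 x ⟨hx, h0⟩).continuousAt
  intro x hx
  rcases lt_trichotomy x 0 with hx0 | hx0 | hx0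
  · have hsub : ∀ z, x ≤ z → z ≤ 0 → z ∈ Icc (-h) h := fun z h1 h2 =>
      ⟨hx.1.trans h1, by linarith [hx.1]⟩
    obtain ⟨z, hz, ez⟩ := exists_deriv_eq_slope g hx0
      (fun z hz => (h1 z (hsub z hz.1 hz.2)).continuousAt.continuousWithinAt)
      (fun z hz => (h1 z (hsub z hz.1.le hz.2.le)).differentiableWithinAt)
    obtain ⟨y, hy, ey⟩ := exists_deriv_eq_slope (deriv g) hz.2
      (fun y hy => (hc' y (hsub y (hz.1.le.trans hy.1) hy.2)).continuousWithinAt)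
      (fun y hy => (h2 y ⟨hsub y (hz.1.trans hy.1).le hy.2.le, hy.2.ne⟩).differentiableWithinAt)
    have hM := hb y ⟨hsub y (hz.1.trans hy.1).le hy.2.le, hy.2.ne⟩
    rw [eq_div_iff (by linarith)] at ez
    rw [eq_div_iff (by linarith [hz.2])] at ey
    have e : g x - g 0 - deriv g 0 * x = deriv (deriv g) y * z * x := by
      linear_combination ez + x * ey
    rw [e, abs_mul, abs_mul, abs_of_neg hz.2, abs_of_neg hx0]
    have hM0 : 0 ≤ M := (abs_nonneg _).trans hM
    have : -z * -x ≤ x ^ 2 := by nlinarith [hz.1, hz.2]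
    calc _ = |deriv (deriv g) y| * (-z * -x) := by ring
      _ ≤ M * x ^ 2 := mul_le_mul hM this (by nlinarith [hz.2]) hM0
  · simp [hx0]
  · have hsub : ∀ z, 0 ≤ z → z ≤ x → z ∈ Icc (-h) h := fun z h1 h2 =>
      ⟨by linarith [hx.2], h2.trans hx.2⟩
    obtain ⟨z, hz, ez⟩ := exists_deriv_eq_slope g hx0
      (fun z hz => (h1 z (hsub z hz.1 hz.2)).continuousAt.continuousWithinAt)
      (fun z hz => (h1 z (hsub z hz.1.le hz.2.le)).differentiableWithinAt)
    obtain ⟨y, hy, ey⟩ := exists_deriv_eq_slope (deriv g) hz.1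
      (fun y hy => (hc' y (hsub y hy.1 (hy.2.trans hz.2.le))).continuousWithinAt)
      (fun y hy => (h2 y ⟨hsub y hy.1.le (hy.2.trans hz.2).le, hy.1.ne'⟩).differentiableWithinAt)
    have hM := hb y ⟨hsub y hy.1.le (hy.2.trans hz.2).le, hy.1.ne'⟩
    rw [eq_div_iff (by linarith)] at ez
    rw [eq_div_iff (by linarith [hz.1])] at ey
    have e : g x - g 0 - deriv g 0 * x = deriv (deriv g) y * z * x := by
      linear_combination -ez - x * ey
    rw [e, abs_mul, abs_mul, abs_of_pos hz.1, abs_of_pos hx0]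
    have hM0 : 0 ≤ M := (abs_nonneg _).trans hM
    have : z * x ≤ x ^ 2 := by nlinarith [hz.1, hz.2]
    calc _ = |deriv (deriv g) y| * (z * x) := by ring
      _ ≤ M * x ^ 2 := mul_le_mul hM this (by nlinarith [hz.1]) hM0

end Calculus

noncomputable section

/-! ### One-sided kernels, their moments and the equivalent kernel -/

section SideKernels

/-- `ψ` is measurable, bounded by `b` and vanishes outside `[-1, 1]`. -/
structure Windowed (ψ : ℝ → ℝ) (b : ℝ) : Prop where
  measurable : Measurable ψ
  bound : ∀ v, |ψ v| ≤ b
  zero : ∀ v ∉ Icc (-1 : ℝ) 1, ψ v = 0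

theorem Windowed.nonneg {ψ : ℝ → ℝ} {b : ℝ} (hψ : Windowed ψ b) : 0 ≤ b :=
  (abs_nonneg _).trans (hψ.bound 0)

theorem Windowed.integrable {ψ : ℝ → ℝ} {b : ℝ} (hψ : Windowed ψ b) : Integrable ψ := by
  have : IntegrableOn ψ (Icc (-1) 1) := by
    refine IntegrableOn.of_bound (C := b) (by simp) hψ.measurable.aestronglyMeasurable
      (Eventually.of_forall hψ.bound)
  exact (integrableOn_iff_integrable_of_support_subset fun v hv => by
    by_contra h; exact hv (hψ.zero v h)).1 this

theorem Windowed.mul {ψ p : ℝ → ℝ} {b c : ℝ} (hψ : Windowed ψ b) (hp : Measurable p)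
    (hc : ∀ v ∈ Icc (-1 : ℝ) 1, |p v| ≤ c) : Windowed (fun v => p v * ψ v) (c * b) where
  measurable := hp.mul hψ.measurable
  bound v := by
    have hc0 : 0 ≤ c := (abs_nonneg _).trans (hc 0 (by simp))
    by_cases hv : v ∈ Icc (-1 : ℝ) 1
    · rw [abs_mul]
      exact mul_le_mul (hc v hv) (hψ.bound v) (abs_nonneg _) hc0
    · rw [hψ.zero v hv, mul_zero, abs_zero]
      exact mul_nonneg hc0 hψ.nonneg
  zero v hv := by rw [hψ.zero v hv, mul_zero]

theorem Windowed.pow_mul {ψ : ℝ → ℝ} {b : ℝ} (hψ : Windowed ψ b) (j : ℕ) :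
    Windowed (fun v => v ^ j * ψ v) b := by
  have := hψ.mul (p := fun v => v ^ j) (c := 1) (by fun_prop) fun v hv => by
    rw [abs_pow]
    exact pow_le_one₀ (abs_nonneg _) (abs_le.2 hv)
  simpa using this

theorem Windowed.sq {ψ : ℝ → ℝ} {b : ℝ} (hψ : Windowed ψ b) :
    Windowed (fun v => ψ v ^ 2) (b ^ 2) where
  measurable := hψ.measurable.pow_const 2
  bound v := by rw [abs_pow]; exact pow_le_pow_left₀ (abs_nonneg _) (hψ.bound v) 2
  zero v hv := by rw [hψ.zero v hv]; norm_num

/-- A kernel for one side of the cutoff. -/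
structure SideKernel (k : ℝ → ℝ) : Prop where
  nonneg : ∀ v, 0 ≤ k v
  windowed : ∃ b, Windowed k b
  pos : 0 < ∫ v, k v

/-- The moments of a one-sided kernel. -/
def sideMoment (k : ℝ → ℝ) (j : ℕ) : ℝ := ∫ v, v ^ j * k v

/-- The determinant of the matrix of the first moments of a one-sided kernel. -/
def sideDet (k : ℝ → ℝ) : ℝ := sideMoment k 0 * sideMoment k 2 - sideMoment k 1 ^ 2

/-- The equivalent kernel of the local linear intercept estimator. -/
def equivKernel (k : ℝ → ℝ) (v : ℝ) : ℝ :=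
  (sideMoment k 2 - sideMoment k 1 * v) / sideDet k * k v

variable {k : ℝ → ℝ}

theorem integral_sq_mul_pos {p g : ℝ → ℝ} (hg : ∀ v, 0 ≤ g v)
    (hint : Integrable fun v => p v ^ 2 * g v) (hgpos : ∫ v, g v ≠ 0)
    (hp : ∀ᵐ v, p v ≠ 0) : 0 < ∫ v, p v ^ 2 * g v := by
  refine lt_of_le_of_ne (integral_nonneg fun v => mul_nonneg (sq_nonneg _) (hg v)) fun h => ?_
  rw [eq_comm, integral_eq_zero_iff_of_nonneg (fun v => mul_nonneg (sq_nonneg _) (hg v)) hint] at h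
  refine hgpos (integral_eq_zero_of_ae ?_)
  filter_upwards [h, hp] with v h1 h2
  have : p v ^ 2 * g v = 0 := h1
  simpa [h2] using this

theorem ae_linear_ne_zero {a b : ℝ} (h : a ≠ 0) : ∀ᵐ v : ℝ, a - b * v ≠ 0 := by
  have : {v : ℝ | ¬ (a - b * v ≠ 0)} ⊆ {a / b} := fun v hv => by
    simp only [ne_eq, not_not, mem_ofPred_eq] at hv
    have hb : b ≠ 0 := fun hb => h (by simpa [hb] using hv)
    rw [mem_singleton_iff, eq_div_iff hb]
    linarith
  exact measure_mono_null this (by simp)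

theorem SideKernel.moment_two_pos (hk : SideKernel k) : 0 < sideMoment k 2 := by
  obtain ⟨b, hb⟩ := hk.windowed
  refine integral_sq_mul_pos hk.nonneg (hb.pow_mul 2).integrable hk.pos.ne' ?_
  have : {v : ℝ | ¬ (v ≠ 0)} ⊆ {0} := fun v hv => by simpa using hv
  exact measure_mono_null this (by simp)

/-- The integral of (M₂ - M₁ v)² k(v) equals M₂ times the determinant. It is strictly positive
because the affine factor vanishes at one point at most while k has positive mass. This is
Cauchy–Schwarz with its equality case excluded. -/
theorem SideKernel.det_pos (hk : SideKernel k) : 0 < sideDet k := by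
  obtain ⟨b, hb⟩ := hk.windowed
  have hM2 := hk.moment_two_pos
  set M0 := sideMoment k 0
  set M1 := sideMoment k 1
  set M2 := sideMoment k 2
  have i := fun j => (hb.pow_mul j).integrable
  have e : ∀ v, (M2 - M1 * v) ^ 2 * k v =
      M2 ^ 2 * (v ^ 0 * k v) - 2 * M1 * M2 * (v ^ 1 * k v) + M1 ^ 2 * (v ^ 2 * k v) := fun v => by
    ring
  have hI : Integrable fun v => (M2 - M1 * v) ^ 2 * k v := by
    simp_rw [e]
    exact (((i 0).const_mul _).sub ((i 1).const_mul _)).add ((i 2).const_mul _)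
  have hpos := integral_sq_mul_pos hk.nonneg hI hk.pos.ne' (ae_linear_ne_zero hM2.ne')
  have : ∫ v, (M2 - M1 * v) ^ 2 * k v = M2 * sideDet k := by
    simp_rw [e]
    have i01 : Integrable fun v => M2 ^ 2 * (v ^ 0 * k v) - 2 * M1 * M2 * (v ^ 1 * k v) :=
      ((i 0).const_mul _).sub ((i 1).const_mul _)
    rw [integral_add i01 ((i 2).const_mul _),
      integral_sub ((i 0).const_mul _) ((i 1).const_mul _), integral_const_mul,
      integral_const_mul, integral_const_mul]
    change M2 ^ 2 * M0 - 2 * M1 * M2 * M1 + M1 ^ 2 * M2 = M2 * (M0 * M2 - M1 ^ 2)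
    ring
  rw [this] at hpos
  exact pos_of_mul_pos_right hpos hM2.le

theorem SideKernel.equivKernel_windowed (hk : SideKernel k) : ∃ b, Windowed (equivKernel k) b := by
  obtain ⟨b, hb⟩ := hk.windowed
  refine ⟨_, hb.mul (c := (|sideMoment k 2| + |sideMoment k 1|) / |sideDet k|) (by fun_prop)
    fun v hv => ?_⟩
  rw [abs_div]
  gcongr
  refine (abs_sub _ _).trans ?_
  rw [abs_mul]
  have : |v| ≤ 1 := abs_le.2 hv
  have := mul_le_of_le_one_right (abs_nonneg (sideMoment k 1)) this
  linarith

/-- Were the integral zero, the product of a nonzero affine factor and k would vanish almost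
everywhere, hence so would k, contradicting its positive mass. -/
theorem SideKernel.integral_equivKernel_sq_pos (hk : SideKernel k) :
    0 < ∫ v, equivKernel k v ^ 2 := by
  obtain ⟨b, hb⟩ := hk.equivKernel_windowed
  have h0 := hk.det_pos
  refine lt_of_le_of_ne (integral_nonneg fun v => sq_nonneg _) fun h => ?_
  rw [eq_comm, integral_eq_zero_iff_of_nonneg (fun v => sq_nonneg _) hb.sq.integrable] at h
  refine hk.pos.ne' (integral_eq_zero_of_ae ?_)
  filter_upwards [h, ae_linear_ne_zero (b := sideMoment k 1) hk.moment_two_pos.ne'] with v h1 h2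
  have h3 : equivKernel k v ^ 2 = 0 := h1
  have h4 := pow_eq_zero_iff (two_ne_zero) |>.1 h3
  unfold equivKernel at h4
  rcases mul_eq_zero.1 h4 with h5 | h5
  · exact absurd h5 (div_ne_zero h2 h0.ne')
  · exact h5

/-- The part of the kernel to the right of the cutoff. -/
def kPlus (K : ℝ → ℝ) (v : ℝ) : ℝ := if 0 ≤ v then K v else 0

/-- The part of the kernel to the left of the cutoff. -/
def kMinus (K : ℝ → ℝ) (v : ℝ) : ℝ := if v < 0 then K v else 0

theorem kernPlus_eq {K : ℝ → ℝ} {h : ℝ} (hh : 0 < h) :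
    kernPlus K h = fun x => kPlus K (x / h) / h := by
  funext x
  have : 0 ≤ x / h ↔ 0 ≤ x := by rw [le_div_iff₀ hh, zero_mul]
  by_cases hx : 0 ≤ x <;> simp [kernPlus, kPlus, this, hx]

theorem kernMinus_eq {K : ℝ → ℝ} {h : ℝ} (hh : 0 < h) :
    kernMinus K h = fun x => kMinus K (x / h) / h := by
  funext x
  have : x / h < 0 ↔ x < 0 := by rw [div_lt_iff₀ hh, zero_mul]
  by_cases hx : x < 0 <;> simp [kernMinus, kMinus, this, hx]

theorem integral_mul_kPlus (K p : ℝ → ℝ) :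
    ∫ v, p v * kPlus K v = ∫ v in Ioi (0 : ℝ), p v * K v := by
  rw [← integral_Ici_eq_integral_Ioi, ← integral_indicator measurableSet_Ici]
  congr 1
  funext v
  by_cases hv : 0 ≤ v <;> simp [kPlus, indicator, hv]

theorem integral_mul_kMinus {K : ℝ → ℝ} (hK : ∀ v, K (-v) = K v) (p : ℝ → ℝ) :
    ∫ v, p v * kMinus K v = ∫ v in Ioi (0 : ℝ), p (-v) * K v := by
  have e : ∫ v, p v * kMinus K v = ∫ v in Iio (0 : ℝ), p v * K v := by
    rw [← integral_indicator measurableSet_Iio]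
    congr 1
    funext v
    by_cases hv : v < 0 <;> simp [kMinus, indicator, hv]
  have e2 := integral_comp_neg_Ioi (0 : ℝ) fun v => p v * K v
  rw [neg_zero, integral_Iic_eq_integral_Iio] at e2
  rw [e, ← e2]
  simp_rw [hK]

theorem sideMoment_kPlus (K : ℝ → ℝ) (j : ℕ) : sideMoment (kPlus K) j = nuMoment K j :=
  integral_mul_kPlus K fun v => v ^ j

theorem sideMoment_kMinus {K : ℝ → ℝ} (hK : ∀ v, K (-v) = K v) (j : ℕ) :
    sideMoment (kMinus K) j = (-1) ^ j * nuMoment K j := by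
  rw [sideMoment, integral_mul_kMinus hK fun v => v ^ j, nuMoment, ← integral_const_mul]
  congr 1
  funext v
  rw [neg_pow]; ring

theorem sideDet_kPlus (K : ℝ → ℝ) :
    sideDet (kPlus K) = nuMoment K 2 * nuMoment K 0 - nuMoment K 1 ^ 2 := by
  simp only [sideDet, sideMoment_kPlus]; ring

theorem sideDet_kMinus {K : ℝ → ℝ} (hK : ∀ v, K (-v) = K v) :
    sideDet (kMinus K) = nuMoment K 2 * nuMoment K 0 - nuMoment K 1 ^ 2 := by
  simp only [sideDet, sideMoment_kMinus hK]; ring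

theorem integral_equivKernel_kPlus_sq (K : ℝ → ℝ) :
    ∫ v, equivKernel (kPlus K) v ^ 2 = kappaBar K := by
  -- One of the two kernel factors of the square stays inside the weight and the other outside, so
  -- that the formula for integrals against `kPlus K` reduces everything to the half-line.
  have e : ∀ v, equivKernel (kPlus K) v ^ 2 = ((nuMoment K 1 * v - nuMoment K 2) ^ 2 * kPlus K v /
      (nuMoment K 2 * nuMoment K 0 - nuMoment K 1 ^ 2) ^ 2) * kPlus K v := fun v => by
    simp only [equivKernel, sideMoment_kPlus, sideDet_kPlus]
    generalize nuMoment K 2 * nuMoment K 0 - nuMoment K 1 ^ 2 = D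
    ring
  simp_rw [e]
  rw [integral_mul_kPlus, kappaBar, ← integral_div]
  refine setIntegral_congr_fun measurableSet_Ioi fun v hv => ?_
  have : (0 : ℝ) ≤ v := le_of_lt hv
  simp only [kPlus, this, if_true]; ring

theorem integral_equivKernel_kMinus_sq {K : ℝ → ℝ} (hK : ∀ v, K (-v) = K v) :
    ∫ v, equivKernel (kMinus K) v ^ 2 = kappaBar K := by
  have e : ∀ v, equivKernel (kMinus K) v ^ 2 = ((nuMoment K 1 * v + nuMoment K 2) ^ 2 * kMinus K v /
      (nuMoment K 2 * nuMoment K 0 - nuMoment K 1 ^ 2) ^ 2) * kMinus K v := fun v => by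
    simp only [equivKernel, sideMoment_kMinus hK, sideDet_kMinus hK]
    generalize nuMoment K 2 * nuMoment K 0 - nuMoment K 1 ^ 2 = D
    ring
  simp_rw [e]
  rw [integral_mul_kMinus hK (fun v => (nuMoment K 1 * v + nuMoment K 2) ^ 2 * kMinus K v /
      (nuMoment K 2 * nuMoment K 0 - nuMoment K 1 ^ 2) ^ 2), kappaBar, ← integral_div]
  refine setIntegral_congr_fun measurableSet_Ioi fun v hv => ?_
  have : (-v : ℝ) < 0 := neg_lt_zero.2 hv
  simp only [kMinus, this, if_true, hK]; ring

/-! ### Consequences of the design assumption near the cutoff -/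

section Design

variable {PX : Measure ℝ} {fX K : ℝ → ℝ} {h : ℕ → ℝ}

theorem DesignAssumption.windowed (hd : DesignAssumption PX fX K h) : ∃ b, Windowed K b := by
  obtain ⟨b, hb⟩ := hd.kernel_bounded
  exact ⟨b, hd.kernel_measurable, fun v => by rw [abs_of_nonneg (hd.kernel_nonneg v)]; exact hb v,
    hd.kernel_zero⟩

/-- By symmetry each half of the kernel carries half of its total mass. In particular both one-sided
kernels have positive mass, which makes the local linear problem nondegenerate. -/
theorem DesignAssumption.nuMoment_zero (hd : DesignAssumption PX fX K h) :
    nuMoment K 0 = 1 / 2 := by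
  obtain ⟨b, hb⟩ := hd.windowed
  have h1 : ∫ v, (1 : ℝ) * kPlus K v = nuMoment K 0 := by
    rw [integral_mul_kPlus K fun _ => 1]; simp [nuMoment]
  have h2 : ∫ v, (1 : ℝ) * kMinus K v = nuMoment K 0 := by
    rw [integral_mul_kMinus hd.kernel_symm fun _ => 1]; simp [nuMoment]
  have h3 : ∀ v, K v = 1 * kPlus K v + 1 * kMinus K v := fun v => by
    rcases lt_or_ge v 0 with hv | hv
    · simp [kPlus, kMinus, hv, not_le.2 hv]
    · simp [kPlus, kMinus, hv, not_lt.2 hv]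
  have i1 : Integrable fun v => (1 : ℝ) * kPlus K v := by
    have : (fun v => (1 : ℝ) * kPlus K v) = indicator (Ici 0) K := by
      funext v; simp [kPlus, indicator]
    rw [this]; exact hb.integrable.indicator measurableSet_Ici
  have i2 : Integrable fun v => (1 : ℝ) * kMinus K v := by
    have : (fun v => (1 : ℝ) * kMinus K v) = indicator (Iio 0) K := by
      funext v; simp [kMinus, indicator]
    rw [this]; exact hb.integrable.indicator measurableSet_Iio
  have := hd.kernel_integral
  simp_rw [fun v => h3 v] at this
  rw [integral_add i1 i2, h1, h2] at this
  linarith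

theorem DesignAssumption.sideKernel_kPlus (hd : DesignAssumption PX fX K h) :
    SideKernel (kPlus K) where
  nonneg v := by unfold kPlus; split_ifs; exacts [hd.kernel_nonneg v, le_rfl]
  windowed := by
    obtain ⟨b, hb⟩ := hd.windowed
    refine ⟨b, ?_, fun v => ?_, fun v hv => ?_⟩
    · exact Measurable.ite measurableSet_Ici hb.measurable measurable_const
    · unfold kPlus; split_ifs; exacts [hb.bound v, by simpa using hb.nonneg]
    · unfold kPlus; rw [hb.zero v hv, ite_self]
  pos := by
    have := sideMoment_kPlus K 0
    rw [hd.nuMoment_zero] at this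
    simp only [sideMoment, pow_zero, one_mul] at this
    rw [this]; norm_num

theorem DesignAssumption.sideKernel_kMinus (hd : DesignAssumption PX fX K h) :
    SideKernel (kMinus K) where
  nonneg v := by unfold kMinus; split_ifs; exacts [hd.kernel_nonneg v, le_rfl]
  windowed := by
    obtain ⟨b, hb⟩ := hd.windowed
    refine ⟨b, ?_, fun v => ?_, fun v hv => ?_⟩
    · exact Measurable.ite measurableSet_Iio hb.measurable measurable_const
    · unfold kMinus; split_ifs; exacts [hb.bound v, by simpa using hb.nonneg]
    · unfold kMinus; rw [hb.zero v hv, ite_self]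
  pos := by
    have := sideMoment_kMinus hd.kernel_symm 0
    rw [hd.nuMoment_zero] at this
    simp only [sideMoment, pow_zero, one_mul] at this
    rw [this]; norm_num

theorem DesignAssumption.kappaBar_pos (hd : DesignAssumption PX fX K h) : 0 < kappaBar K := by
  rw [← integral_equivKernel_kPlus_sq]
  exact hd.sideKernel_kPlus.integral_equivKernel_sq_pos

/-- Near the cutoff the support of the running variable is full and its law is dominated by
Lebesgue measure. -/
theorem DesignAssumption.exists_local (hd : DesignAssumption PX fX K h) :
    ∃ δ > 0, ∃ F > 0, ContinuousOn fX (Ioo (-δ) δ) ∧ (∀ x ∈ Ioo (-δ) δ, 0 < fX x ∧ fX x ≤ F) ∧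
      Ioo (-δ) δ ⊆ interior PX.support := by
  obtain ⟨U, hU, h0, hc, c, hcpos, hcU⟩ := hd.density_cutoff
  have hcont : ContinuousAt fX 0 := hc.continuousAt (hU.mem_nhds h0)
  have hev : ∀ᶠ x in 𝓝 (0 : ℝ), x ∈ U ∧ fX x < fX 0 + 1 :=
    (show ∀ᶠ x in 𝓝 (0 : ℝ), x ∈ U from hU.mem_nhds h0).and
      (hcont.eventually (gt_mem_nhds (lt_add_one _)))
  obtain ⟨δ, hδ, hball⟩ := Metric.eventually_nhds_iff_ball.1 hev
  have hIoo : ∀ x ∈ Ioo (-δ) δ, x ∈ U ∧ fX x < fX 0 + 1 := fun x hx =>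
    hball x (by rw [Metric.mem_ball, Real.dist_eq, sub_zero]; exact abs_lt.2 hx)
  have hf0 : 0 ≤ fX 0 := hd.density_nonneg 0
  refine ⟨δ, hδ, fX 0 + 1, by linarith, hc.mono fun x hx => (hIoo x hx).1,
    fun x hx => ⟨hcpos.trans_le (hcU x (hIoo x hx).1), (hIoo x hx).2.le⟩, ?_⟩
  refine interior_maximal (fun x hx => ?_) isOpen_Ioo
  rw [Measure.mem_support_iff_forall]
  intro V hV
  -- Any neighbourhood of x contains an open set W inside the region where the density is at least
  -- c, so its mass is at least c times the positive Lebesgue measure of W.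
  have hW : V ∩ Ioo (-δ) δ ∈ 𝓝 x := inter_mem hV (isOpen_Ioo.mem_nhds hx)
  obtain ⟨W, hWs, hWo, hxW⟩ := mem_nhds_iff.1 hW
  have hvol : 0 < volume W := hWo.measure_pos _ ⟨x, hxW⟩
  refine lt_of_lt_of_le ?_ (measure_mono (hWs.trans inter_subset_left))
  rw [hd.density, withDensity_apply _ hWo.measurableSet]
  calc 0 < ENNReal.ofReal c * volume W :=
        ENNReal.mul_pos (by simpa using hcpos) hvol.ne'
    _ = ∫⁻ _ in W, ENNReal.ofReal c := by simp
    _ ≤ _ := setLIntegral_mono' hWo.measurableSet fun y hy =>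
        ENNReal.ofReal_le_ofReal (hcU y (hIoo y (hWs hy).2).1)

theorem DesignAssumption.measure_zero (hd : DesignAssumption PX fX K h) : PX {0} = 0 := by
  rw [hd.density]
  exact withDensity_absolutelyContinuous _ _ (by simp)

end Design

end SideKernels

/-! ### Rates and integrals over the shrinking window -/

section LocalIntegrals

variable {PX : Measure ℝ} {fX K : ℝ → ℝ} {h : ℕ → ℝ}

/-- The rate `(n h)^{-1/2}`. -/
def sdRate (h : ℕ → ℝ) (n : ℕ) : ℝ := (Real.sqrt (n * h n))⁻¹

/-- The rate `h² + (n h)^{-1/2}`. -/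
def totRate (h : ℕ → ℝ) (n : ℕ) : ℝ := h n ^ 2 + sdRate h n

/-- `(x / h)^j k(x / h) / h`. -/
def locMom (k : ℝ → ℝ) (h : ℝ) (j : ℕ) (x : ℝ) : ℝ := (x / h) ^ j * k (x / h) / h

/-- The sample average of `f`. -/
def sampleAvg {D : Type*} {n : ℕ} (f : D → ℝ) (W : Fin n → D) : ℝ := (n : ℝ)⁻¹ * ∑ i, f (W i)

theorem sdRate_nonneg (h : ℕ → ℝ) (n : ℕ) : 0 ≤ sdRate h n := inv_nonneg.2 (Real.sqrt_nonneg _)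

theorem totRate_nonneg (h : ℕ → ℝ) (n : ℕ) : 0 ≤ totRate h n :=
  add_nonneg (sq_nonneg _) (sdRate_nonneg h n)

theorem DesignAssumption.tendsto_sdRate (hd : DesignAssumption PX fX K h) :
    Tendsto (sdRate h) atTop (𝓝 0) :=
  tendsto_inv_atTop_zero.comp (Real.tendsto_sqrt_atTop.comp hd.bandwidth_rate)

theorem DesignAssumption.tendsto_totRate (hd : DesignAssumption PX fX K h) :
    Tendsto (totRate h) atTop (𝓝 0) := by
  have := (hd.bandwidth_zero.pow 2).add hd.tendsto_sdRate
  rwa [zero_pow two_ne_zero, zero_add] at this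

theorem DesignAssumption.eventually_lt (hd : DesignAssumption PX fX K h) {δ : ℝ} (hδ : 0 < δ) :
    ∀ᶠ n in atTop, h n < δ :=
  hd.bandwidth_zero.eventually (gt_mem_nhds hδ)

theorem div_mem_Icc_iff {h x : ℝ} (hh : 0 < h) : x / h ∈ Icc (-1 : ℝ) 1 ↔ x ∈ Icc (-h) h := by
  rw [mem_Icc, mem_Icc, le_div_iff₀ hh, div_le_iff₀ hh]
  simp

theorem DesignAssumption.exists_measure_Icc_le (hd : DesignAssumption PX fX K h) :
    ∃ F > 0, ∀ᶠ n in atTop, PX.real (Icc (-h n) (h n)) ≤ F * h n := by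
  obtain ⟨δ, hδ, F, hF, -, hf, -⟩ := hd.exists_local
  refine ⟨2 * F, by positivity, ?_⟩
  filter_upwards [hd.eventually_lt hδ] with n hn
  have hh := hd.bandwidth_pos n
  refine ENNReal.toReal_le_of_le_ofReal (by positivity) ?_
  rw [hd.density, withDensity_apply _ measurableSet_Icc]
  calc _ ≤ ∫⁻ _ in Icc (-h n) (h n), ENNReal.ofReal F :=
        setLIntegral_mono' measurableSet_Icc fun x hx =>
          ENNReal.ofReal_le_ofReal (hf x ⟨by linarith [hx.1], by linarith [hx.2]⟩).2
    _ = ENNReal.ofReal F * ENNReal.ofReal (2 * h n) := by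
        rw [setLIntegral_const, Real.volume_Icc]; ring_nf
    _ ≤ _ := by rw [← ENNReal.ofReal_mul hF.le]; apply ENNReal.ofReal_le_ofReal; nlinarith

theorem DesignAssumption.integral_eq (hd : DesignAssumption PX fX K h) (g : ℝ → ℝ) :
    ∫ x, g x ∂PX = ∫ x, fX x * g x := by
  rw [hd.density, integral_withDensity_eq_integral_toReal_smul
    (hd.density_measurable.ennreal_ofReal) (by simp)]
  simp [ENNReal.toReal_ofReal (hd.density_nonneg _)]

theorem Windowed.integrable_comp_div [IsProbabilityMeasure PX] {ψ : ℝ → ℝ} {b : ℝ}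
    (hψ : Windowed ψ b) (h : ℝ) : Integrable (fun x => ψ (x / h)) PX :=
  Integrable.of_bound (C := b) (hψ.measurable.comp (by fun_prop)).aestronglyMeasurable
    (Eventually.of_forall fun x => hψ.bound _)

/-- Kernel-weighted averages of the running variable converge. -/
theorem DesignAssumption.tendsto_integral_window (hd : DesignAssumption PX fX K h)
    [IsProbabilityMeasure PX] {ψ : ℝ → ℝ} {b : ℝ} (hψ : Windowed ψ b) :
    Tendsto (fun n => ∫ x, ψ (x / h n) / h n ∂PX) atTop (𝓝 (fX 0 * ∫ v, ψ v)) := by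
  obtain ⟨δ, hδ, F, hF, hfc, hf, -⟩ := hd.exists_local
  have hc : ContinuousAt fX 0 := hfc.continuousAt (Ioo_mem_nhds (by linarith) hδ)
  rw [Metric.tendsto_atTop]
  intro ε hε
  have hb := hψ.nonneg
  -- The integrand is at most the tolerance times b/h on a window of length 2h. With this tolerance
  -- the total is ε b/(2b+1) < ε; the added 1 covers the case b = 0.
  obtain ⟨r, hr, hclose⟩ := Metric.continuousAt_iff.1 hc (ε / (2 * b + 1) / 2) (by positivity)
  obtain ⟨N, hN⟩ := eventually_atTop.1 ((hd.eventually_lt hδ).and (hd.eventually_lt hr))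
  refine ⟨N, fun n hn => ?_⟩
  obtain ⟨h1, h2⟩ := hN n hn
  have hh := hd.bandwidth_pos n
  have e1 : fX 0 * ∫ v, ψ v = ∫ x, fX 0 * (ψ (x / h n) / h n) := by
    rw [integral_const_mul, integral_div, Measure.integral_comp_div ψ (h n), abs_of_pos hh,
      smul_eq_mul, mul_div_cancel_left₀ _ hh.ne']
  have i1 : Integrable fun x => fX 0 * (ψ (x / h n) / h n) :=
    ((hψ.integrable.comp_div hh.ne').div_const _).const_mul _
  have i2 : Integrable fun x => fX x * (ψ (x / h n) / h n) := by
    have h3 : Integrable (fun x => ψ (x / h n) / h n) PX :=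
      (hψ.integrable_comp_div (h n)).div_const _
    rw [hd.density, integrable_withDensity_iff_integrable_smul'
      hd.density_measurable.ennreal_ofReal (by simp)] at h3
    simpa [ENNReal.toReal_ofReal (hd.density_nonneg _)] using h3
  rw [hd.integral_eq, e1, Real.dist_eq, ← integral_sub i2 i1]
  have hpt : ∀ x, ‖fX x * (ψ (x / h n) / h n) - fX 0 * (ψ (x / h n) / h n)‖ ≤
      (Icc (-h n) (h n)).indicator (fun _ => ε / (2 * b + 1) / 2 * (b / h n)) x := fun x => by
    by_cases hx : x ∈ Icc (-h n) (h n)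
    · rw [indicator_of_mem hx, ← sub_mul, norm_mul, Real.norm_eq_abs, Real.norm_eq_abs, abs_div,
        abs_of_pos hh]
      have h4 : dist x 0 < r := by
        rw [Real.dist_eq, sub_zero]; exact (abs_le.2 hx).trans_lt h2
      have h5 := (hclose h4).le
      rw [Real.dist_eq] at h5
      have := hψ.bound (x / h n)
      gcongr
    · rw [indicator_of_notMem hx, hψ.zero _ (by rwa [div_mem_Icc_iff hh])]
      simp
  have ic : Integrable ((Icc (-h n) (h n)).indicator fun _ => ε / (2 * b + 1) / 2 * (b / h n)) :=
    (integrable_indicator_iff measurableSet_Icc).2 (integrableOn_const (by simp))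
  refine (norm_integral_le_of_norm_le ic (Eventually.of_forall hpt)).trans_lt ?_
  rw [integral_indicator_const _ measurableSet_Icc, Measure.real, Real.volume_Icc,
    ENNReal.toReal_ofReal (by linarith), smul_eq_mul]
  have : (h n - -h n) * (ε / (2 * b + 1) / 2 * (b / h n)) = ε * (b / (2 * b + 1)) := by
    field_simp; ring
  rw [this]
  have : b / (2 * b + 1) < 1 := by rw [div_lt_one (by positivity)]; linarith
  nlinarith

theorem DesignAssumption.density_pos (hd : DesignAssumption PX fX K h) : 0 < fX 0 := by
  obtain ⟨δ, hδ, F, -, -, hf, -⟩ := hd.exists_local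
  exact (hf 0 ⟨by linarith, hδ⟩).1

/-- Disintegration along X: a function that vanishes off the window and has conditional integrals at
most A there integrates to at most A times the mass of the window. That mass is O(h), the source of
the factor h in the later moment bounds. -/
theorem integrable_of_window {d : ℕ} [IsProbabilityMeasure PX] {κ : Kernel ℝ (Obs d)}
    [IsMarkovKernel κ] {h A : ℝ} {G : Datum d → ℝ} (hG : Measurable G) (hG0 : ∀ w, 0 ≤ G w)
    (hout : ∀ x ∉ Icc (-h) h, ∀ w, G (x, w) = 0)
    (hin : ∀ᵐ x ∂PX, x ∈ Icc (-h) h → Integrable (fun w => G (x, w)) (κ x) ∧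
      ∫ w, G (x, w) ∂(κ x) ≤ A) :
    Integrable G (PX ⊗ₘ κ) ∧ ∫ w, G w ∂(PX ⊗ₘ κ) ≤ A * PX.real (Icc (-h) h) := by
  have hb : ∀ᵐ x ∂PX, ‖∫ w, ‖G (x, w)‖ ∂(κ x)‖ ≤ (Icc (-h) h).indicator (fun _ => A) x := by
    filter_upwards [hin] with x hx
    simp only [Real.norm_eq_abs, abs_of_nonneg (hG0 _)]
    by_cases hxm : x ∈ Icc (-h) h
    · rw [indicator_of_mem hxm, abs_of_nonneg (integral_nonneg fun w => hG0 _)]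
      exact (hx hxm).2
    · rw [indicator_of_notMem hxm]
      simp [hout x hxm]
  have ic : Integrable ((Icc (-h) h).indicator fun _ => A) PX :=
    (integrable_const A).indicator measurableSet_Icc
  have hsm : StronglyMeasurable fun x => ∫ w, ‖G (x, w)‖ ∂(κ x) :=
    StronglyMeasurable.integral_kernel_prod_right' (f := fun p : ℝ × Obs d => ‖G p‖)
      hG.norm.stronglyMeasurable
  have hint : Integrable G (PX ⊗ₘ κ) := by
    rw [Measure.integrable_compProd_iff hG.aestronglyMeasurable]
    refine ⟨?_, ic.mono' hsm.aestronglyMeasurable hb⟩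
    filter_upwards [hin] with x hx
    by_cases hxm : x ∈ Icc (-h) h
    · exact (hx hxm).1
    · simp [hout x hxm]
  refine ⟨hint, ?_⟩
  rw [Measure.integral_compProd hint]
  calc _ ≤ ∫ x, (Icc (-h) h).indicator (fun _ => A) x ∂PX := by
        refine integral_mono_ae ?_ ic ?_
        · have := (Measure.integrable_compProd_iff hG.aestronglyMeasurable).1 hint |>.2
          simpa [Real.norm_eq_abs, abs_of_nonneg (hG0 _)] using this
        · filter_upwards [hb] with x hx
          simp only [Real.norm_eq_abs, abs_of_nonneg (hG0 _)] at hx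
          exact (le_abs_self _).trans hx
    _ = _ := by rw [integral_indicator_const _ measurableSet_Icc, smul_eq_mul, mul_comm]

/-- A product of a window and an error with bounded conditional second moment. -/
theorem Windowed.memLp_mul {d : ℕ} [IsProbabilityMeasure PX] {κ : Kernel ℝ (Obs d)}
    [IsMarkovKernel κ] {h A b : ℝ} (hh : 0 < h) {ψ : ℝ → ℝ} (hψ : Windowed ψ b) {e : Datum d → ℝ}
    (he : Measurable e)
    (hin : ∀ᵐ x ∂PX, x ∈ Icc (-h) h → Integrable (fun w => e (x, w) ^ 2) (κ x) ∧
      ∫ w, e (x, w) ^ 2 ∂(κ x) ≤ A) :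
    MemLp (fun w : Datum d => ψ (w.1 / h) / h * e w) 2 (PX ⊗ₘ κ) ∧
      ∫ w, (ψ (w.1 / h) / h * e w) ^ 2 ∂(PX ⊗ₘ κ) ≤
        (b / h) ^ 2 * A * PX.real (Icc (-h) h) := by
  have hm : Measurable fun w : Datum d => ψ (w.1 / h) / h * e w :=
    ((hψ.measurable.comp (by fun_prop)).div_const _).mul he
  have hb : ∀ x, (ψ (x / h) / h) ^ 2 ≤ (b / h) ^ 2 := fun x => by
    rw [← sq_abs, abs_div, abs_of_pos hh]
    have := hψ.bound (x / h)
    gcongr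
  have := integrable_of_window (PX := PX) (κ := κ) (h := h) (A := (b / h) ^ 2 * A)
    (G := fun w => (ψ (w.1 / h) / h * e w) ^ 2) (hm.pow_const 2) (fun w => sq_nonneg _)
    (fun x hx w => by
      simp only
      rw [hψ.zero _ (by rwa [div_mem_Icc_iff hh])]; simp)
    (by
      filter_upwards [hin] with x hx hxm
      simp only [mul_pow]
      refine ⟨(hx hxm).1.const_mul _, ?_⟩
      rw [integral_const_mul]
      exact mul_le_mul (hb x) (hx hxm).2 (integral_nonneg fun _ => sq_nonneg _) (sq_nonneg _))
  exact ⟨(memLp_two_iff_integrable_sq hm.aestronglyMeasurable).2 this.1, this.2⟩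

end LocalIntegrals

/-! ### Concentration of kernel-weighted sample averages -/

section LawOfLargeNumbers

variable {S : ℕ} {d : ℕ → ℕ} {PX : Measure ℝ} [IsProbabilityMeasure PX] {fX K : ℝ → ℝ} {h : ℕ → ℝ}
  {κ : ∀ n, Kernel ℝ (Obs (d n))} [∀ n, IsMarkovKernel (κ n)]
  {ρ : ∀ n, Measure (Fin n → Fin S)} [∀ n, IsProbabilityMeasure (ρ n)]

theorem measurePreserving_snd_sampleLaw (n : ℕ) :
    MeasurePreserving Prod.snd (sampleLaw (ρ n) PX (κ n))
      (Measure.pi fun _ : Fin n => PX ⊗ₘ κ n) := by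
  unfold sampleLaw
  exact measurePreserving_snd

theorem exists_ofReal_div_sq_le (B : ℝ) {η : ENNReal} (hη : 0 < η) :
    ∃ C > 0, ENNReal.ofReal (B / C ^ 2) ≤ η := by
  have h1 : Tendsto (fun C : ℝ => ENNReal.ofReal (B / C ^ 2)) atTop (𝓝 0) := by
    have : Tendsto (fun C : ℝ => B / C ^ 2) atTop (𝓝 0) :=
      tendsto_const_nhds.div_atTop (tendsto_pow_atTop (by norm_num))
    simpa using ENNReal.tendsto_ofReal this
  obtain ⟨C, h2, h3⟩ := ((ENNReal.tendsto_nhds_zero.1 h1 η hη).and (eventually_gt_atTop 0)).exists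
  exact ⟨C, h3, h2⟩

/-- A second moment of order 1/h gives an average with variance of order 1/(nh), the square of
`sdRate`. Chebyshev's inequality at a large multiple of that rate concludes. -/
theorem DesignAssumption.bigOP_sampleAvg_sub (hd : DesignAssumption PX fX K h)
    {f : ∀ n, Datum (d n) → ℝ} {B : ℝ}
    (hf : ∀ᶠ n in atTop, MemLp (f n) 2 (PX ⊗ₘ κ n) ∧ ∫ w, f n w ^ 2 ∂(PX ⊗ₘ κ n) ≤ B / h n) :
    BigOP (fun n => sampleLaw (ρ n) PX (κ n))
      (fun n p => sampleAvg (f n) p.2 - ∫ w, f n w ∂(PX ⊗ₘ κ n)) (sdRate h) := by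
  intro η hη
  obtain ⟨C, hC, hCη⟩ := exists_ofReal_div_sq_le B hη
  refine ⟨C, hC, ?_⟩
  filter_upwards [hf, eventually_gt_atTop 0] with n hn hn0
  have hn0' : (0 : ℝ) < n := by exact_mod_cast hn0
  have hh := hd.bandwidth_pos n
  have hs : 0 < Real.sqrt (n * h n) := Real.sqrt_pos.2 (by positivity)
  have ht : 0 < n * (C * sdRate h n) := by unfold sdRate; positivity
  have := pi_sum_sub_le (ι := Fin n) (PX ⊗ₘ κ n) hn.1 hn.2 ht
  have hmp := measurePreserving_snd_sampleLaw (ρ := ρ) (PX := PX) (κ := κ) n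
  rw [← hmp.map_eq] at this
  have h2 := (Measure.le_map_apply hmp.measurable.aemeasurable _).trans this
  rw [Fintype.card_fin] at h2
  refine (measure_mono ?_).trans (h2.trans (le_trans (ENNReal.ofReal_le_ofReal ?_) hCη))
  · intro p hp hc
    refine hp ?_
    have e : sampleAvg (f n) p.2 - ∫ w, f n w ∂(PX ⊗ₘ κ n) =
        (n : ℝ)⁻¹ * (∑ i, f n (p.2 i) - n * ∫ w, f n w ∂(PX ⊗ₘ κ n)) := by
      unfold sampleAvg; field_simp
    rw [e, abs_mul, abs_of_pos (inv_pos.2 hn0')]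
    calc _ ≤ (n : ℝ)⁻¹ * (n * (C * sdRate h n)) := by gcongr
      _ = _ := by field_simp
  · refine le_of_eq ?_
    have : sdRate h n ^ 2 = (n * h n)⁻¹ := by
      rw [sdRate, inv_pow, Real.sq_sqrt (by positivity)]
    rw [mul_pow, mul_pow, this]
    field_simp

/-- The running variable has a density, so each observation avoids the cutoff almost surely. This
matters because conditional means are controlled only off 0, while the right-hand kernel may charge
0. -/
theorem DesignAssumption.whp_ne_zero (hd : DesignAssumption PX fX K h) :
    Whp (fun n => sampleLaw (ρ n) PX (κ n)) fun n p => ∀ i : Fin n, (p.2 i).1 ≠ 0 := by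
  refine tendsto_const_nhds.congr fun n => ?_
  have hmp : ∀ i : Fin n, MeasurePreserving
      (fun p : (Fin n → Fin S) × (Fin n → Datum (d n)) => (p.2 i).1)
      (sampleLaw (ρ n) PX (κ n)) PX := fun i =>
    (⟨measurable_fst, Measure.fst_compProd PX (κ n)⟩ : MeasurePreserving Prod.fst (PX ⊗ₘ κ n)
      PX).comp ((measurePreserving_eval _ i).comp
      (measurePreserving_snd_sampleLaw n))
  have : {p : (Fin n → Fin S) × (Fin n → Datum (d n)) | ¬ ∀ i : Fin n, (p.2 i).1 ≠ 0} =
      ⋃ i : Fin n, (fun p => (p.2 i).1) ⁻¹' {0} := by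
    ext p; simp
  rw [this, eq_comm, measure_iUnion_null_iff]
  intro i
  rw [(hmp i).measure_preimage (by simp)]
  exact hd.measure_zero

theorem integral_fst_compProd {d : ℕ} {κ : Kernel ℝ (Obs d)} [IsMarkovKernel κ] {g : ℝ → ℝ}
    (hg : Measurable g) : ∫ w, g w.1 ∂(PX ⊗ₘ κ) = ∫ x, g x ∂PX := by
  have h := (Measure.fst_compProd PX κ)
  conv_rhs => rw [← h, Measure.fst, integral_map measurable_fst.aemeasurable
    hg.aestronglyMeasurable]

theorem locMom_measurable {k : ℝ → ℝ} {b : ℝ} (hk : Windowed k b) (h : ℝ) (j : ℕ) :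
    Measurable (locMom k h j) :=
  ((hk.pow_mul j).measurable.comp (by fun_prop : Measurable fun x : ℝ => x / h)).div_const h

/-- The empirical kernel moments concentrate around their means. -/
theorem DesignAssumption.bigOP_locMom (hd : DesignAssumption PX fX K h) {k : ℝ → ℝ} {b : ℝ}
    (hk : Windowed k b) (j : ℕ) :
    BigOP (fun n => sampleLaw (ρ n) PX (κ n))
      (fun n p => sampleAvg (fun w : Datum (d n) => locMom k (h n) j w.1) p.2 -
        ∫ x, locMom k (h n) j x ∂PX) (sdRate h) := by
  obtain ⟨F, hF, hF2⟩ := hd.exists_measure_Icc_le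
  have := hd.bigOP_sampleAvg_sub (κ := κ) (ρ := ρ) (B := b ^ 2 * F)
    (f := fun n w => locMom k (h n) j w.1) (by
      filter_upwards [hF2] with n hn
      have hh := hd.bandwidth_pos n
      have := (hk.pow_mul j).memLp_mul (PX := PX) (κ := κ n) (A := 1) hh (e := fun _ => 1)
        measurable_const (Eventually.of_forall fun x _ => by simp)
      simp only [mul_one] at this
      refine ⟨this.1, this.2.trans ?_⟩
      calc _ ≤ (b / h n) ^ 2 * (F * h n) := by gcongr
        _ = _ := by field_simp)
  simp_rw [integral_fst_compProd (locMom_measurable hk _ j)] at this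
  exact this

theorem DesignAssumption.tendsto_integral_locMom (hd : DesignAssumption PX fX K h) {k : ℝ → ℝ}
    {b : ℝ} (hk : Windowed k b) (j : ℕ) :
    Tendsto (fun n => ∫ x, locMom k (h n) j x ∂PX) atTop (𝓝 (fX 0 * sideMoment k j)) :=
  hd.tendsto_integral_window (hk.pow_mul j)

theorem BigOP.littleOP_one {Ω : ℕ → Type*} [∀ n, MeasurableSpace (Ω n)] {μ : ∀ n, Measure (Ω n)}
    {R : ∀ n, Ω n → ℝ} {a : ℕ → ℝ} (hR : BigOP μ R a) (ha : Tendsto a atTop (𝓝 0)) :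
    LittleOP μ R fun _ => 1 :=
  hR.littleOP fun ε hε => by
    filter_upwards [ha.eventually (ge_mem_nhds hε)] with n hn
    simpa using hn

/-- The empirical kernel moments converge in probability. -/
theorem DesignAssumption.littleOP_locMom (hd : DesignAssumption PX fX K h) {k : ℝ → ℝ} {b : ℝ}
    (hk : Windowed k b) (j : ℕ) :
    LittleOP (fun n => sampleLaw (ρ n) PX (κ n))
      (fun n p => sampleAvg (fun w : Datum (d n) => locMom k (h n) j w.1) p.2 -
        fX 0 * sideMoment k j) (fun _ => 1) := by
  have h1 := (hd.bigOP_locMom (κ := κ) (ρ := ρ) hk j).littleOP_one hd.tendsto_sdRate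
  have h2 := (tendsto_sub_nhds_zero_iff.2 (hd.tendsto_integral_locMom hk j))
  have := h1.add (LittleOP.of_tendsto h2)
  simpa using this

/-- Cramer's rule for the 2×2 system, after rescaling the regressor by h; the intercept is invariant
under this rescaling, so powers of h cancel. The formula also covers a singular matrix, since the
matrix inverse and the division then both give 0. The sum runs over a subset s so that it applies to
a single fold, while the moments use the full sample. -/
theorem sideWeight_sum {n : ℕ} (hn : 0 < n) (k : ℝ → ℝ) {h : ℝ} (hh : 0 < h) (x y : Fin n → ℝ)
    (s : Finset (Fin n)) :
    ∑ i ∈ s, sideWeight (fun v => k (v / h) / h) x i * y i =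
      (sampleAvg (locMom k h 2) x * ((n : ℝ)⁻¹ * ∑ i ∈ s, locMom k h 0 (x i) * y i) -
        sampleAvg (locMom k h 1) x * ((n : ℝ)⁻¹ * ∑ i ∈ s, locMom k h 1 (x i) * y i)) /
      (sampleAvg (locMom k h 0) x * sampleAvg (locMom k h 2) x -
        sampleAvg (locMom k h 1) x ^ 2) := by
  have hn' : (n : ℝ) ≠ 0 := by exact_mod_cast hn.ne'
  set Q : ℕ → ℝ := fun j => sampleAvg (locMom k h j) x with hQ
  have hS : ∀ j, ∑ i, k (x i / h) / h * x i ^ j = n * h ^ j * Q j := fun j => by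
    simp only [hQ, sampleAvg, locMom]
    rw [mul_comm (n : ℝ), mul_assoc, mul_inv_cancel_left₀ hn', Finset.mul_sum]
    refine Finset.sum_congr rfl fun i _ => ?_
    rw [div_pow]; field_simp
  have hw : ∀ i, sideWeight (fun v => k (v / h) / h) x i =
      (n : ℝ)⁻¹ * (Q 2 * locMom k h 0 (x i) - Q 1 * locMom k h 1 (x i)) /
        (Q 0 * Q 2 - Q 1 ^ 2) := fun i => by
    have e0 := hS 0
    have e1 := hS 1
    have e2 := hS 2
    simp only [pow_zero, mul_one, pow_one] at e0 e1 e2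
    simp only [sideWeight, Matrix.inv_def, Matrix.det_fin_two, Matrix.adjugate_fin_two,
      Ring.inverse_eq_inv', Matrix.of_apply, Fin.val_zero, Fin.val_one, pow_zero, pow_one, mul_one,
      one_mul, one_pow, ← pow_two, e0, e1, e2, Matrix.smul_mulVec, Pi.smul_apply, smul_eq_mul]
    simp only [Matrix.mulVec, dotProduct, Fin.sum_univ_two, Matrix.of_apply, Matrix.cons_val_zero,
      Matrix.cons_val_one, Matrix.cons_val', Fin.val_zero, Fin.val_one, pow_zero, pow_one, mul_one]
    have ed : (n * Q 0) * (n * h ^ 2 * Q 2) - (n * h * Q 1) ^ 2 =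
        (n : ℝ) ^ 2 * h ^ 2 * (Q 0 * Q 2 - Q 1 ^ 2) := by ring
    rw [ed]
    generalize Q 0 * Q 2 - Q 1 ^ 2 = D
    simp only [locMom, pow_zero, one_mul, pow_one, mul_inv]
    rw [div_eq_mul_inv _ D]
    field_simp
    ring
  simp_rw [hw]
  simp only [Finset.mul_sum, ← Finset.sum_sub_distrib, Finset.sum_div]
  exact Finset.sum_congr rfl fun i _ => by simp only [hQ]; ring

end LawOfLargeNumbers

/-! ### Expansion of the one-sided local linear estimator -/

section SideExpansion

variable {S : ℕ} {d : ℕ → ℕ} {PX : Measure ℝ} [IsProbabilityMeasure PX] {fX K : ℝ → ℝ} {h : ℕ → ℝ}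
  {κ : ∀ n, Kernel ℝ (Obs (d n))} [∀ n, IsMarkovKernel (κ n)]
  {ρ : ∀ n, Measure (Fin n → Fin S)} [∀ n, IsProbabilityMeasure (ρ n)]

/-- The residual `y - E[y | X]`. -/
def residual {d : ℕ} (κ : Kernel ℝ (Obs d)) (y : Obs d → ℝ) (w : Datum d) : ℝ :=
  y w.2 - condMean κ y w.1

theorem measurable_condMean {d : ℕ} {κ : Kernel ℝ (Obs d)} {y : Obs d → ℝ} (hy : Measurable y) :
    Measurable (condMean κ y) :=
  (hy.stronglyMeasurable.integral_kernel).measurable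

theorem measurable_residual {d : ℕ} {κ : Kernel ℝ (Obs d)} {y : Obs d → ℝ} (hy : Measurable y) :
    Measurable (residual κ y) :=
  (hy.comp measurable_snd).sub ((measurable_condMean hy).comp measurable_fst)

/-- Conditionally on X the residual has mean zero, so any function of X multiplied by it integrates
to zero. -/
theorem integral_window_mul_residual {d : ℕ} {κ : Kernel ℝ (Obs d)} [IsMarkovKernel κ]
    {y : Obs d → ℝ} (hy : ∀ x ∈ PX.support, Integrable y (κ x)) (g : ℝ → ℝ)
    (hint : Integrable (fun w : Datum d => g w.1 * residual κ y w) (PX ⊗ₘ κ)) :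
    ∫ w, g w.1 * residual κ y w ∂(PX ⊗ₘ κ) = 0 := by
  rw [Measure.integral_compProd hint]
  refine integral_eq_zero_of_ae ?_
  filter_upwards [PX.support_mem_ae] with x hx
  simp only [residual]
  rw [integral_const_mul, integral_sub (hy x hx) (integrable_const _)]
  simp [condMean]

/-- The empirical moment of the running variable in the window. -/
def empMom (k : ℝ → ℝ) (h : ℝ) {d n S : ℕ} (j : ℕ) (p : (Fin n → Fin S) × (Fin n → Datum d)) : ℝ :=
  sampleAvg (fun w : Datum d => locMom k h j w.1) p.2

/-- The determinant of the matrix of empirical moments. -/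
def empDet (k : ℝ → ℝ) (h : ℝ) {d n S : ℕ} (p : (Fin n → Fin S) × (Fin n → Datum d)) : ℝ :=
  empMom k h 0 p * empMom k h 2 p - empMom k h 1 p ^ 2

theorem DesignAssumption.littleOP_empDet (hd : DesignAssumption PX fX K h) {k : ℝ → ℝ}
    (hk : SideKernel k) :
    LittleOP (fun n => sampleLaw (ρ n) PX (κ n))
      (fun n p => empDet k (h n) p - fX 0 ^ 2 * sideDet k) fun _ => 1 := by
  obtain ⟨b, hb⟩ := hk.windowed
  have q := fun j => hd.littleOP_locMom (κ := κ) (ρ := ρ) hb j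
  have h1 := (q 0).mul_sub (fun _ => le_rfl) (q 2) (fun _ => le_rfl)
  have h2 := (q 1).mul_sub (fun _ => le_rfl) (q 1) (fun _ => le_rfl)
  convert h1.sub h2 using 3
  simp only [empDet, empMom, sideDet]
  ring

theorem DesignAssumption.whp_empDet_ne_zero (hd : DesignAssumption PX fX K h) {k : ℝ → ℝ}
    (hk : SideKernel k) :
    Whp (fun n => sampleLaw (ρ n) PX (κ n)) fun n p => empDet k (h n) p ≠ 0 := by
  have hpos : 0 < fX 0 ^ 2 * sideDet k := mul_pos (pow_pos hd.density_pos 2) hk.det_pos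
  exact (hd.littleOP_empDet hk).whp_ne_zero hpos (fun _ => le_abs_self _)

theorem DesignAssumption.littleOP_empMom_div (hd : DesignAssumption PX fX K h) {k : ℝ → ℝ}
    (hk : SideKernel k) (j : ℕ) :
    LittleOP (fun n => sampleLaw (ρ n) PX (κ n))
      (fun n p => empMom k (h n) j p / empDet k (h n) p - sideMoment k j / (fX 0 * sideDet k))
      fun _ => 1 := by
  obtain ⟨b, hb⟩ := hk.windowed
  have hf := hd.density_pos
  have hD := hk.det_pos
  have hpos : 0 < fX 0 ^ 2 * sideDet k := mul_pos (pow_pos hf 2) hD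
  have h1 := (hd.littleOP_empDet (κ := κ) (ρ := ρ) hk).inv_sub hpos (fun _ => le_abs_self _)
  have h2 := (hd.littleOP_locMom (κ := κ) (ρ := ρ) hb j).mul_sub (fun _ => le_rfl) h1
    (fun _ => le_rfl)
  convert h2 using 3
  have : sideMoment k j / (fX 0 * sideDet k) =
      fX 0 * sideMoment k j * (fX 0 ^ 2 * sideDet k)⁻¹ := by
    field_simp
  rw [this, div_eq_mul_inv]
  rfl

theorem LittleOP.to_totRate {Ω : ℕ → Type*} [∀ n, MeasurableSpace (Ω n)] {μ : ∀ n, Measure (Ω n)}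
    {R : ∀ n, Ω n → ℝ} (hR : LittleOP μ R (sdRate h)) : LittleOP μ R (totRate h) :=
  hR.mono_rate one_pos (Eventually.of_forall fun n => by
    rw [one_mul, totRate]; linarith [sq_nonneg (h n)])

theorem LittleOP.sq_to_totRate {Ω : ℕ → Type*} [∀ n, MeasurableSpace (Ω n)]
    {μ : ∀ n, Measure (Ω n)} {R : ∀ n, Ω n → ℝ} (hR : LittleOP μ R fun n => h n ^ 2) :
    LittleOP μ R (totRate h) :=
  hR.mono_rate one_pos (Eventually.of_forall fun n => by
    rw [one_mul, totRate]; linarith [sdRate_nonneg h n])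

/-- The linearized stochastic part of the local linear intercept estimator. -/
def linearPart {d n S : ℕ} (k : ℝ → ℝ) (f₀ h : ℝ) (κ : Kernel ℝ (Obs d)) (y : Obs d → ℝ)
    (p : (Fin n → Fin S) × (Fin n → Datum d)) : ℝ :=
  sampleAvg (fun w : Datum d => equivKernel k (w.1 / h) / h / f₀ * residual κ y w) p.2

theorem linearPart_eq {d n S : ℕ} (k : ℝ → ℝ) (f₀ h : ℝ) (κ : Kernel ℝ (Obs d)) (y : Obs d → ℝ)
    (p : (Fin n → Fin S) × (Fin n → Datum d)) :
    linearPart k f₀ h κ y p = sideMoment k 2 / (f₀ * sideDet k) *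
        sampleAvg (fun w : Datum d => locMom k h 0 w.1 * residual κ y w) p.2 -
      sideMoment k 1 / (f₀ * sideDet k) *
        sampleAvg (fun w : Datum d => locMom k h 1 w.1 * residual κ y w) p.2 := by
  simp only [linearPart, sampleAvg, Finset.mul_sum, ← Finset.sum_sub_distrib]
  refine Finset.sum_congr rfl fun i _ => ?_
  simp only [equivKernel, locMom]
  generalize sideDet k = D
  rw [mul_comm f₀ D, ← div_div, ← div_div]
  ring

theorem DesignAssumption.bigOP_residual (hd : DesignAssumption PX fX K h) {k : ℝ → ℝ} {b : ℝ}
    (hk : Windowed k b) {y : ∀ n, Obs (d n) → ℝ} (hym : ∀ n, Measurable (y n))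
    (hyint : ∀ n, ∀ x ∈ PX.support, Integrable (y n) (κ n x)) {A : ℝ}
    (hyvar : ∀ n, ∀ x ∈ PX.support, Integrable (fun w => residual (κ n) (y n) (x, w) ^ 2) (κ n x) ∧
      ∫ w, residual (κ n) (y n) (x, w) ^ 2 ∂(κ n x) ≤ A) (j : ℕ) :
    BigOP (fun n => sampleLaw (ρ n) PX (κ n))
      (fun n p => sampleAvg (fun w : Datum (d n) => locMom k (h n) j w.1 *
        residual (κ n) (y n) w) p.2) (sdRate h) := by
  obtain ⟨F, hF, hF2⟩ := hd.exists_measure_Icc_le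
  have key : ∀ n, MemLp (fun w : Datum (d n) => locMom k (h n) j w.1 * residual (κ n) (y n) w) 2
      (PX ⊗ₘ κ n) ∧ ∫ w, (locMom k (h n) j w.1 * residual (κ n) (y n) w) ^ 2 ∂(PX ⊗ₘ κ n) ≤
        (b / h n) ^ 2 * A * PX.real (Icc (-h n) (h n)) := fun n =>
    (hk.pow_mul j).memLp_mul (hd.bandwidth_pos n) (measurable_residual (hym n)) (by
      filter_upwards [PX.support_mem_ae] with x hx _
      exact hyvar n x hx)
  have hA : 0 ≤ A := by
    obtain ⟨x, hx⟩ := PX.nonempty_support (IsProbabilityMeasure.ne_zero PX)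
    exact (integral_nonneg fun _ => sq_nonneg _).trans (hyvar 0 x hx).2
  have := hd.bigOP_sampleAvg_sub (κ := κ) (ρ := ρ) (B := b ^ 2 * A * F)
    (f := fun n w => locMom k (h n) j w.1 * residual (κ n) (y n) w) (by
      filter_upwards [hF2] with n hn
      have hh := hd.bandwidth_pos n
      refine ⟨(key n).1, (key n).2.trans ?_⟩
      calc _ ≤ (b / h n) ^ 2 * A * (F * h n) := by gcongr
        _ = _ := by field_simp)
  simp_rw [fun n => integral_window_mul_residual (hyint n) (locMom k (h n) j)
    ((key n).1.integrable (by norm_num)), sub_zero] at this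
  exact this

/-- Expansion of the one-sided local linear estimator. -/
theorem DesignAssumption.side_expansion (hd : DesignAssumption PX fX K h) {k : ℝ → ℝ}
    (hk : SideKernel k) {y : ∀ n, Obs (d n) → ℝ} (hym : ∀ n, Measurable (y n))
    (hyint : ∀ n, ∀ x ∈ PX.support, Integrable (y n) (κ n x)) {A : ℝ}
    (hyvar : ∀ n, ∀ x ∈ PX.support, Integrable (fun w => residual (κ n) (y n) (x, w) ^ 2) (κ n x) ∧
      ∫ w, residual (κ n) (y n) (x, w) ^ 2 ∂(κ n x) ≤ A)
    {a b s : ℕ → ℝ} {C L : ℝ} (hs : ∀ n, |s n| ≤ C) (hL : 0 ≤ L)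
    (hexp : ∀ᶠ n in atTop, ∀ x, x ≠ 0 → k (x / h n) ≠ 0 →
      |condMean (κ n) (y n) x - a n - b n * x - s n / 2 * x ^ 2| ≤ L * |x| ^ 3) :
    LittleOP (fun n => sampleLaw (ρ n) PX (κ n))
      (fun n p => ∑ i, sideWeight (fun v => k (v / h n) / h n) (fun j => (p.2 j).1) i *
          y n (p.2 i).2 -
        (a n + (sideMoment k 2 ^ 2 - sideMoment k 1 * sideMoment k 3) / sideDet k * (s n / 2) *
          h n ^ 2 + linearPart k (fX 0) (h n) (κ n) (y n) p)) (totRate h) := by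
  obtain ⟨bb, hb⟩ := hk.windowed
  have hf := hd.density_pos
  have hD := hk.det_pos
  set μ := fun n => sampleLaw (ρ n) PX (κ n) with hμ
  have q := fun j => hd.littleOP_locMom (κ := κ) (ρ := ρ) hb j
  have r := fun j => hd.littleOP_empMom_div (κ := κ) (ρ := ρ) hk j
  have E := fun j => hd.bigOP_residual (ρ := ρ) hb hym hyint hyvar j
  have rB := fun j => (r j).bigOP_of_sub (fun _ => le_rfl)
  -- the approximation error of the conditional mean
  let rem : ∀ n, ℝ → ℝ := fun n x =>
    condMean (κ n) (y n) x - a n - b n * x - s n / 2 * x ^ 2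
  let R : ℕ → ∀ n, (Fin n → Fin S) × (Fin n → Datum (d n)) → ℝ := fun j n p =>
    sampleAvg (fun w : Datum (d n) => locMom k (h n) j w.1 * rem n w.1) p.2
  -- The cubic Taylor error is at most L h³ on the window, and the empirical kernel mass is O_P(1),
  -- so every moment of the error is O_P(h³) = o_P(h²).
  have hQ0 : BigOP μ (fun n p => L * h n ^ 3 * empMom k (h n) 0 p) (fun n => h n ^ 3) := by
    have h1 : BigOP μ (fun n _ => L * h n ^ 3) (fun n => h n ^ 3) :=
      BigOP.of_bounded (C := L + 1) (by positivity) (.of_eventually (Eventually.of_forall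
        fun n _ => by
          have := pow_pos (hd.bandwidth_pos n) 3
          rw [abs_of_nonneg (by positivity)]
          nlinarith))
    have h2 := h1.mul ((q 0).bigOP_of_sub (fun _ => le_rfl))
    simp only [mul_one] at h2
    exact h2
  have hR : ∀ j, LittleOP μ (R j) (totRate h) := fun j => by
    refine LittleOP.sq_to_totRate (BigOP.littleOP (hQ0.of_whp_le ?_) ?_)
    · refine hd.whp_ne_zero.mono_eventually ?_
      filter_upwards [hexp] with n hn p hp
      have hh := hd.bandwidth_pos n
      refine le_trans ?_ (le_abs_self _)
      simp only [R, empMom, sampleAvg]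
      rw [abs_mul, abs_of_nonneg (inv_nonneg.2 (Nat.cast_nonneg n)), mul_left_comm]
      refine mul_le_mul_of_nonneg_left ?_ (inv_nonneg.2 (Nat.cast_nonneg n))
      refine (Finset.abs_sum_le_sum_abs _ _).trans ?_
      rw [Finset.mul_sum]
      refine Finset.sum_le_sum fun i _ => ?_
      simp only [locMom, pow_zero, one_mul]
      by_cases h0 : k ((p.2 i).1 / h n) = 0
      · simp [h0]
      · have hmem : (p.2 i).1 / h n ∈ Icc (-1 : ℝ) 1 := by
          by_contra hc; exact h0 (hb.zero _ hc)
        have hx := abs_le.2 ((div_mem_Icc_iff hh).1 hmem)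
        have h1 := hn _ (hp i) h0
        have hkn := hk.nonneg ((p.2 i).1 / h n)
        rw [abs_mul, abs_div, abs_mul, abs_of_pos hh, abs_of_nonneg hkn, mul_comm]
        have h2 : |((p.2 i).1 / h n) ^ j| ≤ 1 := by
          rw [abs_pow]; exact pow_le_one₀ (abs_nonneg _) (abs_le.2 hmem)
        have h3 : |rem n (p.2 i).1| ≤ L * h n ^ 3 := h1.trans (by gcongr)
        calc _ ≤ L * h n ^ 3 * (1 * k ((p.2 i).1 / h n) / h n) := by gcongr
          _ = _ := by rw [one_mul]
    · intro ε hε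
      filter_upwards [hd.eventually_lt hε] with n hn
      have := sq_nonneg (h n)
      nlinarith
  -- the curvature term
  have hcurv : LittleOP μ (fun n p => s n / 2 * h n ^ 2 *
      (empMom k (h n) 2 p / empDet k (h n) p * empMom k (h n) 2 p -
        empMom k (h n) 1 p / empDet k (h n) p * empMom k (h n) 3 p -
        (sideMoment k 2 ^ 2 - sideMoment k 1 * sideMoment k 3) / sideDet k)) (totRate h) := by
    have h1 := ((r 2).mul_sub (fun _ => le_rfl) (q 2) (fun _ => le_rfl)).sub
      ((r 1).mul_sub (fun _ => le_rfl) (q 3) (fun _ => le_rfl))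
    have h2 : BigOP μ (fun n _ => s n / 2 * h n ^ 2) (fun n => h n ^ 2) := by
      refine BigOP.of_bounded (C := |C| + 1) (by positivity) (.of_eventually (Eventually.of_forall
        fun n _ => ?_))
      rw [abs_mul, abs_div, abs_two, abs_of_nonneg (sq_nonneg (h n))]
      have := (hs n).trans (le_abs_self C)
      have := abs_nonneg (s n)
      refine mul_le_mul_of_nonneg_right ?_ (sq_nonneg _)
      linarith
    have h3 := h1.mul_bigOP h2
    simp only [one_mul] at h3
    refine LittleOP.sq_to_totRate ?_
    convert h3 using 3
    have : (sideMoment k 2 ^ 2 - sideMoment k 1 * sideMoment k 3) / sideDet k =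
      sideMoment k 2 / (fX 0 * sideDet k) * (fX 0 * sideMoment k 2) -
      sideMoment k 1 / (fX 0 * sideDet k) * (fX 0 * sideMoment k 3) := by field_simp
    rw [this]
    simp only [empMom]
    ring
  have hE2 := ((r 2).mul_bigOP (E 0))
  have hE1 := ((r 1).mul_bigOP (E 1))
  simp only [one_mul] at hE1 hE2
  have hR0 := (hR 0).mul_bigOP (rB 2)
  have hR1 := (hR 1).mul_bigOP (rB 1)
  simp only [mul_one] at hR0 hR1
  refine ((hcurv.add (hE2.sub hE1).to_totRate).add (hR0.sub hR1)).of_whp_eq ?_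
  refine (hd.whp_empDet_ne_zero hk).mono_eventually ?_
  filter_upwards [eventually_gt_atTop 0] with n hn p hp
  have hh := hd.bandwidth_pos n
  -- Each weighted moment of the outcome splits into level, slope, curvature, Taylor error and
  -- residual. In the combination given by Cramer's rule the level coefficient is q₂q₀ - q₁² = D and
  -- the slope coefficient is q₂q₁ - q₁q₂ = 0. Both identities are exact, which is why the sequences
  -- a and b need no bounds.
  have hsum : ∀ j, (n : ℝ)⁻¹ * ∑ i, locMom k (h n) j (p.2 i).1 * y n (p.2 i).2 =
      a n * empMom k (h n) j p + b n * h n * empMom k (h n) (j + 1) p +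
        s n / 2 * h n ^ 2 * empMom k (h n) (j + 2) p + R j n p +
        sampleAvg (fun w : Datum (d n) => locMom k (h n) j w.1 * residual (κ n) (y n) w) p.2 := by
    intro j
    simp only [R, empMom, sampleAvg, Finset.mul_sum, ← Finset.sum_add_distrib]
    refine Finset.sum_congr rfl fun i _ => ?_
    simp only [locMom, residual, rem, pow_succ]
    field_simp
    ring
  have hsw := sideWeight_sum hn k hh (fun j => (p.2 j).1) (fun i => y n (p.2 i).2) Finset.univ
  rw [hsw, hsum 0, hsum 1, linearPart_eq]
  change (empMom k (h n) 2 p * _ - empMom k (h n) 1 p * _) / (empMom k (h n) 0 p *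
    empMom k (h n) 2 p - empMom k (h n) 1 p ^ 2) - _ = _
  have hdet : empMom k (h n) 0 p * empMom k (h n) 2 p - empMom k (h n) 1 p ^ 2 =
    empDet k (h n) p := rfl
  rw [hdet]
  generalize sampleAvg (fun w : Datum (d n) => locMom k (h n) 0 w.1 * residual (κ n) (y n) w) p.2
    = E0
  generalize sampleAvg (fun w : Datum (d n) => locMom k (h n) 1 w.1 * residual (κ n) (y n) w) p.2
    = E1
  generalize hr2 : sideMoment k 2 / (fX 0 * sideDet k) = c2
  generalize hr1 : sideMoment k 1 / (fX 0 * sideDet k) = c1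
  generalize (sideMoment k 2 ^ 2 - sideMoment k 1 * sideMoment k 3) / sideDet k = β
  generalize R 0 n p = R0
  generalize R 1 n p = R1
  generalize empMom k (h n) 3 p = q3
  simp only [zero_add, Nat.reduceAdd]
  generalize empMom k (h n) 2 p = q2 at *
  generalize empMom k (h n) 1 p = q1 at *
  generalize empMom k (h n) 0 p = q0 at *
  generalize empDet k (h n) p = D at *
  field_simp
  linear_combination (2 * a n) * hdet

end SideExpansion

/-! ### Conditional concentration under cross-fitting -/

section CrossFitting

/-- The split is independent of the data, so a bound valid for each fixed split integrates to the
same bound. There are finitely many splits, so measurability of the fibres suffices. -/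
theorem sampleLaw_le_of_forall {d n S : ℕ} {ρ : Measure (Fin n → Fin S)} [IsProbabilityMeasure ρ]
    {PX : Measure ℝ} [IsProbabilityMeasure PX] {κ : Kernel ℝ (Obs d)} [IsMarkovKernel κ]
    {E : (Fin n → Fin S) → Set (Fin n → Datum d)} {c : ENNReal} (hE : ∀ σ, MeasurableSet (E σ))
    (hc : ∀ σ, (Measure.pi fun _ : Fin n => PX ⊗ₘ κ) (E σ) ≤ c) :
    sampleLaw ρ PX κ {p | p.2 ∈ E p.1} ≤ c := by
  have hm : MeasurableSet {p : (Fin n → Fin S) × (Fin n → Datum d) | p.2 ∈ E p.1} := by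
    have : {p : (Fin n → Fin S) × (Fin n → Datum d) | p.2 ∈ E p.1} = ⋃ σ, {σ} ×ˢ E σ := by
      ext p; simp
    rw [this]
    exact MeasurableSet.iUnion fun σ => (measurableSet_singleton σ).prod (hE σ)
  rw [sampleLaw, Measure.prod_apply hm]
  calc _ ≤ ∫⁻ _ : Fin n → Fin S, c ∂ρ := lintegral_mono fun σ => hc σ
    _ = c := by simp

/-- Conditionally on the observations in `A`, the observations outside `A` are i.i.d., so that
Chebyshev's inequality applies to functions that depend on the observations in `A`. -/
theorem pi_split_chebyshev {n : ℕ} {D : Type*} [MeasurableSpace D] (P : Measure D)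
    [IsProbabilityMeasure P] (A T : Finset (Fin n)) (hT : ∀ i, i ∈ T ↔ i ∉ A)
    {Φ : (A → D) × D → ℝ} (hΦ : Measurable Φ) {B t : ℝ} (hB : 0 ≤ B) (ht : 0 < t) :
    MeasurableSet {W : Fin n → D |
      ∫⁻ w, ENNReal.ofReal (Φ (fun i : A => W i, w) ^ 2) ∂P ≤ ENNReal.ofReal B ∧
      ¬ |∑ i ∈ T, Φ (fun i : A => W i, W i) - T.card * ∫ w, Φ (fun i : A => W i, w) ∂P| ≤ t} ∧
    (Measure.pi fun _ => P) {W : Fin n → D |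
      ∫⁻ w, ENNReal.ofReal (Φ (fun i : A => W i, w) ^ 2) ∂P ≤ ENNReal.ofReal B ∧
      ¬ |∑ i ∈ T, Φ (fun i : A => W i, W i) - T.card * ∫ w, Φ (fun i : A => W i, w) ∂P| ≤ t} ≤
      ENNReal.ofReal (T.card * B / t ^ 2) := by
  -- The second-moment condition depends on the coordinates in A alone and is part of the event. As
  -- a lower integral it is measurable and meaningful without integrability. Sections on which it
  -- fails are empty, so Chebyshev's inequality is needed only where it holds.
  set E' : Set (({i // i ∈ A} → D) × ({i // i ∉ A} → D)) := {q |
      ∫⁻ w, ENNReal.ofReal (Φ (q.1, w) ^ 2) ∂P ≤ ENNReal.ofReal B ∧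
      ¬ |∑ i, Φ (q.1, q.2 i) - T.card * ∫ w, Φ (q.1, w) ∂P| ≤ t} with hE'
  have hmp := measurePreserving_piEquivPiSubtypeProd (fun _ : Fin n => P) (fun i => i ∈ A)
  have hpre : {W : Fin n → D |
      ∫⁻ w, ENNReal.ofReal (Φ (fun i : A => W i, w) ^ 2) ∂P ≤ ENNReal.ofReal B ∧
      ¬ |∑ i ∈ T, Φ (fun i : A => W i, W i) - T.card * ∫ w, Φ (fun i : A => W i, w) ∂P| ≤ t} =
      MeasurableEquiv.piEquivPiSubtypeProd (fun _ : Fin n => D) (fun i => i ∈ A) ⁻¹' E' := by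
    ext W
    simp only [mem_ofPred_eq, mem_preimage, hE']
    rw [Finset.sum_subtype T hT]
    rfl
  have hmE : MeasurableSet E' := by
    have m1 : Measurable fun q : ({i // i ∈ A} → D) × ({i // i ∉ A} → D) =>
        ∫⁻ w, ENNReal.ofReal (Φ (q.1, w) ^ 2) ∂P := by
      have : Measurable fun a : {i // i ∈ A} → D => ∫⁻ w, ENNReal.ofReal (Φ (a, w) ^ 2) ∂P :=
        Measurable.lintegral_prod_right' (f := fun z => ENNReal.ofReal (Φ z ^ 2))
          (hΦ.pow_const 2).ennreal_ofReal
      exact this.comp measurable_fst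
    have m2 : Measurable fun q : ({i // i ∈ A} → D) × ({i // i ∉ A} → D) =>
        ∫ w, Φ (q.1, w) ∂P := by
      have : StronglyMeasurable fun a : {i // i ∈ A} → D => ∫ w, Φ (a, w) ∂P :=
        hΦ.stronglyMeasurable.integral_prod_right'
      exact this.measurable.comp measurable_fst
    have m3 : Measurable fun q : ({i // i ∈ A} → D) × ({i // i ∉ A} → D) =>
        ∑ i, Φ (q.1, q.2 i) := Finset.measurable_sum _ fun i _ =>
      hΦ.comp (measurable_fst.prodMk ((measurable_pi_apply i).comp measurable_snd))
    exact (measurableSet_le m1 measurable_const).inter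
      (measurableSet_le (m3.sub (m2.const_mul _)).abs measurable_const).compl
  rw [hpre]
  refine ⟨hmp.measurable hmE, ?_⟩
  rw [hmp.measure_preimage hmE.nullMeasurableSet, Measure.prod_apply hmE]
  have hcard : Fintype.card {i // i ∉ A} = T.card := by
    rw [Fintype.card_subtype]
    congr 1
    ext i
    simp [hT]
  have hsec : ∀ a : {i // i ∈ A} → D, (Measure.pi fun _ : {i // i ∉ A} => P)
      (Prod.mk a ⁻¹' E') ≤ ENNReal.ofReal (T.card * B / t ^ 2) := fun a => by
    by_cases ha : ∫⁻ w, ENNReal.ofReal (Φ (a, w) ^ 2) ∂P ≤ ENNReal.ofReal B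
    · have hma : Measurable fun w => Φ (a, w) := hΦ.comp measurable_prodMk_left
      have hint : Integrable (fun w => Φ (a, w) ^ 2) P := by
        refine ⟨(hma.pow_const 2).aestronglyMeasurable, ?_⟩
        rw [hasFiniteIntegral_iff_ofReal (Eventually.of_forall fun w => sq_nonneg _)]
        exact ha.trans_lt ENNReal.ofReal_lt_top
      have hle : ∫ w, Φ (a, w) ^ 2 ∂P ≤ B := by
        rw [integral_eq_lintegral_of_nonneg_ae (Eventually.of_forall fun w => sq_nonneg _)
          (hma.pow_const 2).aestronglyMeasurable]
        exact ENNReal.toReal_le_of_le_ofReal hB ha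
      have := pi_sum_sub_le (ι := {i // i ∉ A}) P
        ((memLp_two_iff_integrable_sq hma.aestronglyMeasurable).2 hint) hle ht
      rw [hcard] at this
      exact (measure_mono fun b hb => hb.2).trans this
    · have : Prod.mk a ⁻¹' E' = ∅ := by
        ext b
        simp only [hE', mem_preimage, mem_ofPred_eq, mem_empty_iff_false, iff_false, not_and]
        exact fun h => absurd h ha
      rw [this, measure_empty]
      exact zero_le
  refine (lintegral_mono fun a => hsec a).trans (le_of_eq ?_)
  rw [lintegral_const, measure_univ, mul_one]

variable {S : ℕ} {d : ℕ → ℕ} {PX : Measure ℝ} [IsProbabilityMeasure PX] {fX K : ℝ → ℝ} {h : ℕ → ℝ}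
  {κ : ∀ n, Kernel ℝ (Obs (d n))} [∀ n, IsMarkovKernel (κ n)]
  {ρ : ∀ n, Measure (Fin n → Fin S)} [∀ n, IsProbabilityMeasure (ρ n)]
  {est : ∀ n, FirstStage (d n) n} {ηbar : ∀ n, (Fin (d n) → ℝ) → ℝ}

/-- The observations in fold `s`. -/
def fold {n S : ℕ} (σ : Fin n → Fin S) (s : Fin S) : Finset (Fin n) :=
  Finset.univ.filter fun i => σ i = s

/-- The deviation of the cross-fitted function from its target. -/
def fitGap {d n S : ℕ} (est : FirstStage d n) (ηbar : (Fin d → ℝ) → ℝ) (s : Fin S)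
    (p : (Fin n → Fin S) × (Fin n → Datum d)) : (Fin d → ℝ) → ℝ :=
  crossFit est p.1 s p.2 - ηbar

theorem measurable_covs {d : ℕ} : Measurable (covs : Obs d → Fin d → ℝ) :=
  measurable_snd.comp measurable_snd

/-- The fold averages of a cross-fitted function concentrate around the conditional means given the
data outside the fold. -/
theorem DesignAssumption.littleOP_fold (hd : DesignAssumption PX fX K h) {k : ℝ → ℝ} {b : ℝ}
    (hk : Windowed k b)
    (hest : ∀ n (A : Finset (Fin n)), Measurable
      fun p : (A → Datum (d n)) × (Fin (d n) → ℝ) => est n A p.1 p.2)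
    (hη : ∀ n, Measurable (ηbar n)) {𝒯 : ∀ n, Set ((Fin (d n) → ℝ) → ℝ)} {r : ℕ → ℝ} {c : ℝ}
    (hr : Tendsto r atTop (𝓝 0)) (h𝒯 : ∀ n, ∀ η ∈ 𝒯 n, Measurable η) {s : Fin S}
    (hwhp : Whp (fun n => sampleLaw (ρ n) PX (κ n)) fun n p => crossFit (est n) p.1 s p.2 ∈ 𝒯 n)
    (hms : ∀ᶠ n in atTop, ∀ η ∈ 𝒯 n, ∀ x ∈ localSupport PX (h n),
      Integrable (fun w => onCovs (η - ηbar n) w ^ 2) (κ n x) ∧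
      condMean (κ n) (fun w => onCovs (η - ηbar n) w ^ 2) x ≤ c * r n ^ 2) (j : ℕ) :
    LittleOP (fun n => sampleLaw (ρ n) PX (κ n))
      (fun n p => (n : ℝ)⁻¹ * ∑ i ∈ fold p.1 s, locMom k (h n) j (p.2 i).1 *
          onCovs (fitGap (est n) (ηbar n) s p) (p.2 i).2 -
        (fold p.1 s).card / n * ∫ w, locMom k (h n) j w.1 *
          onCovs (fitGap (est n) (ηbar n) s p) w.2 ∂(PX ⊗ₘ κ n)) (sdRate h) := by
  obtain ⟨F, hF, hF2⟩ := hd.exists_measure_Icc_le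
  intro ε hε
  -- An upper bound for the second moment of one summand: (b/h)² from the kernel weight, |c| r² from
  -- the conditional mean square, and F h from the mass of the window.
  set B : ℕ → ℝ := fun n => b ^ 2 * |c| * F * r n ^ 2 / h n with hBdef
  let t : ℕ → ℝ := fun n => n * (ε * sdRate h n)
  let A : ∀ n, (Fin n → Fin S) → Finset (Fin n) := fun n σ => Finset.univ.filter fun i => σ i ≠ s
  let Φ : ∀ n (σ : Fin n → Fin S), (A n σ → Datum (d n)) × Datum (d n) → ℝ := fun n σ q =>
    locMom k (h n) j q.2.1 * (est n (A n σ) q.1 (covs q.2.2) - ηbar n (covs q.2.2))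
  have hΦ : ∀ n σ, Measurable (Φ n σ) := fun n σ => by
    have m1 : Measurable fun q : (A n σ → Datum (d n)) × Datum (d n) => covs q.2.2 :=
      measurable_covs.comp (measurable_snd.comp measurable_snd)
    refine ((locMom_measurable hk (h n) j).comp (measurable_fst.comp measurable_snd)).mul
      (Measurable.sub ?_ ((hη n).comp m1))
    exact (hest n (A n σ)).comp (measurable_fst.prodMk m1)
  have hBn : ∀ n, 0 ≤ B n := fun n => by
    have := hd.bandwidth_pos n
    positivity
  -- The event that the fitted function lies in `𝒯 n` need not be measurable. It is replaced by the
  -- measurable second-moment condition, which it implies. The Chebyshev bound is then of order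
  -- r²/ε², so the deviation is o_P, not merely O_P, at the rate (nh)^{-1/2}.
  let E : ∀ n, (Fin n → Fin S) → Set (Fin n → Datum (d n)) := fun n σ => {W |
      ∫⁻ w, ENNReal.ofReal (Φ n σ (fun i : A n σ => W i, w) ^ 2) ∂(PX ⊗ₘ κ n) ≤
        ENNReal.ofReal (B n) ∧
      ¬ |∑ i ∈ fold σ s, Φ n σ (fun i : A n σ => W i, W i) -
        (fold σ s).card * ∫ w, Φ n σ (fun i : A n σ => W i, w) ∂(PX ⊗ₘ κ n)| ≤ t n}
  have hE : ∀ n, 0 < n → sampleLaw (ρ n) PX (κ n) {p | p.2 ∈ E n p.1} ≤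
      ENNReal.ofReal (b ^ 2 * |c| * F * r n ^ 2 / ε ^ 2) := fun n hn => by
    have hn' : (0 : ℝ) < n := by exact_mod_cast hn
    have hh := hd.bandwidth_pos n
    have hs : 0 < Real.sqrt (n * h n) := Real.sqrt_pos.2 (by positivity)
    have ht : 0 < t n := by simp only [t, sdRate]; positivity
    have hch := fun σ => pi_split_chebyshev (PX ⊗ₘ κ n) (A n σ) (fold σ s)
      (fun i => by simp [fold, A]) (hΦ n σ) (hBn n) ht
    refine sampleLaw_le_of_forall (fun σ => (hch σ).1) fun σ => (hch σ).2.trans ?_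
    refine ENNReal.ofReal_le_ofReal ?_
    have hcard : ((fold σ s).card : ℝ) ≤ n := by
      have := Finset.card_le_univ (fold σ s)
      rw [Fintype.card_fin] at this
      exact_mod_cast this
    have e : sdRate h n ^ 2 = (n * h n)⁻¹ := by
      rw [sdRate, inv_pow, Real.sq_sqrt (by positivity)]
    calc _ ≤ n * B n / t n ^ 2 := by gcongr
      _ = _ := by
        simp only [t, hBdef, mul_pow, e]
        field_simp
  have hlim : Tendsto (fun n => ENNReal.ofReal (b ^ 2 * |c| * F * r n ^ 2 / ε ^ 2)) atTop
      (𝓝 0) := by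
    have : Tendsto (fun n => b ^ 2 * |c| * F * r n ^ 2 / ε ^ 2) atTop (𝓝 0) := by
      simpa using ((hr.pow 2).const_mul (b ^ 2 * |c| * F)).div_const (ε ^ 2)
    simpa using ENNReal.tendsto_ofReal this
  have hEw : Whp (fun n => sampleLaw (ρ n) PX (κ n)) fun n p => ¬ p.2 ∈ E n p.1 := by
    refine tendsto_of_tendsto_of_tendsto_of_le_of_le' tendsto_const_nhds hlim
      (Eventually.of_forall fun _ => zero_le) ?_
    filter_upwards [eventually_gt_atTop 0] with n hn
    simpa using hE n hn
  refine (hwhp.and hEw).mono_eventually ?_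
  filter_upwards [hms, hF2, eventually_gt_atTop 0] with n hms hF2 hn p hp
  obtain ⟨hp1, hp2⟩ := hp
  have hn' : (0 : ℝ) < n := by exact_mod_cast hn
  have hh := hd.bandwidth_pos n
  have hgap : ∀ w : Datum (d n), locMom k (h n) j w.1 * onCovs (fitGap (est n) (ηbar n) s p) w.2 =
      Φ n p.1 (fun i : A n p.1 => p.2 i, w) := fun w => rfl
  have hlint : ∫⁻ w, ENNReal.ofReal (Φ n p.1 (fun i : A n p.1 => p.2 i, w) ^ 2) ∂(PX ⊗ₘ κ n) ≤
      ENNReal.ofReal (B n) := by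
    have hm := (hk.pow_mul j).memLp_mul (PX := PX) (κ := κ n) (A := |c| * r n ^ 2) hh
      (e := fun w => onCovs (fitGap (est n) (ηbar n) s p) w.2)
      ((((h𝒯 n _ hp1).sub (hη n)).comp measurable_covs).comp measurable_snd) (by
        filter_upwards [PX.support_mem_ae] with x hx hxI
        have := hms _ hp1 x ⟨hx, hxI⟩
        refine ⟨this.1, this.2.trans ?_⟩
        have := le_abs_self c
        gcongr)
    refine (ofReal_integral_eq_lintegral_ofReal hm.1.integrable_sq
      (Eventually.of_forall fun w => sq_nonneg _)).symm.le.trans ?_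
    refine ENNReal.ofReal_le_ofReal (hm.2.trans ?_)
    calc _ ≤ (b / h n) ^ 2 * (|c| * r n ^ 2) * (F * h n) := by gcongr
      _ = _ := by simp only [hBdef]; field_simp
  have := not_not.1 fun hc => hp2 ⟨hlint, hc⟩
  simp_rw [hgap]
  have e : (n : ℝ)⁻¹ * ∑ i ∈ fold p.1 s, Φ n p.1 (fun i : A n p.1 => p.2 i, p.2 i) -
      (fold p.1 s).card / n * ∫ w, Φ n p.1 (fun i : A n p.1 => p.2 i, w) ∂(PX ⊗ₘ κ n) =
      (n : ℝ)⁻¹ * (∑ i ∈ fold p.1 s, Φ n p.1 (fun i : A n p.1 => p.2 i, p.2 i) -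
      (fold p.1 s).card * ∫ w, Φ n p.1 (fun i : A n p.1 => p.2 i, w) ∂(PX ⊗ₘ κ n)) := by
    field_simp
  rw [e, abs_mul, abs_of_pos (inv_pos.2 hn')]
  calc _ ≤ (n : ℝ)⁻¹ * t n := by gcongr
    _ = _ := by simp only [t]; field_simp

end CrossFitting

/-! ### The first-stage contribution at the cutoff -/

section FirstStageBias

theorem contDiffOn_condMean_sub {d : ℕ} {κ : Kernel ℝ (Obs d)} {η η' : (Fin d → ℝ) → ℝ}
    (hη : η ∈ admissible κ) (hη' : η' ∈ admissible κ) :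
    ∃ ε > 0, ContDiffOn ℝ 2 (condMean κ (onCovs (η - η'))) (Ioo (-ε) ε) := by
  obtain ⟨-, ε, hε, hi, hc⟩ := hη
  obtain ⟨-, ε', hε', hi', hc'⟩ := hη'
  have s1 : Ioo (-min ε ε') (min ε ε') ⊆ Ioo (-ε) ε := Ioo_subset_Ioo
    (neg_le_neg (min_le_left _ _)) (min_le_left _ _)
  have s2 : Ioo (-min ε ε') (min ε ε') ⊆ Ioo (-ε') ε' := Ioo_subset_Ioo
    (neg_le_neg (min_le_right _ _)) (min_le_right _ _)
  refine ⟨min ε ε', lt_min hε hε', ((hc.mono s1).sub (hc'.mono s2)).congr fun x hx => ?_⟩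
  exact integral_sub (hi x (s1 hx)) (hi' x (s2 hx))

/-- Nonnegativity of the variance, that is, Jensen's inequality. -/
theorem abs_condMean_le_sqrt {d : ℕ} {κ : Kernel ℝ (Obs d)} [IsMarkovKernel κ] {g : Obs d → ℝ}
    (hg : Measurable g) {x R : ℝ} (hi : Integrable (fun w => g w ^ 2) (κ x))
    (hR : condMean κ (fun w => g w ^ 2) x ≤ R) : |condMean κ g x| ≤ Real.sqrt R := by
  refine Real.abs_le_sqrt (le_trans ?_ hR)
  have h1 := variance_eq_sub ((memLp_two_iff_integrable_sq hg.aestronglyMeasurable).2 hi)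
  have h2 := variance_nonneg g (κ x)
  rw [h1] at h2
  simpa [condMean] using h2

variable {S : ℕ} {d : ℕ → ℕ} {PX : Measure ℝ} [IsProbabilityMeasure PX] {fX K : ℝ → ℝ} {h : ℕ → ℝ}
  {κ : ∀ n, Kernel ℝ (Obs (d n))} [∀ n, IsMarkovKernel (κ n)]
  {ρ : ∀ n, Measure (Fin n → Fin S)} [∀ n, IsProbabilityMeasure (ρ n)]
  {est : ∀ n, FirstStage (d n) n} {ηbar : ∀ n, (Fin (d n) → ℝ) → ℝ}

/-- The conditional mean g of the gap stays within M x² of its tangent at 0. Against a kernel weight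
of size b/h on the window this costs M h b times the mass of the window. The slope is read off from
values of g: h g'(0) is g(h) - g(0) up to M h², and the values are small by the mean-square bound.
-/
theorem abs_integral_gap_sub_le {d : ℕ} {κ : Kernel ℝ (Obs d)} [IsMarkovKernel κ] {k : ℝ → ℝ}
    {b h : ℝ} (hh : 0 < h) (hk : Windowed k b) {η η' : (Fin d → ℝ) → ℝ}
    (hη : η ∈ admissible κ) (hη' : η' ∈ admissible κ) {R M : ℝ} (hM : 0 ≤ M)
    (hsupp : Icc (-h) h ⊆ PX.support)
    (hms : ∀ x ∈ localSupport PX h, Integrable (fun w => onCovs (η - η') w ^ 2) (κ x) ∧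
      condMean κ (fun w => onCovs (η - η') w ^ 2) x ≤ R)
    (hder : ∀ x ∈ localSupport PX h \ {0},
      DifferentiableAt ℝ (condMean κ (onCovs (η - η'))) x ∧
      DifferentiableAt ℝ (deriv (condMean κ (onCovs (η - η')))) x ∧
      |iteratedDeriv 2 (condMean κ (onCovs (η - η'))) x| ≤ M) :
    |condMean κ (onCovs (η - η')) 0| ≤ Real.sqrt R ∧
    |h * deriv (condMean κ (onCovs (η - η'))) 0| ≤ 2 * Real.sqrt R + M * h ^ 2 ∧
    ∀ j, |∫ w, locMom k h j w.1 * onCovs (η - η') w.2 ∂(PX ⊗ₘ κ) -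
      (condMean κ (onCovs (η - η')) 0 * ∫ x, locMom k h j x ∂PX +
        h * deriv (condMean κ (onCovs (η - η'))) 0 * ∫ x, locMom k h (j + 1) x ∂PX)| ≤
      M * h * b * PX.real (Icc (-h) h) := by
  have hηm : Measurable (η - η') := hη.1.sub hη'.1
  have hgm : Measurable (onCovs (η - η') : Obs d → ℝ) := hηm.comp measurable_covs
  have hloc : localSupport PX h = Icc (-h) h := inter_eq_right.2 hsupp
  rw [hloc] at hms hder
  have hg := fun x hx => abs_condMean_le_sqrt hgm (hms x hx).1 (hms x hx).2
  obtain ⟨ε, hε, hC⟩ := contDiffOn_condMean_sub hη hη'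
  set g := condMean κ (onCovs (η - η')) with hgdef
  have h0 : (0 : ℝ) ∈ Ioo (-ε) ε := ⟨by linarith, hε⟩
  have hnhds : Ioo (-ε) ε ∈ 𝓝 (0 : ℝ) := isOpen_Ioo.mem_nhds h0
  have hlin := abs_sub_linear_le (g := g) (h := h) (M := M)
    (fun x hx => by
      by_cases hx0 : x = 0
      · rw [hx0]
        exact ((hC.differentiableOn (by norm_num)) 0 h0).differentiableAt hnhds
      · exact (hder x ⟨hx, hx0⟩).1)
    ((hC.continuousOn_deriv_of_isOpen isOpen_Ioo (by norm_num)).continuousAt hnhds)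
    (fun x hx => (hder x hx).2.1)
    (fun x hx => by rw [← iteratedDeriv_two_eq]; exact (hder x hx).2.2)
  have m0 : (0 : ℝ) ∈ Icc (-h) h := ⟨by linarith, hh.le⟩
  have mh : h ∈ Icc (-h) h := ⟨by linarith, le_rfl⟩
  refine ⟨hg 0 m0, ?_, fun j => ?_⟩
  · have e : h * deriv g 0 = g h - g 0 - (g h - g 0 - deriv g 0 * h) := by ring
    rw [e]
    have := abs_sub (g h - g 0) (g h - g 0 - deriv g 0 * h)
    have := abs_sub (g h) (g 0)
    linarith [hlin h mh, hg 0 m0, hg h mh]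
  · have iδ : Integrable (fun w : Datum d => locMom k h j w.1 * onCovs (η - η') w.2) (PX ⊗ₘ κ) :=
      ((hk.pow_mul j).memLp_mul (PX := PX) (κ := κ) hh (hgm.comp measurable_snd) (by
        filter_upwards with x hx
        exact hms x hx)).1.integrable (by norm_num)
    have il : ∀ j, Integrable (fun w : Datum d => locMom k h j w.1) (PX ⊗ₘ κ) := fun j => by
      have := (hk.pow_mul j).memLp_mul (PX := PX) (κ := κ) (A := 1) hh (e := fun _ => 1)
        measurable_const (Eventually.of_forall fun x _ => by simp)
      have := this.1.integrable (by norm_num)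
      simp only [mul_one] at this
      exact this
    have isum : Integrable (fun w : Datum d => g 0 * locMom k h j w.1 +
        h * deriv g 0 * locMom k h (j + 1) w.1) (PX ⊗ₘ κ) :=
      ((il j).const_mul _).add ((il (j + 1)).const_mul _)
    have iall : Integrable (fun w : Datum d => locMom k h j w.1 * onCovs (η - η') w.2 -
        (g 0 * locMom k h j w.1 + h * deriv g 0 * locMom k h (j + 1) w.1)) (PX ⊗ₘ κ) :=
      iδ.sub isum
    have e : ∫ w, locMom k h j w.1 * onCovs (η - η') w.2 ∂(PX ⊗ₘ κ) -
        (g 0 * ∫ x, locMom k h j x ∂PX + h * deriv g 0 * ∫ x, locMom k h (j + 1) x ∂PX) =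
        ∫ w, (locMom k h j w.1 * onCovs (η - η') w.2 - (g 0 * locMom k h j w.1 +
          h * deriv g 0 * locMom k h (j + 1) w.1)) ∂(PX ⊗ₘ κ) := by
      rw [integral_sub iδ isum,
        integral_add ((il j).const_mul _) ((il (j + 1)).const_mul _), integral_const_mul,
        integral_const_mul, integral_fst_compProd (locMom_measurable hk h j),
        integral_fst_compProd (locMom_measurable hk h (j + 1))]
    rw [e, Measure.integral_compProd iall]
    have ic : Integrable ((Icc (-h) h).indicator fun _ => M * h * b) PX :=
      (integrable_const _).indicator measurableSet_Icc
    rw [← Real.norm_eq_abs]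
    refine le_of_le_of_eq (norm_integral_le_of_norm_le ic (Eventually.of_forall fun x => ?_))
      (by rw [integral_indicator_const _ measurableSet_Icc, smul_eq_mul, mul_comm])
    have hstep : locMom k h (j + 1) x = locMom k h j x * (x / h) := by
      simp only [locMom, pow_succ]; ring
    by_cases hx : x ∈ Icc (-h) h
    · have hi : Integrable (onCovs (η - η')) (κ x) :=
        ((memLp_two_iff_integrable_sq hgm.aestronglyMeasurable).2 (hms x hx).1).integrable
          (by norm_num)
      simp only
      rw [integral_sub (hi.const_mul _) (integrable_const _), integral_const_mul]
      have e2 : locMom k h j x * ∫ w, onCovs (η - η') w ∂(κ x) -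
          ∫ _, (g 0 * locMom k h j x + h * deriv g 0 * locMom k h (j + 1) x) ∂(κ x) =
          locMom k h j x * (g x - g 0 - deriv g 0 * x) := by
        rw [integral_const]
        simp only [probReal_univ, one_smul, hstep, hgdef, condMean]
        field_simp
        ring
      rw [e2, indicator_of_mem hx, norm_mul, Real.norm_eq_abs, Real.norm_eq_abs]
      have hw : |locMom k h j x| ≤ b / h := by
        rw [locMom, abs_div, abs_of_pos hh]
        exact div_le_div_of_nonneg_right ((hk.pow_mul j).bound _) hh.le
      have hx2 : x ^ 2 ≤ h ^ 2 := sq_le_sq' hx.1 hx.2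
      calc _ ≤ (b / h) * (M * x ^ 2) := mul_le_mul hw (hlin x hx) (abs_nonneg _)
            (div_nonneg hk.nonneg hh.le)
        _ ≤ (b / h) * (M * h ^ 2) := by
            have := div_nonneg hk.nonneg hh.le
            gcongr
        _ = _ := by field_simp
    · have hz : k (x / h) = 0 := hk.zero _ (by rwa [div_mem_Icc_iff hh])
      rw [indicator_of_notMem hx]
      simp [locMom, hz]

/-- The contribution of the first stage to the one-sided estimator does not depend on the side, up
to negligible terms. -/
theorem DesignAssumption.side_firstStage (hd : DesignAssumption PX fX K h) {k : ℝ → ℝ}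
    (hk : SideKernel k)
    (hest : ∀ n (A : Finset (Fin n)), Measurable
      fun p : (A → Datum (d n)) × (Fin (d n) → ℝ) => est n A p.1 p.2)
    (hfirst : FirstStageAssumption PX h κ ρ est ηbar) :
    LittleOP (fun n => sampleLaw (ρ n) PX (κ n))
      (fun n p => ∑ i, sideWeight (fun v => k (v / h n) / h n) (fun j => (p.2 j).1) i *
          onCovs (fitGap (est n) (ηbar n) (p.1 i) p) (p.2 i).2 -
        ∑ s, ((fold p.1 s).card : ℝ) / n *
          condMean (κ n) (onCovs (fitGap (est n) (ηbar n) s p)) 0) (totRate h) := by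
  obtain ⟨𝒯, r, v, hadm, hbar, hwhp, hr, ⟨c, hms⟩, -, hv2, ⟨c', hder⟩⟩ := hfirst
  obtain ⟨b, hb⟩ := hk.windowed
  obtain ⟨δ, hδ, F₀, -, -, -, hsupp⟩ := hd.exists_local
  obtain ⟨F, hF, hF2⟩ := hd.exists_measure_Icc_le
  set μ := fun n => sampleLaw (ρ n) PX (κ n) with hμ
  have hη : ∀ n, Measurable (ηbar n) := fun n => (hadm n (hbar n)).1
  have hgood : ∀ s, Whp μ fun n p => crossFit (est n) p.1 s p.2 ∈ 𝒯 n := fun s => hwhp s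
  have hb0 := hb.nonneg
  -- deterministic bounds for the deviations in `𝒯 n`
  have hdet : ∀ᶠ n in atTop, ∀ η ∈ 𝒯 n,
      |condMean (κ n) (onCovs (η - ηbar n)) 0| ≤ Real.sqrt (c * r n ^ 2) ∧
      |h n * deriv (condMean (κ n) (onCovs (η - ηbar n))) 0| ≤
        2 * Real.sqrt (c * r n ^ 2) + |c'| * |v 2 n| * h n ^ 2 ∧
      ∀ j, |∫ w, locMom k (h n) j w.1 * onCovs (η - ηbar n) w.2 ∂(PX ⊗ₘ κ n) -
        (condMean (κ n) (onCovs (η - ηbar n)) 0 * ∫ x, locMom k (h n) j x ∂PX +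
          h n * deriv (condMean (κ n) (onCovs (η - ηbar n))) 0 *
            ∫ x, locMom k (h n) (j + 1) x ∂PX)| ≤ |c'| * |v 2 n| * b * F * h n ^ 2 := by
    filter_upwards [hms, hder, hF2, hd.eventually_lt hδ] with n h1 h2 h3 h4 η hη
    have hh := hd.bandwidth_pos n
    have hM : 0 ≤ |c'| * |v 2 n| := by positivity
    have := abs_integral_gap_sub_le (PX := PX) hh hb (hadm n hη) (hadm n (hbar n)) hM
      (fun x hx => interior_subset (hsupp ⟨by linarith [hx.1], by linarith [hx.2]⟩)) (h1 η hη)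
      (fun x hx => ⟨(h2 η hη x hx).1, (h2 η hη x hx).2.1, ((h2 η hη x hx).2.2 2 (by simp)).trans
        (mul_le_mul_of_nonneg_right (le_abs_self _) (abs_nonneg _))⟩)
    refine ⟨this.1, this.2.1, fun j => (this.2.2 j).trans ?_⟩
    calc _ ≤ |c'| * |v 2 n| * h n * b * (F * h n) := by gcongr
      _ = _ := by ring
  have hsq : Tendsto (fun n => Real.sqrt (c * r n ^ 2)) atTop (𝓝 0) := by
    have := (hr.pow 2).const_mul c
    rw [zero_pow two_ne_zero, mul_zero] at this
    simpa using this.sqrt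
  have hv2' : Tendsto (fun n => |v 2 n|) atTop (𝓝 0) := by simpa using hv2.abs
  -- one fold at a time
  have hfoldle : ∀ (n : ℕ) (σ : Fin n → Fin S) s, |((fold σ s).card : ℝ) / n| ≤ 1 := by
    intro n σ s
    rw [abs_of_nonneg (by positivity)]
    refine div_le_one_of_le₀ ?_ (Nat.cast_nonneg n)
    have := Finset.card_le_univ (fold σ s)
    rw [Fintype.card_fin] at this
    exact_mod_cast this
  have hfold : ∀ s, LittleOP μ (fun n p =>
      ∑ i ∈ fold p.1 s, sideWeight (fun v => k (v / h n) / h n) (fun j => (p.2 j).1) i *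
          onCovs (fitGap (est n) (ηbar n) s p) (p.2 i).2 -
        ((fold p.1 s).card : ℝ) / n *
          condMean (κ n) (onCovs (fitGap (est n) (ηbar n) s p)) 0) (totRate h) := by
    intro s
    have fB : BigOP μ (fun n p => ((fold p.1 s).card : ℝ) / n) fun _ => 1 :=
      BigOP.of_bounded one_pos (.of_eventually (Eventually.of_forall fun n p => by
        simpa using hfoldle n p.1 s))
    have g0 : LittleOP μ (fun n p => condMean (κ n) (onCovs (fitGap (est n) (ηbar n) s p)) 0)
        fun _ => 1 := by
      refine LittleOP.of_le_null hsq (fun _ => zero_le_one) ((hgood s).mono_eventually ?_)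
      filter_upwards [hdet] with n hn p hp
      rw [mul_one]; exact (hn _ hp).1
    have g1 : LittleOP μ (fun n p => h n *
        deriv (condMean (κ n) (onCovs (fitGap (est n) (ηbar n) s p))) 0) fun _ => 1 := by
      have hlim : Tendsto (fun n => 2 * Real.sqrt (c * r n ^ 2) + |c'| * |v 2 n| * h n ^ 2) atTop
          (𝓝 0) := by
        have := (hsq.const_mul 2).add ((hv2'.const_mul |c'|).mul (hd.bandwidth_zero.pow 2))
        simpa using this
      refine LittleOP.of_le_null hlim (fun _ => zero_le_one) ((hgood s).mono_eventually ?_)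
      filter_upwards [hdet] with n hn p hp
      rw [mul_one]; exact (hn _ hp).2.1
    let Rj : ℕ → ∀ n, (Fin n → Fin S) × (Fin n → Datum (d n)) → ℝ := fun j n p =>
      (n : ℝ)⁻¹ * ∑ i ∈ fold p.1 s, locMom k (h n) j (p.2 i).1 *
          onCovs (fitGap (est n) (ηbar n) s p) (p.2 i).2 -
        (fold p.1 s).card / n * (condMean (κ n) (onCovs (fitGap (est n) (ηbar n) s p)) 0 *
          ∫ x, locMom k (h n) j x ∂PX +
          h n * deriv (condMean (κ n) (onCovs (fitGap (est n) (ηbar n) s p))) 0 *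
            ∫ x, locMom k (h n) (j + 1) x ∂PX)
    have hR : ∀ j, LittleOP μ (Rj j) (totRate h) := fun j => by
      have h1 := hd.littleOP_fold hb hest hη hr (fun n η hη => (hadm n hη).1) (hgood s) hms j
      have h2 : LittleOP μ (fun n p => ∫ w, locMom k (h n) j w.1 *
          onCovs (fitGap (est n) (ηbar n) s p) w.2 ∂(PX ⊗ₘ κ n) -
          (condMean (κ n) (onCovs (fitGap (est n) (ηbar n) s p)) 0 *
          ∫ x, locMom k (h n) j x ∂PX +
          h n * deriv (condMean (κ n) (onCovs (fitGap (est n) (ηbar n) s p))) 0 *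
            ∫ x, locMom k (h n) (j + 1) x ∂PX)) (fun n => h n ^ 2) := by
        have hlim : Tendsto (fun n => |c'| * |v 2 n| * b * F) atTop (𝓝 0) := by
          simpa using ((hv2'.const_mul |c'|).mul_const b).mul_const F
        refine LittleOP.of_le_null hlim (fun n => sq_nonneg _) ((hgood s).mono_eventually ?_)
        filter_upwards [hdet] with n hn p hp
        exact (hn _ hp).2.2 j
      have h3 := h2.mul_bigOP fB
      simp only [mul_one] at h3
      convert h1.to_totRate.add h3.sq_to_totRate using 3
      simp only [Rj]
      ring
    have q := fun j => hd.bigOP_locMom (κ := κ) (ρ := ρ) hb j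
    have rB := fun j => (hd.littleOP_empMom_div (κ := κ) (ρ := ρ) hk j).bigOP_of_sub
      (fun _ => le_rfl)
    -- With empirical in place of population moments, the local linear weights would return the
    -- value G0 at the cutoff and remove the slope G1 exactly. The discrepancy between these moments
    -- is O_P((nh)^{-1/2}) and is multiplied by G0 or G1, which are only o_P(1). The products t2 and
    -- t3 are therefore negligible without any rate for the first stage.
    have t1 := ((hR 0).mul_bigOP (rB 2)).sub ((hR 1).mul_bigOP (rB 1))
    have t2 := (g0.mul_bigOP (((rB 1).mul (q 1)).sub ((rB 2).mul (q 0)))).mul_bigOP fB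
    have t3 := (g1.mul_bigOP (((rB 1).mul (q 2)).sub ((rB 2).mul (q 1)))).mul_bigOP fB
    simp only [one_mul, mul_one] at t1 t2 t3
    refine (t1.add (t2.add t3).to_totRate).of_whp_eq ?_
    refine (hd.whp_empDet_ne_zero hk).mono_eventually ?_
    filter_upwards [eventually_gt_atTop 0] with n hn p hp
    have hh := hd.bandwidth_pos n
    rw [sideWeight_sum hn k hh (fun j => (p.2 j).1)
      (fun i => onCovs (fitGap (est n) (ηbar n) s p) (p.2 i).2) (fold p.1 s)]
    have hR' : ∀ j, (n : ℝ)⁻¹ * ∑ i ∈ fold p.1 s, locMom k (h n) j (p.2 i).1 *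
        onCovs (fitGap (est n) (ηbar n) s p) (p.2 i).2 = Rj j n p +
        (fold p.1 s).card / n * (condMean (κ n) (onCovs (fitGap (est n) (ηbar n) s p)) 0 *
          ∫ x, locMom k (h n) j x ∂PX +
          h n * deriv (condMean (κ n) (onCovs (fitGap (est n) (ηbar n) s p))) 0 *
            ∫ x, locMom k (h n) (j + 1) x ∂PX) := fun j => by simp only [Rj]; ring
    rw [hR' 0, hR' 1]
    change (empMom k (h n) 2 p * _ - empMom k (h n) 1 p * _) / (empMom k (h n) 0 p *
      empMom k (h n) 2 p - empMom k (h n) 1 p ^ 2) - _ = _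
    have hdet : empMom k (h n) 0 p * empMom k (h n) 2 p - empMom k (h n) 1 p ^ 2 =
      empDet k (h n) p := rfl
    have hQ : ∀ j, sampleAvg (fun w : Datum (d n) => locMom k (h n) j w.1) p.2 =
      empMom k (h n) j p := fun _ => rfl
    simp only [hQ]
    rw [hdet]
    simp only [zero_add, Nat.reduceAdd]
    generalize Rj 0 n p = R0
    generalize Rj 1 n p = R1
    generalize h n * deriv (condMean (κ n) (onCovs (fitGap (est n) (ηbar n) s p))) 0 = G1
    generalize condMean (κ n) (onCovs (fitGap (est n) (ηbar n) s p)) 0 = G0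
    generalize ((fold p.1 s).card : ℝ) / n = f
    generalize empMom k (h n) 2 p = q2 at *
    generalize empMom k (h n) 1 p = q1 at *
    generalize empMom k (h n) 0 p = q0 at *
    generalize empDet k (h n) p = D at *
    generalize ∫ x, locMom k (h n) 0 x ∂PX = M0
    generalize ∫ x, locMom k (h n) 1 x ∂PX = M1
    generalize ∫ x, locMom k (h n) 2 x ∂PX = M2
    field_simp
    linear_combination (G0 * f) * hdet
  refine (LittleOP.sum Finset.univ (totRate_nonneg h) fun s _ => hfold s).of_whp_eq
    (.of_eventually (Eventually.of_forall fun n p => ?_))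
  rw [Finset.sum_sub_distrib]
  congr 1
  rw [← Finset.sum_fiberwise Finset.univ p.1]
  refine Finset.sum_congr rfl fun s _ => Finset.sum_congr rfl fun i hi => ?_
  rw [(Finset.mem_filter.1 hi).2]

end FirstStageBias

/-! ### Existence of the one-sided limits and expansions at the cutoff -/

section OneSidedLimits

theorem limPlus_eq {f : ℝ → ℝ} {a : ℝ} (hf : Tendsto f (𝓝[>] 0) (𝓝 a)) : limPlus f = a :=
  rightLim_eq_of_tendsto hf

theorem limMinus_eq {f : ℝ → ℝ} {a : ℝ} (hf : Tendsto f (𝓝[<] 0) (𝓝 a)) : limMinus f = a :=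
  leftLim_eq_of_tendsto hf

theorem HasOneSidedLimits.of_tendsto {f : ℝ → ℝ} {a b : ℝ} (ha : Tendsto f (𝓝[>] 0) (𝓝 a))
    (hb : Tendsto f (𝓝[<] 0) (𝓝 b)) :
    HasOneSidedLimits f ∧ limPlus f = a ∧ limMinus f = b := by
  have h1 := limPlus_eq ha
  have h2 := limMinus_eq hb
  exact ⟨⟨h1 ▸ ha, h2 ▸ hb⟩, h1, h2⟩

theorem Ioo_neg_subset_left {δ : ℝ} (hδ : 0 < δ) : Ioo (-δ) 0 ⊆ Ioo (-δ) δ :=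
  Ioo_subset_Ioo le_rfl hδ.le

theorem Ioo_pos_subset_right {δ : ℝ} (hδ : 0 < δ) : Ioo 0 δ ⊆ Ioo (-δ) δ :=
  Ioo_subset_Ioo (by linarith) le_rfl

theorem eventually_nhdsWithin_of_Ioo {δ : ℝ} (hδ : 0 < δ) {p : ℝ → Prop}
    (hp : ∀ x ∈ Ioo (-δ) δ, x ≠ 0 → p x) : (∀ᶠ x in 𝓝[>] 0, p x) ∧ ∀ᶠ x in 𝓝[<] 0, p x := by
  constructor
  · filter_upwards [Ioo_mem_nhdsGT hδ] with x hx
    exact hp x (Ioo_pos_subset_right hδ hx) hx.1.ne'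
  · filter_upwards [Ioo_mem_nhdsLT (neg_lt_zero.2 hδ)] with x hx
    exact hp x (Ioo_neg_subset_left hδ hx) hx.2.ne

variable {d : ℕ} {PX : Measure ℝ} {κ : Kernel ℝ (Obs d)} {m : Obs d → ℝ} {C L δ : ℝ}

theorem SmoothMean.differentiableAt (hm : SmoothMean PX C L κ m) {x : ℝ}
    (hx : x ∈ interior PX.support) (h0 : x ≠ 0) :
    DifferentiableAt ℝ (condMean κ m) x ∧ DifferentiableAt ℝ (deriv (condMean κ m)) x := by
  have ho : IsOpen (interior PX.support \ {0}) := isOpen_interior.sdiff isClosed_singleton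
  have hn := ho.mem_nhds ⟨hx, h0⟩
  obtain ⟨-, hc, -⟩ := hm
  refine ⟨(hc.differentiableOn (by norm_num)).differentiableAt hn, ?_⟩
  have h1 : ContDiffOn ℝ 1 (deriv (condMean κ m)) (interior PX.support \ {0}) :=
    hc.deriv_of_isOpen ho (by norm_num)
  exact (h1.differentiableOn (by norm_num)).differentiableAt hn

/-- The quadratic expansions of the conditional mean on the two sides of the cutoff. -/
theorem SmoothMean.expansion (hm : SmoothMean PX C L κ m) (hδ : 0 < δ)
    (hsub : Ioo (-δ) δ ⊆ interior PX.support) :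
    HasOneSidedLimits (condMean κ m) ∧ HasOneSidedLimits (iteratedDeriv 2 (condMean κ m)) ∧
    |limPlus (iteratedDeriv 2 (condMean κ m))| ≤ C ∧
    |limMinus (iteratedDeriv 2 (condMean κ m))| ≤ C ∧
    (∃ b, ∀ x ∈ Ioo 0 δ, |condMean κ m x - limPlus (condMean κ m) - b * x -
      limPlus (iteratedDeriv 2 (condMean κ m)) / 2 * x ^ 2| ≤ |L| * |x| ^ 3) ∧
    ∃ b, ∀ x ∈ Ioo (-δ) 0, |condMean κ m x - limMinus (condMean κ m) - b * x -
      limMinus (iteratedDeriv 2 (condMean κ m)) / 2 * x ^ 2| ≤ |L| * |x| ^ 3 := by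
  have hd := fun x (hx : x ∈ Ioo (-δ) δ) (h0 : x ≠ 0) => hm.differentiableAt (hsub hx) h0
  have hlip : ∀ x ∈ Ioo (-δ) δ, ∀ y ∈ Ioo (-δ) δ, 0 < x * y →
      |iteratedDeriv 2 (condMean κ m) x - iteratedDeriv 2 (condMean κ m) y| ≤ |L| * |x - y| :=
    fun x hx y hy hxy => (hm.2.2.2 x ⟨hsub hx, fun h => by
      rw [mem_singleton_iff.1 h, zero_mul] at hxy; exact hxy.ne rfl⟩ y ⟨hsub hy, fun h => by
      rw [mem_singleton_iff.1 h, mul_zero] at hxy; exact hxy.ne rfl⟩ hxy).trans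
      (mul_le_mul_of_nonneg_right (le_abs_self L) (abs_nonneg _))
  have s1 := Ioo_pos_subset_right hδ
  have s2 := Ioo_neg_subset_left hδ
  obtain ⟨a, b, s, ha, hs, hexp⟩ := exists_right_expansion hδ (abs_nonneg L)
    (fun x hx => (hd x (s1 hx) hx.1.ne').1) (fun x hx => (hd x (s1 hx) hx.1.ne').2)
    (fun x hx y hy => hlip x (s1 hx) y (s1 hy) (mul_pos hx.1 hy.1))
  obtain ⟨a', b', s', ha', hs', hexp'⟩ := exists_left_expansion hδ (abs_nonneg L)
    (fun x hx => (hd x (s2 hx) hx.2.ne).1) (fun x hx => (hd x (s2 hx) hx.2.ne).2)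
    (fun x hx y hy => hlip x (s2 hx) y (s2 hy) (mul_pos_of_neg_of_neg hx.2 hy.2))
  obtain ⟨h1, e1, e2⟩ := HasOneSidedLimits.of_tendsto ha ha'
  obtain ⟨h2, e3, e4⟩ := HasOneSidedLimits.of_tendsto hs hs'
  have hb := eventually_nhdsWithin_of_Ioo hδ (p := fun x => |iteratedDeriv 2 (condMean κ m) x| ≤ C)
    fun x hx h0 => hm.2.2.1 x ⟨hsub hx, h0⟩
  rw [e1, e2, e3, e4]
  exact ⟨h1, h2, le_of_tendsto hs.abs hb.1, le_of_tendsto hs'.abs hb.2, ⟨b, hexp⟩, ⟨b', hexp'⟩⟩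

/-- Adjusting the outcome by an admissible function changes the conditional mean by a function that
is smooth at the cutoff. -/
theorem condMean_adjusted {y : Obs d → ℝ} {η : (Fin d → ℝ) → ℝ} (hη : η ∈ admissible κ)
    (hm : ∀ x ∈ PX.support, Integrable (adjusted y η) (κ x)) (hδ : 0 < δ)
    (hsub : Ioo (-δ) δ ⊆ interior PX.support) :
    ∃ ε > 0, ContDiffOn ℝ 2 (condMean κ (onCovs η)) (Ioo (-ε) ε) ∧
      Ioo (-ε) ε ⊆ interior PX.support ∧ ∀ x ∈ Ioo (-ε) ε, Integrable y (κ x) ∧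
      condMean κ y x = condMean κ (adjusted y η) x + condMean κ (onCovs η) x := by
  obtain ⟨-, ε, hε, hi, hc⟩ := hη
  have s1 : Ioo (-min ε δ) (min ε δ) ⊆ Ioo (-ε) ε := Ioo_subset_Ioo
    (neg_le_neg (min_le_left _ _)) (min_le_left _ _)
  have s2 : Ioo (-min ε δ) (min ε δ) ⊆ Ioo (-δ) δ := Ioo_subset_Ioo
    (neg_le_neg (min_le_right _ _)) (min_le_right _ _)
  refine ⟨min ε δ, lt_min hε hδ, hc.mono s1, s2.trans hsub, fun x hx => ?_⟩
  have i1 := hm x (interior_subset (hsub (s2 hx)))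
  have i2 := hi x (s1 hx)
  have e : (fun w => adjusted y η w + onCovs η w) = y := by
    ext w; simp [adjusted]
  refine ⟨e ▸ i1.add i2, ?_⟩
  have := integral_add i1 i2
  rw [e] at this
  exact this

theorem contDiffOn_tendsto_zero {g : ℝ → ℝ} {ε : ℝ} (hε : 0 < ε)
    (hg : ContDiffOn ℝ 2 g (Ioo (-ε) ε)) :
    Tendsto g (𝓝 0) (𝓝 (g 0)) ∧ Tendsto (iteratedDeriv 2 g) (𝓝 0) (𝓝 (iteratedDeriv 2 g 0)) := by
  have hn : Ioo (-ε) ε ∈ 𝓝 (0 : ℝ) := Ioo_mem_nhds (by linarith) hε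
  refine ⟨hg.continuousOn.continuousAt hn, ?_⟩
  rw [iteratedDeriv_two_eq]
  have h1 : ContDiffOn ℝ 1 (deriv g) (Ioo (-ε) ε) := hg.deriv_of_isOpen isOpen_Ioo (by norm_num)
  exact (h1.continuousOn_deriv_of_isOpen isOpen_Ioo (by norm_num)).continuousAt hn

/-- The one-sided limits of the outcome and of the adjusted outcome. -/
theorem limits_adjusted {y : Obs d → ℝ} {η : (Fin d → ℝ) → ℝ} (hη : η ∈ admissible κ)
    (hm : SmoothMean PX C L κ (adjusted y η)) (hδ : 0 < δ)
    (hsub : Ioo (-δ) δ ⊆ interior PX.support) :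
    HasOneSidedLimits (condMean κ y) ∧
    rdJump κ y = limPlus (condMean κ (adjusted y η)) - limMinus (condMean κ (adjusted y η)) := by
  obtain ⟨ε, hε, hc, -, he⟩ := condMean_adjusted hη hm.1 hδ hsub
  have hg := (contDiffOn_tendsto_zero hε hc).1
  obtain ⟨⟨h1, h2⟩, -⟩ := hm.expansion hδ hsub
  have hev := eventually_nhdsWithin_of_Ioo hε (p := fun x => condMean κ (adjusted y η) x +
    condMean κ (onCovs η) x = condMean κ y x) fun x hx _ => (he x hx).2.symm
  -- The conditional mean of η(Z) is continuous at the cutoff, so it adds the same number to both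
  -- limits and leaves the jump unchanged.
  obtain ⟨h, e1, e2⟩ := HasOneSidedLimits.of_tendsto
    ((h1.add (hg.mono_left nhdsWithin_le_nhds)).congr' hev.1)
    ((h2.add (hg.mono_left nhdsWithin_le_nhds)).congr' hev.2)
  refine ⟨h, ?_⟩
  rw [rdJump, e1, e2]
  ring

theorem SmoothMean.contDiffAt (hm : SmoothMean PX C L κ m) {x : ℝ}
    (hx : x ∈ interior PX.support) (h0 : x ≠ 0) : ContDiffAt ℝ 2 (condMean κ m) x :=
  hm.2.1.contDiffAt ((isOpen_interior.sdiff isClosed_singleton).mem_nhds ⟨hx, h0⟩)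

/-- The jump in the curvature of the conditional mean of `Y - θ T` at the cutoff. -/
theorem limits_fuzzyOutcome {ηY ηT : (Fin d → ℝ) → ℝ} {C' L' : ℝ} (hηY : ηY ∈ admissible κ)
    (hηT : ηT ∈ admissible κ) (hY : SmoothMean PX C L κ (adjusted outY ηY))
    (hT : SmoothMean PX C' L' κ (adjusted outT ηT)) (hδ : 0 < δ)
    (hsub : Ioo (-δ) δ ⊆ interior PX.support) :
    HasOneSidedLimits (iteratedDeriv 2 (condMean κ (fuzzyOutcome κ))) ∧
    limPlus (iteratedDeriv 2 (condMean κ (fuzzyOutcome κ))) -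
      limMinus (iteratedDeriv 2 (condMean κ (fuzzyOutcome κ))) =
    limPlus (iteratedDeriv 2 (condMean κ (adjusted outY ηY))) -
      limMinus (iteratedDeriv 2 (condMean κ (adjusted outY ηY))) -
    fuzzyParam κ * (limPlus (iteratedDeriv 2 (condMean κ (adjusted outT ηT))) -
      limMinus (iteratedDeriv 2 (condMean κ (adjusted outT ηT)))) := by
  obtain ⟨ε, hε, hc, hs, he⟩ := condMean_adjusted hηY hY.1 hδ hsub
  obtain ⟨ε', hε', hc', hs', he'⟩ := condMean_adjusted hηT hT.1 hδ hsub
  obtain ⟨-, ⟨h1, h2⟩, -⟩ := hY.expansion hδ hsub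
  obtain ⟨-, ⟨h1', h2'⟩, -⟩ := hT.expansion hδ hsub
  have hg := (contDiffOn_tendsto_zero hε hc).2
  have hg' := (contDiffOn_tendsto_zero hε' hc').2
  have s1 : Ioo (-min ε ε') (min ε ε') ⊆ Ioo (-ε) ε := Ioo_subset_Ioo
    (neg_le_neg (min_le_left _ _)) (min_le_left _ _)
  have s2 : Ioo (-min ε ε') (min ε ε') ⊆ Ioo (-ε') ε' := Ioo_subset_Ioo
    (neg_le_neg (min_le_right _ _)) (min_le_right _ _)
  have heq : ∀ x ∈ Ioo (-min ε ε') (min ε ε'), condMean κ (fuzzyOutcome κ) x =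
      (condMean κ (adjusted outY ηY) x + condMean κ (onCovs ηY) x) -
      fuzzyParam κ * (condMean κ (adjusted outT ηT) x + condMean κ (onCovs ηT) x) := fun x hx => by
    rw [← (he x (s1 hx)).2, ← (he' x (s2 hx)).2]
    unfold condMean fuzzyOutcome
    rw [integral_sub (he x (s1 hx)).1 ((he' x (s2 hx)).1.const_mul _), integral_const_mul]
  -- Off the cutoff all four conditional means are C², so second derivatives may be combined
  -- linearly. The adjustment terms have a second derivative continuous at 0 and cancel from the
  -- jump in curvature.
  have hev := eventually_nhdsWithin_of_Ioo (lt_min hε hε') (p := fun x =>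
    (iteratedDeriv 2 (condMean κ (adjusted outY ηY)) x +
      iteratedDeriv 2 (condMean κ (onCovs ηY)) x) -
    fuzzyParam κ * (iteratedDeriv 2 (condMean κ (adjusted outT ηT)) x +
      iteratedDeriv 2 (condMean κ (onCovs ηT)) x) =
    iteratedDeriv 2 (condMean κ (fuzzyOutcome κ)) x) fun x hx h0 => by
    have c1 := hY.contDiffAt (hs (s1 hx)) h0
    have c2 : ContDiffAt ℝ 2 (condMean κ (onCovs ηY)) x :=
      hc.contDiffAt (isOpen_Ioo.mem_nhds (s1 hx))
    have c3 := hT.contDiffAt (hs (s1 hx)) h0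
    have c4 : ContDiffAt ℝ 2 (condMean κ (onCovs ηT)) x :=
      hc'.contDiffAt (isOpen_Ioo.mem_nhds (s2 hx))
    have hee : condMean κ (fuzzyOutcome κ) =ᶠ[𝓝 x]
        ((condMean κ (adjusted outY ηY) + condMean κ (onCovs ηY)) -
        fun x => fuzzyParam κ * (condMean κ (adjusted outT ηT) + condMean κ (onCovs ηT)) x) := by
      filter_upwards [isOpen_Ioo.mem_nhds hx] with z hz
      exact heq z hz
    have c34 : ContDiffAt ℝ 2 (fun x => fuzzyParam κ *
        (condMean κ (adjusted outT ηT) + condMean κ (onCovs ηT)) x) x :=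
      contDiffAt_const.mul (c3.add c4)
    have c12 : ContDiffAt ℝ 2 (condMean κ (adjusted outY ηY) + condMean κ (onCovs ηY)) x :=
      c1.add c2
    rw [hee.iteratedDeriv_eq, iteratedDeriv_sub c12 c34, iteratedDeriv_add c1 c2,
      iteratedDeriv_const_mul_field, iteratedDeriv_add c3 c4]
  have l := fun {l : Filter ℝ} (hl : l ≤ 𝓝 0) => hg.mono_left hl
  have l' := fun {l : Filter ℝ} (hl : l ≤ 𝓝 0) => hg'.mono_left hl
  obtain ⟨h, e1, e2⟩ := HasOneSidedLimits.of_tendsto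
    (((h1.add (l nhdsWithin_le_nhds)).sub ((h1'.add (l' nhdsWithin_le_nhds)).const_mul _)).congr'
      hev.1)
    (((h2.add (l nhdsWithin_le_nhds)).sub ((h2'.add (l' nhdsWithin_le_nhds)).const_mul _)).congr'
      hev.2)
  refine ⟨h, ?_⟩
  rw [e1, e2]
  ring

/-- The one-sided limits of the conditional variance. -/
theorem RegularVariance.limits (hm : RegularVariance PX C L κ m) (hδ : 0 < δ)
    (hsub : Ioo (-δ) δ ⊆ interior PX.support) :
    HasOneSidedLimits (condVar κ m) ∧ 1 / C ≤ limPlus (condVar κ m) ∧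
    1 / C ≤ limMinus (condVar κ m) ∧
    (∀ x ∈ Ioo 0 δ, |condVar κ m x - limPlus (condVar κ m)| ≤ |L| * |x|) ∧
    ∀ x ∈ Ioo (-δ) 0, |condVar κ m x - limMinus (condVar κ m)| ≤ |L| * |x| := by
  have hmem : ∀ x ∈ Ioo (-δ) δ, x ≠ 0 → x ∈ PX.support \ {0} := fun x hx h0 =>
    ⟨interior_subset (hsub hx), h0⟩
  have hlip : ∀ x ∈ Ioo (-δ) δ, ∀ y ∈ Ioo (-δ) δ, 0 < x * y →
      |condVar κ m x - condVar κ m y| ≤ |L| * |x - y| := fun x hx y hy hxy =>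
    (hm.1 x (hmem x hx (left_ne_zero_of_mul hxy.ne')) y
      (hmem y hy (right_ne_zero_of_mul hxy.ne')) hxy).trans
      (mul_le_mul_of_nonneg_right (le_abs_self L) (abs_nonneg _))
  have s1 := Ioo_pos_subset_right hδ
  have s2 := Ioo_neg_subset_left hδ
  have hneg : ∀ x ∈ Ioo 0 δ, -x ∈ Ioo (-δ) 0 := fun x hx => ⟨by linarith [hx.2], by linarith [hx.1]⟩
  obtain ⟨a, ha, hexp⟩ := exists_right_limit_of_pow_lipschitz hδ (abs_nonneg L) 0
    (g := condVar κ m) fun x hx y hy hyx => by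
      have := hlip x (s1 hx) y (s1 hy) (mul_pos hx.1 hy.1)
      rwa [abs_of_pos (sub_pos.2 hyx), ← mul_one |L|, ← pow_zero x] at this
  -- The left limit is obtained by reflection; the exponent 0 encodes a plain Lipschitz bound.
  obtain ⟨a', ha', hexp'⟩ := exists_right_limit_of_pow_lipschitz hδ (abs_nonneg L) 0
    (g := fun x => condVar κ m (-x)) fun x hx y hy hyx => by
      have := hlip (-x) (s2 (hneg x hx)) (-y) (s2 (hneg y hy)) (by
        rw [neg_mul_neg]; exact mul_pos hx.1 hy.1)
      rwa [show -x - -y = -(x - y) by ring, abs_neg, abs_of_pos (sub_pos.2 hyx), ← mul_one |L|,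
        ← pow_zero x] at this
  have ht : Tendsto (fun x : ℝ => -x) (𝓝[<] 0) (𝓝[>] 0) := by
    simpa using tendsto_neg_nhdsLT (a := (0 : ℝ))
  have ha'' : Tendsto (condVar κ m) (𝓝[<] 0) (𝓝 a') := by
    have := ha'.comp ht
    simpa [Function.comp_def] using this
  obtain ⟨h1, e1, e2⟩ := HasOneSidedLimits.of_tendsto ha ha''
  have hb := eventually_nhdsWithin_of_Ioo hδ (p := fun x => 1 / C ≤ condVar κ m x)
    fun x hx h0 => hm.2 x (hmem x hx h0)
  rw [e1, e2]
  refine ⟨h1, ge_of_tendsto ha hb.1, ge_of_tendsto ha'' hb.2, fun x hx => ?_, fun x hx => ?_⟩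
  · simpa [abs_of_pos hx.1] using hexp x hx
  · simpa [abs_of_neg hx.2] using hexp' (-x) ⟨by linarith [hx.2], by linarith [hx.1]⟩

end OneSidedLimits

/-! ### Expansion of the sharp estimator -/

section SharpExpansion

theorem rpow_le_one_add_rpow {t r q : ℝ} (ht : 0 ≤ t) (hr : 0 ≤ r) (hrq : r ≤ q) :
    t ^ r ≤ 1 + t ^ q := by
  rcases le_total t 1 with h | h
  · have := Real.rpow_le_one ht h hr
    have := Real.rpow_nonneg ht q
    linarith
  · have := Real.rpow_le_rpow_of_exponent_le h hrq
    linarith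

/-- Since t^r ≤ 1 + t^q, a moment bound of order q controls all lower orders at the cost of adding
1. It is needed for r = 2 and for an exponent common to both outcomes. -/
theorem BoundedMoment.residual_rpow {d : ℕ} {PX : Measure ℝ} {κ : Kernel ℝ (Obs d)}
    [IsMarkovKernel κ] {m : Obs d → ℝ} {C q r : ℝ} (hm : BoundedMoment PX C q κ m)
    (hmm : Measurable m) (hr : 0 ≤ r) (hrq : r ≤ q) {x : ℝ} (hx : x ∈ PX.support) :
    Integrable (fun w => |residual κ m (x, w)| ^ r) (κ x) ∧
      ∫ w, |residual κ m (x, w)| ^ r ∂(κ x) ≤ 1 + C := by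
  obtain ⟨h1, h2⟩ := hm x hx
  have i2 : Integrable (fun w => 1 + |m w - condMean κ m x| ^ q) (κ x) :=
    (integrable_const 1).add h1
  have hle : ∀ w, |residual κ m (x, w)| ^ r ≤ 1 + |m w - condMean κ m x| ^ q := fun w =>
    rpow_le_one_add_rpow (abs_nonneg _) hr hrq
  have hmeas : Measurable fun w => |residual κ m (x, w)| ^ r :=
    ((measurable_residual hmm).comp measurable_prodMk_left).abs.pow_const r
  have i1 : Integrable (fun w => |residual κ m (x, w)| ^ r) (κ x) := by
    refine i2.mono' hmeas.aestronglyMeasurable (Eventually.of_forall fun w => ?_)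
    rw [Real.norm_of_nonneg (Real.rpow_nonneg (abs_nonneg _) _)]
    exact hle w
  refine ⟨i1, (integral_mono i1 i2 hle).trans ?_⟩
  rw [integral_add (integrable_const 1) h1]
  simpa [condMean] using h2

theorem BoundedMoment.residual_sq {d : ℕ} {PX : Measure ℝ} {κ : Kernel ℝ (Obs d)}
    [IsMarkovKernel κ] {m : Obs d → ℝ} {C q : ℝ} (hm : BoundedMoment PX C q κ m)
    (hmm : Measurable m) (hq : 2 ≤ q) {x : ℝ} (hx : x ∈ PX.support) :
    Integrable (fun w => residual κ m (x, w) ^ 2) (κ x) ∧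
      ∫ w, residual κ m (x, w) ^ 2 ∂(κ x) ≤ 1 + C := by
  have := hm.residual_rpow hmm zero_le_two hq hx
  simpa only [Real.rpow_two, sq_abs] using this

theorem FirstStageAssumption.admissible {S : ℕ} {d : ℕ → ℕ} {PX : Measure ℝ} {h : ℕ → ℝ}
    {κ : ∀ n, Kernel ℝ (Obs (d n))} {ρ : ∀ n, Measure (Fin n → Fin S)}
    {est : ∀ n, FirstStage (d n) n} {ηbar : ∀ n, (Fin (d n) → ℝ) → ℝ}
    (hfirst : FirstStageAssumption PX h κ ρ est ηbar) (n : ℕ) : ηbar n ∈ admissible (κ n) := by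
  obtain ⟨𝒯, r, v, hadm, hbar, -⟩ := hfirst
  exact hadm n (hbar n)

variable {S : ℕ} {d : ℕ → ℕ} {PX : Measure ℝ} [IsProbabilityMeasure PX] {fX K : ℝ → ℝ} {h : ℕ → ℝ}
  {κ : ∀ n, Kernel ℝ (Obs (d n))} [∀ n, IsMarkovKernel (κ n)]
  {ρ : ∀ n, Measure (Fin n → Fin S)} [∀ n, IsProbabilityMeasure (ρ n)]
  {est : ∀ n, FirstStage (d n) n} {ηbar : ∀ n, (Fin (d n) → ℝ) → ℝ}

/-- The difference of the linear parts on the two sides of the cutoff. -/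
def rdLinear {d n S : ℕ} (K : ℝ → ℝ) (f₀ h : ℝ) (κ : Kernel ℝ (Obs d)) (m : Obs d → ℝ)
    (p : (Fin n → Fin S) × (Fin n → Datum d)) : ℝ :=
  linearPart (kPlus K) f₀ h κ m p - linearPart (kMinus K) f₀ h κ m p

/-- The jump of the second derivative of the conditional mean at the cutoff. -/
def curvJump {d : ℕ} (κ : Kernel ℝ (Obs d)) (m : Obs d → ℝ) : ℝ :=
  limPlus (iteratedDeriv 2 (condMean κ m)) - limMinus (iteratedDeriv 2 (condMean κ m))

/-- Expansion of the cross-fitted sharp estimator. -/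
theorem DesignAssumption.sharp_expansion (hd : DesignAssumption PX fX K h)
    {y : ∀ n, Obs (d n) → ℝ} (hy : ∀ n, Measurable (y n))
    (hest : ∀ n (A : Finset (Fin n)), Measurable
      fun p : (A → Datum (d n)) × (Fin (d n) → ℝ) => est n A p.1 p.2)
    (hfirst : FirstStageAssumption PX h κ ρ est ηbar)
    (hout : OutcomeAssumption PX κ fun n => adjusted (y n) (ηbar n)) :
    LittleOP (fun n => sampleLaw (ρ n) PX (κ n))
      (fun n p => sharpEst K (h n) (y n) (est n) p.1 p.2 - (rdJump (κ n) (y n) +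
        nuBar K * (curvJump (κ n) (adjusted (y n) (ηbar n)) / 2) * h n ^ 2 +
        rdLinear K (fX 0) (h n) (κ n) (adjusted (y n) (ηbar n)) p)) (totRate h) := by
  obtain ⟨C, L, q, hC, hq, ho⟩ := hout
  obtain ⟨δ, hδ, F, -, -, -, hsub⟩ := hd.exists_local
  have hηm : ∀ n, Measurable (ηbar n) := fun n => (hfirst.admissible n).1
  have hmm : ∀ n, Measurable (adjusted (y n) (ηbar n)) := fun n =>
    (hy n).sub ((hηm n).comp measurable_covs)
  have hE := fun n => (ho n).1.expansion hδ hsub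
  choose bp hbp using fun n => (hE n).2.2.2.2.1
  choose bm hbm using fun n => (hE n).2.2.2.2.2
  have hvar := fun n x hx => (ho n).2.1.residual_sq (hmm n) hq.le (x := x) hx
  have hP := hd.side_expansion (ρ := ρ) hd.sideKernel_kPlus hmm (fun n => (ho n).1.1) hvar
    (fun n => (hE n).2.2.1) (abs_nonneg L)
    (a := fun n => limPlus (condMean (κ n) (adjusted (y n) (ηbar n)))) (b := bp) (by
      filter_upwards [hd.eventually_lt hδ] with n hn x h0 hx
      have hh := hd.bandwidth_pos n
      refine hbp n x ⟨lt_of_le_of_ne ?_ h0.symm, ?_⟩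
      · by_contra hc
        refine hx (if_neg ?_)
        rw [not_le] at hc ⊢
        exact div_neg_of_neg_of_pos hc hh
      · by_contra hc
        obtain ⟨b, hb⟩ := hd.sideKernel_kPlus.windowed
        refine hx (hb.zero _ ?_)
        rw [div_mem_Icc_iff hh]
        exact fun hm => by linarith [hm.2, not_lt.1 hc])
  have hM := hd.side_expansion (ρ := ρ) hd.sideKernel_kMinus hmm (fun n => (ho n).1.1) hvar
    (fun n => (hE n).2.2.2.1) (abs_nonneg L)
    (a := fun n => limMinus (condMean (κ n) (adjusted (y n) (ηbar n)))) (b := bm) (by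
      filter_upwards [hd.eventually_lt hδ] with n hn x h0 hx
      have hh := hd.bandwidth_pos n
      refine hbm n x ⟨?_, lt_of_le_of_ne ?_ h0⟩
      · by_contra hc
        obtain ⟨b, hb⟩ := hd.sideKernel_kMinus.windowed
        refine hx (hb.zero _ ?_)
        rw [div_mem_Icc_iff hh]
        exact fun hm => by linarith [hm.1, not_lt.1 hc]
      · by_contra hc
        refine hx (if_neg ?_)
        rw [not_lt]
        exact div_nonneg (not_le.1 hc).le hh.le)
  have gP := hd.side_firstStage hd.sideKernel_kPlus hest hfirst
  have gM := hd.side_firstStage hd.sideKernel_kMinus hest hfirst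
  -- The fold-weighted conditional means at the cutoff are the same in `gP` and `gM`, so the first
  -- stage disappears from the difference.
  refine ((hP.sub hM).sub (gP.sub gM)).of_whp_eq
    (.of_eventually (Eventually.of_forall fun n p => ?_))
  have hh := hd.bandwidth_pos n
  -- The left moments differ from the right ones by (-1)^j, and every product here has even total
  -- degree, so both sides share the bias constant.
  have hν : (sideMoment (kMinus K) 2 ^ 2 - sideMoment (kMinus K) 1 * sideMoment (kMinus K) 3) /
      sideDet (kMinus K) = nuBar K := by
    rw [sideDet_kMinus hd.kernel_symm, nuBar]
    simp only [sideMoment_kMinus hd.kernel_symm]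
    congr 1
    ring
  have hν' : (sideMoment (kPlus K) 2 ^ 2 - sideMoment (kPlus K) 1 * sideMoment (kPlus K) 3) /
      sideDet (kPlus K) = nuBar K := by
    rw [sideDet_kPlus, nuBar]
    simp only [sideMoment_kPlus]
  have hadj : ∀ i, adjusted (y n) (crossFit (est n) p.1 (p.1 i) p.2) (p.2 i).2 =
      adjusted (y n) (ηbar n) (p.2 i).2 -
        onCovs (fitGap (est n) (ηbar n) (p.1 i) p) (p.2 i).2 := fun i => by
    simp only [adjusted, onCovs, fitGap, Pi.sub_apply]
    ring
  have hj := (limits_adjusted (hfirst.admissible n) (ho n).1 hδ hsub).2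
  have hsum : sharpEst K (h n) (y n) (est n) p.1 p.2 =
      (∑ i, sideWeight (fun v => kPlus K (v / h n) / h n) (fun j => (p.2 j).1) i *
          adjusted (y n) (ηbar n) (p.2 i).2 -
        ∑ i, sideWeight (fun v => kMinus K (v / h n) / h n) (fun j => (p.2 j).1) i *
          adjusted (y n) (ηbar n) (p.2 i).2) -
      (∑ i, sideWeight (fun v => kPlus K (v / h n) / h n) (fun j => (p.2 j).1) i *
          onCovs (fitGap (est n) (ηbar n) (p.1 i) p) (p.2 i).2 -
        ∑ i, sideWeight (fun v => kMinus K (v / h n) / h n) (fun j => (p.2 j).1) i *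
          onCovs (fitGap (est n) (ηbar n) (p.1 i) p) (p.2 i).2) := by
    simp only [sharpEst, rdWeight, hadj, kernPlus_eq hh, kernMinus_eq hh, ← Finset.sum_sub_distrib]
    refine Finset.sum_congr rfl fun i _ => ?_
    ring
  rw [hsum, hj, hν, hν', rdLinear, curvJump]
  ring

theorem DesignAssumption.bigOP_linearPart (hd : DesignAssumption PX fX K h) {k : ℝ → ℝ}
    (hk : SideKernel k) {m : ∀ n, Obs (d n) → ℝ} (hm : ∀ n, Measurable (m n))
    (hout : OutcomeAssumption PX κ m) :
    BigOP (fun n => sampleLaw (ρ n) PX (κ n))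
      (fun n p => linearPart k (fX 0) (h n) (κ n) (m n) p) (sdRate h) := by
  obtain ⟨C, L, q, hC, hq, ho⟩ := hout
  obtain ⟨b, hb⟩ := hk.windowed
  have E := fun j => hd.bigOP_residual (ρ := ρ) hb hm (fun n => (ho n).1.1)
    (fun n x hx => (ho n).2.1.residual_sq (hm n) hq.le (x := x) hx) j
  have c := fun (c : ℝ) => BigOP.const (μ := fun n => sampleLaw (ρ n) PX (κ n)) (c := fun _ => c)
    (fun _ => le_rfl)
  have := ((c (sideMoment k 2 / (fX 0 * sideDet k))).mul (E 0)).sub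
    ((c (sideMoment k 1 / (fX 0 * sideDet k))).mul (E 1))
  simp only [one_mul] at this
  simpa only [linearPart_eq] using this

theorem DesignAssumption.bigOP_rdLinear (hd : DesignAssumption PX fX K h)
    {m : ∀ n, Obs (d n) → ℝ} (hm : ∀ n, Measurable (m n))
    (hout : OutcomeAssumption PX κ m) :
    BigOP (fun n => sampleLaw (ρ n) PX (κ n))
      (fun n p => rdLinear K (fX 0) (h n) (κ n) (m n) p) (sdRate h) :=
  (hd.bigOP_linearPart hd.sideKernel_kPlus hm hout).sub
    (hd.bigOP_linearPart hd.sideKernel_kMinus hm hout)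

end SharpExpansion

/-! ### Linearization of the ratio estimator -/

section FuzzyExpansion

variable {S : ℕ} {d : ℕ → ℕ} {PX : Measure ℝ} [IsProbabilityMeasure PX] {fX K : ℝ → ℝ} {h : ℕ → ℝ}
  {κ : ∀ n, Kernel ℝ (Obs (d n))} [∀ n, IsMarkovKernel (κ n)]
  {ρ : ∀ n, Measure (Fin n → Fin S)} [∀ n, IsProbabilityMeasure (ρ n)]
  {est estY estT : ∀ n, FirstStage (d n) n} {ηbar ηY ηT : ∀ n, (Fin (d n) → ℝ) → ℝ}

theorem measurable_adjusted {d : ℕ} {y : Obs d → ℝ} {η : (Fin d → ℝ) → ℝ} (hy : Measurable y)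
    (hη : Measurable η) : Measurable (adjusted y η) :=
  hy.sub (hη.comp measurable_covs)

/-- The curvature is bounded uniformly in n, so the bias is O(h²), and the linear part is
O_P((nh)^{-1/2}). This crude rate makes the denominator of the ratio consistent and controls the
quadratic error of the linearization. -/
theorem DesignAssumption.sharp_bigOP (hd : DesignAssumption PX fX K h)
    {y : ∀ n, Obs (d n) → ℝ} (hy : ∀ n, Measurable (y n))
    (hest : ∀ n (A : Finset (Fin n)), Measurable
      fun p : (A → Datum (d n)) × (Fin (d n) → ℝ) => est n A p.1 p.2)
    (hfirst : FirstStageAssumption PX h κ ρ est ηbar)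
    (hout : OutcomeAssumption PX κ fun n => adjusted (y n) (ηbar n)) :
    BigOP (fun n => sampleLaw (ρ n) PX (κ n))
      (fun n p => sharpEst K (h n) (y n) (est n) p.1 p.2 - rdJump (κ n) (y n)) (totRate h) := by
  have h1 := hd.sharp_expansion hy hest hfirst hout
  have h2 := (hd.bigOP_rdLinear (ρ := ρ) (fun n => measurable_adjusted (hy n)
    (hfirst.admissible n).1) hout).mono_rate (b := totRate h) fun n => by
      rw [totRate]; linarith [sq_nonneg (h n)]
  obtain ⟨C, L, q, hC, hq, ho⟩ := hout
  obtain ⟨δ, hδ, F, -, -, -, hsub⟩ := hd.exists_local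
  have h3 : BigOP (fun n => sampleLaw (ρ n) PX (κ n)) (fun n _ => nuBar K *
      (curvJump (κ n) (adjusted (y n) (ηbar n)) / 2) * h n ^ 2) (totRate h) := by
    refine BigOP.of_bounded (C := |nuBar K| * C + 1) (by positivity)
      (.of_eventually (Eventually.of_forall fun n p => ?_))
    obtain ⟨-, -, e1, e2, -⟩ := (ho n).1.expansion hδ hsub
    have e3 := abs_sub (limPlus (iteratedDeriv 2 (condMean (κ n) (adjusted (y n) (ηbar n)))))
      (limMinus (iteratedDeriv 2 (condMean (κ n) (adjusted (y n) (ηbar n)))))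
    rw [abs_mul, abs_mul, abs_of_nonneg (sq_nonneg (h n)), totRate]
    have e4 : |curvJump (κ n) (adjusted (y n) (ηbar n)) / 2| ≤ C := by
      rw [abs_div, abs_two, curvJump]; linarith
    have := sdRate_nonneg h n
    have e5 := mul_le_mul_of_nonneg_left e4 (abs_nonneg (nuBar K))
    have e6 := mul_le_mul_of_nonneg_right e5 (sq_nonneg (h n))
    have e7 : 0 ≤ |nuBar K| * C := by positivity
    nlinarith [sq_nonneg (h n), mul_nonneg e7 this]
  refine ((h1.bigOP.add h3).add h2).of_whp_le
    (.of_eventually (Eventually.of_forall fun n p => le_of_eq ?_))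
  congr 1
  ring

/-- Expansion of the cross-fitted fuzzy estimator. -/
theorem DesignAssumption.fuzzy_expansion (hd : DesignAssumption PX fX K h)
    (hestY : ∀ n (A : Finset (Fin n)), Measurable
      fun p : (A → Datum (d n)) × (Fin (d n) → ℝ) => estY n A p.1 p.2)
    (hestT : ∀ n (A : Finset (Fin n)), Measurable
      fun p : (A → Datum (d n)) × (Fin (d n) → ℝ) => estT n A p.1 p.2)
    (hfirstY : FirstStageAssumption PX h κ ρ estY ηY)
    (hfirstT : FirstStageAssumption PX h κ ρ estT ηT)
    (houtY : OutcomeAssumption PX κ fun n => adjusted outY (ηY n))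
    (houtT : OutcomeAssumption PX κ fun n => adjusted outT (ηT n))
    {c C : ℝ} (hc : 0 < c) (hjump : ∀ n, c ≤ |rdJump (κ n) outT| ∧ |fuzzyParam (κ n)| ≤ C) :
    LittleOP (fun n => sampleLaw (ρ n) PX (κ n))
      (fun n p => fuzzyEst K (h n) (estY n) (estT n) p.1 p.2 - fuzzyParam (κ n) -
        (biasLead K (κ n) * h n ^ 2 +
          (rdLinear K (fX 0) (h n) (κ n) (adjusted outY (ηY n)) p -
            fuzzyParam (κ n) * rdLinear K (fX 0) (h n) (κ n) (adjusted outT (ηT n)) p) /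
          rdJump (κ n) outT)) (totRate h) := by
  have mY : ∀ n, Measurable (outY : Obs (d n) → ℝ) := fun n => measurable_fst
  have mT : ∀ n, Measurable (outT : Obs (d n) → ℝ) := fun n => measurable_fst.comp measurable_snd
  have eY := hd.sharp_expansion mY hestY hfirstY houtY
  have eT := hd.sharp_expansion mT hestT hfirstT houtT
  have bY := hd.sharp_bigOP mY hestY hfirstY houtY
  have bT := hd.sharp_bigOP mT hestT hfirstT houtT
  have oT := bT.littleOP_one hd.tendsto_totRate
  have hinv := oT.inv_sub hc fun n => (hjump n).1
  have hne := oT.whp_ne_zero hc fun n => (hjump n).1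
  have hτ : ∀ n, |(rdJump (κ n) outT)⁻¹| ≤ c⁻¹ := fun n => by
    rw [abs_inv]; exact inv_anti₀ hc (hjump n).1
  have hN := bY.sub (by
    have := (BigOP.const (μ := fun n => sampleLaw (ρ n) PX (κ n)) fun n => (hjump n).2).mul bT
    simp only [one_mul] at this
    exact this)
  -- The error of the ratio is N/τ̂_T with N = (τ̂_Y - τ_Y) - θ(τ̂_T - τ_T), by τ_Y = θ τ_T. Here t1
  -- is the cost of replacing 1/τ̂_T by 1/τ_T, and t2 is the remainder of the expansion of N,
  -- divided by τ_T.
  have t1 := hinv.mul_bigOP hN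
  simp only [one_mul] at t1
  have t2 := (eY.sub (eT.const_mul fun n => (hjump n).2)).const_mul hτ
  refine (t1.add t2).of_whp_eq (hne.mono fun n p hp => ?_)
  obtain ⟨δ, hδ, F, -, -, -, hsub⟩ := hd.exists_local
  obtain ⟨_, _, _, -, -, hoY⟩ := houtY
  obtain ⟨_, _, _, -, -, hoT⟩ := houtT
  have hlead := (limits_fuzzyOutcome (hfirstY.admissible n) (hfirstT.admissible n) (hoY n).1
    (hoT n).1 hδ hsub).2
  have hτ0 : rdJump (κ n) outT ≠ 0 := fun h0 => by
    have := (hjump n).1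
    rw [h0, abs_zero] at this
    linarith
  have hθ : rdJump (κ n) outY = fuzzyParam (κ n) * rdJump (κ n) outT := by
    rw [fuzzyParam, div_mul_cancel₀ _ hτ0]
  rw [biasLead, hlead, fuzzyEst, hθ]
  simp only [curvJump]
  field_simp
  ring

end FuzzyExpansion

/-! ### Limits of the local variance and of the Lyapunov ratio -/

section CentralLimit

/-- The difference of the equivalent kernels on the two sides of the cutoff. -/
def rdKernel (K : ℝ → ℝ) (v : ℝ) : ℝ := equivKernel (kPlus K) v - equivKernel (kMinus K) v

theorem equivKernel_kPlus_of_neg (K : ℝ → ℝ) {v : ℝ} (hv : v < 0) :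
    equivKernel (kPlus K) v = 0 := by
  simp [equivKernel, kPlus, not_le.2 hv]

theorem equivKernel_kMinus_of_nonneg (K : ℝ → ℝ) {v : ℝ} (hv : 0 ≤ v) :
    equivKernel (kMinus K) v = 0 := by
  simp [equivKernel, kMinus, not_lt.2 hv]

variable {PX : Measure ℝ} {fX K : ℝ → ℝ} {h : ℕ → ℝ}

theorem DesignAssumption.rdKernel_windowed (hd : DesignAssumption PX fX K h) :
    ∃ b, Windowed (rdKernel K) b := by
  obtain ⟨b, hb⟩ := hd.sideKernel_kPlus.equivKernel_windowed
  obtain ⟨b', hb'⟩ := hd.sideKernel_kMinus.equivKernel_windowed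
  exact ⟨b + b', hb.measurable.sub hb'.measurable, fun v => (abs_sub _ _).trans
    (add_le_add (hb.bound v) (hb'.bound v)), fun v hv => by
      rw [rdKernel, hb.zero v hv, hb'.zero v hv, sub_zero]⟩

/-- The local variance functional converges to the average of the one-sided limits. -/
theorem DesignAssumption.tendsto_integral_rdKernel_sq [IsProbabilityMeasure PX]
    (hd : DesignAssumption PX fX K h)
    {v : ℕ → ℝ → ℝ} {sp sm : ℕ → ℝ} {v₀ L δ : ℝ} (hv₀ : 0 < v₀) (hδ : 0 < δ)
    (hsp : ∀ n, v₀ ≤ sp n) (hsm : ∀ n, v₀ ≤ sm n)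
    (hvp : ∀ n, ∀ x ∈ Ioo 0 δ, |v n x - sp n| ≤ L * |x|)
    (hvm : ∀ n, ∀ x ∈ Ioo (-δ) 0, |v n x - sm n| ≤ L * |x|)
    (hint : ∀ n, Integrable (fun x => rdKernel K (x / h n) ^ 2 / h n * v n x) PX) :
    Tendsto (fun n => (∫ x, rdKernel K (x / h n) ^ 2 / h n * v n x ∂PX) /
      (fX 0 * kappaBar K * (sp n + sm n))) atTop (𝓝 1) := by
  have hf := hd.density_pos
  have hk := hd.kappaBar_pos
  have hL : 0 ≤ L := by
    have := (abs_nonneg _).trans (hvp 0 (δ / 2) ⟨by positivity, by linarith⟩)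
    rw [abs_of_pos (by positivity)] at this
    exact nonneg_of_mul_nonneg_left this (by positivity)
  obtain ⟨b, hb⟩ := hd.sideKernel_kPlus.equivKernel_windowed
  obtain ⟨b', hb'⟩ := hd.sideKernel_kMinus.equivKernel_windowed
  set ep := equivKernel (kPlus K) with hep
  set em := equivKernel (kMinus K) with hem
  let Ip : ℕ → ℝ := fun n => ∫ x, ep (x / h n) ^ 2 / h n ∂PX
  let Im : ℕ → ℝ := fun n => ∫ x, em (x / h n) ^ 2 / h n ∂PX
  have hIp : Tendsto Ip atTop (𝓝 (fX 0 * kappaBar K)) := by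
    have := hd.tendsto_integral_window hb.sq
    rwa [integral_equivKernel_kPlus_sq] at this
  have hIm : Tendsto Im atTop (𝓝 (fX 0 * kappaBar K)) := by
    have := hd.tendsto_integral_window hb'.sq
    rwa [integral_equivKernel_kMinus_sq hd.kernel_symm] at this
  -- The one-sided variances depend on n and need not converge, so the ratio is compared with 1. The
  -- first term bounds the relative error of the kernel integrals, the second the Lipschitz
  -- variation over the window. Dividing by sp + sm, bounded below by v₀, removes any need for upper
  -- bounds on the variances.
  have hlim : Tendsto (fun n => (|Ip n - fX 0 * kappaBar K| + |Im n - fX 0 * kappaBar K|) /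
      (fX 0 * kappaBar K) + L * h n * (Ip n + Im n) / (fX 0 * kappaBar K * v₀)) atTop (𝓝 0) := by
    have h1 := ((hIp.sub_const (fX 0 * kappaBar K)).abs.add
      (hIm.sub_const (fX 0 * kappaBar K)).abs).div_const (fX 0 * kappaBar K)
    have h2 := ((hd.bandwidth_zero.const_mul L).mul (hIp.add hIm)).div_const
      (fX 0 * kappaBar K * v₀)
    simpa using h1.add h2
  rw [tendsto_iff_norm_sub_tendsto_zero]
  refine tendsto_of_tendsto_of_tendsto_of_le_of_le' tendsto_const_nhds hlim
    (Eventually.of_forall fun _ => norm_nonneg _) ?_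
  filter_upwards [hd.eventually_lt hδ] with n hn
  have hh := hd.bandwidth_pos n
  have hs : v₀ ≤ sp n + sm n := by linarith [hsp n, hsm n]
  have hden : 0 < fX 0 * kappaBar K * (sp n + sm n) := by
    have := hv₀.trans_le hs
    positivity
  have ip : Integrable (fun x => ep (x / h n) ^ 2 / h n) PX :=
    (hb.sq.integrable_comp_div (h n)).div_const _
  have im : Integrable (fun x => em (x / h n) ^ 2 / h n) PX :=
    (hb'.sq.integrable_comp_div (h n)).div_const _
  have icomb : Integrable (fun x => sp n * (ep (x / h n) ^ 2 / h n) +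
      sm n * (em (x / h n) ^ 2 / h n)) PX := (ip.const_mul _).add (im.const_mul _)
  have ibd : Integrable (fun x => L * h n * (ep (x / h n) ^ 2 / h n + em (x / h n) ^ 2 / h n)) PX :=
    (ip.add im).const_mul _
  have hmain : |(∫ x, rdKernel K (x / h n) ^ 2 / h n * v n x ∂PX) -
      (sp n * Ip n + sm n * Im n)| ≤ L * h n * (Ip n + Im n) := by
    have e1 : sp n * Ip n + sm n * Im n = ∫ x, (sp n * (ep (x / h n) ^ 2 / h n) +
        sm n * (em (x / h n) ^ 2 / h n)) ∂PX := by
      rw [integral_add (ip.const_mul _) (im.const_mul _), integral_const_mul, integral_const_mul]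
    have e2 : L * h n * (Ip n + Im n) = ∫ x, L * h n * (ep (x / h n) ^ 2 / h n +
        em (x / h n) ^ 2 / h n) ∂PX := by
      rw [integral_const_mul, integral_add ip im]
    rw [e1, e2, ← integral_sub (hint n) icomb, ← Real.norm_eq_abs]
    refine norm_integral_le_of_norm_le ibd ?_
    have hz : ∀ᵐ x ∂PX, x ≠ 0 := by
      rw [ae_iff]
      simpa using hd.measure_zero
    filter_upwards [hz] with x hx
    rw [Real.norm_eq_abs]
    by_cases hxI : x ∈ Icc (-h n) (h n)
    · rcases lt_or_gt_of_ne hx with hx0 | hx0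
      · have hneg := div_neg_of_neg_of_pos hx0 hh
        have z : ep (x / h n) = 0 := equivKernel_kPlus_of_neg K hneg
        -- The two equivalent kernels live on opposite sides, so the square of their difference has
        -- no cross term.
        have hr : rdKernel K (x / h n) ^ 2 = em (x / h n) ^ 2 := by
          rw [rdKernel, ← hep, ← hem, z]; ring
        have hle := hvm n x ⟨by linarith [hxI.1], hx0⟩
        have hxa : |x| ≤ h n := abs_le.2 hxI
        have hw : 0 ≤ em (x / h n) ^ 2 / h n := by positivity
        rw [hr, z]
        calc _ = (em (x / h n) ^ 2 / h n) * |v n x - sm n| := by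
              rw [← abs_of_nonneg hw, ← abs_mul, abs_of_nonneg hw]; congr 1; ring
          _ ≤ (em (x / h n) ^ 2 / h n) * (L * h n) := by
              refine mul_le_mul_of_nonneg_left (hle.trans ?_) hw
              gcongr
          _ = _ := by ring
      · have hpos := div_pos hx0 hh
        have z : em (x / h n) = 0 := equivKernel_kMinus_of_nonneg K hpos.le
        have hr : rdKernel K (x / h n) ^ 2 = ep (x / h n) ^ 2 := by
          rw [rdKernel, ← hep, ← hem, z]; ring
        have hle := hvp n x ⟨hx0, by linarith [hxI.2]⟩
        have hxa : |x| ≤ h n := abs_le.2 hxI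
        have hw : 0 ≤ ep (x / h n) ^ 2 / h n := by positivity
        rw [hr, z]
        calc _ = (ep (x / h n) ^ 2 / h n) * |v n x - sp n| := by
              rw [← abs_of_nonneg hw, ← abs_mul, abs_of_nonneg hw]; congr 1; ring
          _ ≤ (ep (x / h n) ^ 2 / h n) * (L * h n) := by
              refine mul_le_mul_of_nonneg_left (hle.trans ?_) hw
              gcongr
          _ = _ := by ring
    · have hout : x / h n ∉ Icc (-1 : ℝ) 1 := by rwa [div_mem_Icc_iff hh]
      have z1 := hb.zero _ hout
      have z2 := hb'.zero _ hout
      simp [rdKernel, ← hep, ← hem, z1, z2]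
  have hIpm : 0 ≤ Ip n + Im n := add_nonneg
    (integral_nonneg fun x => by positivity) (integral_nonneg fun x => by positivity)
  rw [Real.norm_eq_abs, div_sub_one hden.ne', abs_div, abs_of_pos hden]
  set J := ∫ x, rdKernel K (x / h n) ^ 2 / h n * v n x ∂PX
  set A := fX 0 * kappaBar K with hA
  have hA0 : 0 < A := by positivity
  have h1 : |J - A * (sp n + sm n)| ≤ (sp n + sm n) * (|Ip n - A| + |Im n - A|) +
      L * h n * (Ip n + Im n) := by
    have e : J - A * (sp n + sm n) = (J - (sp n * Ip n + sm n * Im n)) +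
        (sp n * (Ip n - A) + sm n * (Im n - A)) := by ring
    have a1 := abs_add_le (J - (sp n * Ip n + sm n * Im n))
      (sp n * (Ip n - A) + sm n * (Im n - A))
    have a2 := abs_add_le (sp n * (Ip n - A)) (sm n * (Im n - A))
    have p1 : 0 ≤ sp n := hv₀.le.trans (hsp n)
    have p2 : 0 ≤ sm n := hv₀.le.trans (hsm n)
    rw [abs_mul, abs_mul, abs_of_nonneg p1, abs_of_nonneg p2] at a2
    rw [e]
    have a3 := mul_nonneg p1 (abs_nonneg (Im n - A))
    have a4 := mul_nonneg p2 (abs_nonneg (Ip n - A))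
    nlinarith
  have hs0 := hv₀.trans_le hs
  calc _ ≤ ((sp n + sm n) * (|Ip n - A| + |Im n - A|) + L * h n * (Ip n + Im n)) /
        (A * (sp n + sm n)) := by gcongr
    _ = (|Ip n - A| + |Im n - A|) / A + L * h n * (Ip n + Im n) / (A * (sp n + sm n)) := by
        field_simp
    _ ≤ _ := by
        have := mul_nonneg (mul_nonneg hL hh.le) hIpm
        gcongr

/-- The Lyapunov ratio vanishes. -/
theorem DesignAssumption.tendsto_lyapunov (hd : DesignAssumption PX fX K h) {q : ℝ} (hq : 2 < q) :
    Tendsto (fun n : ℕ => n * h n * (Real.sqrt (n * h n) / (n * h n)) ^ q) atTop (𝓝 0) := by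
  have h1 : Tendsto (fun n : ℕ => Real.sqrt (n * h n) ^ (-(q - 2))) atTop (𝓝 0) :=
    (tendsto_rpow_neg_atTop (by linarith)).comp
      (Real.tendsto_sqrt_atTop.comp hd.bandwidth_rate)
  refine h1.congr' ?_
  filter_upwards [eventually_gt_atTop 0] with n hn
  have hn' : (0 : ℝ) < n := by exact_mod_cast hn
  have hm : 0 < n * h n := mul_pos hn' (hd.bandwidth_pos n)
  have hs : 0 < Real.sqrt (n * h n) := Real.sqrt_pos.2 hm
  have e : Real.sqrt (n * h n) / (n * h n) = (Real.sqrt (n * h n))⁻¹ := by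
    rw [Real.sqrt_div_self', one_div]
  rw [e, Real.inv_rpow hs.le, neg_sub, Real.rpow_sub hs, Real.rpow_two, Real.sq_sqrt hm.le]
  rfl

end CentralLimit

/-! ### Conditional moments of the centred score -/

section Score

/-- The conditionally centred `U(η_Y, η_T)`. -/
def score {d : ℕ} (κ : Kernel ℝ (Obs d)) (ηY ηT : (Fin d → ℝ) → ℝ) (w : Datum d) : ℝ :=
  (residual κ (adjusted outY ηY) w - fuzzyParam κ * residual κ (adjusted outT ηT) w) /
    rdJump κ outT

theorem measurable_outY {d : ℕ} : Measurable (outY : Obs d → ℝ) := measurable_fst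

theorem measurable_outT {d : ℕ} : Measurable (outT : Obs d → ℝ) :=
  measurable_fst.comp measurable_snd

variable {d : ℕ} {PX : Measure ℝ} {κ : Kernel ℝ (Obs d)} {ηY ηT : (Fin d → ℝ) → ℝ}

theorem measurable_score (hY : Measurable ηY) (hT : Measurable ηT) : Measurable (score κ ηY ηT) :=
  ((measurable_residual (measurable_adjusted measurable_outY hY)).sub
    ((measurable_residual (measurable_adjusted measurable_outT hT)).const_mul _)).div_const _

theorem integral_score [IsMarkovKernel κ] {x : ℝ} (iY : Integrable (adjusted outY ηY) (κ x))
    (iT : Integrable (adjusted outT ηT) (κ x)) :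
    ∫ w, score κ ηY ηT (x, w) ∂(κ x) = 0 := by
  have i1 : Integrable (fun w => residual κ (adjusted outY ηY) (x, w)) (κ x) :=
    iY.sub (integrable_const (condMean κ (adjusted outY ηY) x))
  have i2 : Integrable (fun w => residual κ (adjusted outT ηT) (x, w)) (κ x) :=
    iT.sub (integrable_const (condMean κ (adjusted outT ηT) x))
  have e : ∀ y : Obs d → ℝ, Integrable y (κ x) → ∫ w, residual κ y (x, w) ∂(κ x) = 0 :=
    fun y hy => by
      simp only [residual]
      rw [integral_sub hy (integrable_const _), integral_const]
      simp [condMean]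
  simp only [score]
  rw [integral_div, integral_sub i1 (i2.const_mul _), integral_const_mul, e _ iY, e _ iT]
  simp

/-- U is the combination (M_Y - θ M_T)/τ_T of the adjusted outcomes, so subtracting its conditional
mean centres each of them separately and gives the score. -/
theorem integral_score_sq {x : ℝ} (hY : Measurable ηY) (hT : Measurable ηT)
    (iY : Integrable (adjusted outY ηY) (κ x)) (iT : Integrable (adjusted outT ηT) (κ x)) :
    ∫ w, score κ ηY ηT (x, w) ^ 2 ∂(κ x) = condVar κ (fuzzyU κ ηY ηT) x := by
  have e : fuzzyU κ ηY ηT = fun w =>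
      (adjusted outY ηY w - fuzzyParam κ * adjusted outT ηT w) / rdJump κ outT := by
    ext w
    simp only [fuzzyU, adjusted]
    congr 1
    ring
  have hm : Measurable (fuzzyU κ ηY ηT) := by
    rw [e]
    exact ((measurable_adjusted measurable_outY hY).sub
      ((measurable_adjusted measurable_outT hT).const_mul _)).div_const _
  rw [condVar, variance_eq_integral hm.aemeasurable, e]
  simp only [score, residual, condMean]
  rw [integral_div, integral_sub iY (iT.const_mul _), integral_const_mul]
  congr 1
  ext w
  congr 1
  ring

/-- The score is at most a constant times the larger of the two residuals, and the q-th power of a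
maximum is at most the sum of the q-th powers. -/
theorem abs_score_rpow_le {c C q : ℝ} (hc : 0 < c) (hq : 0 ≤ q) (hτ : c ≤ |rdJump κ outT|)
    (hθ : |fuzzyParam κ| ≤ C) (w : Datum d) :
    |score κ ηY ηT w| ^ q ≤ (2 * (1 + C) / c) ^ q * (|residual κ (adjusted outY ηY) w| ^ q +
      |residual κ (adjusted outT ηT) w| ^ q) := by
  set t := |residual κ (adjusted outY ηY) w| with ht
  set u := |residual κ (adjusted outT ηT) w| with hu
  have ht0 : 0 ≤ t := abs_nonneg _
  have hu0 : 0 ≤ u := abs_nonneg _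
  have hC : 0 ≤ C := (abs_nonneg _).trans hθ
  have h1 : |score κ ηY ηT w| ≤ 2 * (1 + C) / c * max t u := by
    rw [score, abs_div, div_mul_eq_mul_div]
    refine div_le_div₀ (by positivity) ((abs_sub _ _).trans ?_) hc hτ
    rw [abs_mul, ← ht, ← hu]
    have a1 := le_max_left t u
    have a2 := le_max_right t u
    have a3 := mul_le_mul hθ a2 hu0 hC
    have a4 : 0 ≤ max t u := ht0.trans a1
    nlinarith [mul_nonneg hC a4]
  have h2 : max t u ^ q ≤ t ^ q + u ^ q := by
    have b1 := Real.rpow_nonneg ht0 q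
    have b2 := Real.rpow_nonneg hu0 q
    rcases max_cases t u with h | h <;> rw [h.1] <;> linarith
  have hk : 0 ≤ 2 * (1 + C) / c := by positivity
  calc _ ≤ (2 * (1 + C) / c * max t u) ^ q := Real.rpow_le_rpow (abs_nonneg _) h1 hq
    _ = (2 * (1 + C) / c) ^ q * max t u ^ q := Real.mul_rpow hk (ht0.trans (le_max_left t u))
    _ ≤ _ := mul_le_mul_of_nonneg_left h2 (Real.rpow_nonneg hk q)

theorem score_moment [IsMarkovKernel κ] {c C q CY qY CT qT : ℝ} (hc : 0 < c) (hq : 0 ≤ q)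
    (hτ : c ≤ |rdJump κ outT|) (hθ : |fuzzyParam κ| ≤ C) (hY : Measurable ηY) (hT : Measurable ηT)
    (mY : BoundedMoment PX CY qY κ (adjusted outY ηY)) (hqY : q ≤ qY)
    (mT : BoundedMoment PX CT qT κ (adjusted outT ηT)) (hqT : q ≤ qT) {x : ℝ}
    (hx : x ∈ PX.support) :
    Integrable (fun w => |score κ ηY ηT (x, w)| ^ q) (κ x) ∧
      ∫ w, |score κ ηY ηT (x, w)| ^ q ∂(κ x) ≤
        (2 * (1 + C) / c) ^ q * ((1 + CY) + (1 + CT)) := by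
  obtain ⟨i1, b1⟩ := mY.residual_rpow (measurable_adjusted measurable_outY hY) hq hqY hx
  obtain ⟨i2, b2⟩ := mT.residual_rpow (measurable_adjusted measurable_outT hT) hq hqT hx
  have i3 : Integrable (fun w => (2 * (1 + C) / c) ^ q *
      (|residual κ (adjusted outY ηY) (x, w)| ^ q + |residual κ (adjusted outT ηT) (x, w)| ^ q))
      (κ x) := (i1.add i2).const_mul _
  have hle := fun w => abs_score_rpow_le (ηY := ηY) (ηT := ηT) hc hq hτ hθ (x, w)
  have i4 : Integrable (fun w => |score κ ηY ηT (x, w)| ^ q) (κ x) := by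
    refine i3.mono' ((((measurable_score hY hT).comp
      measurable_prodMk_left).abs.pow_const q).aestronglyMeasurable)
      (Eventually.of_forall fun w => ?_)
    rw [Real.norm_of_nonneg (Real.rpow_nonneg (abs_nonneg _) _)]
    exact hle w
  refine ⟨i4, (integral_mono i4 i3 hle).trans ?_⟩
  rw [integral_const_mul, integral_add i1 i2]
  have hC : 0 ≤ C := (abs_nonneg _).trans hθ
  have : 0 ≤ (2 * (1 + C) / c) ^ q := by positivity
  gcongr

end Score

/-! ### Measurability of the estimators -/

section Measurability

theorem measurable_crossFit {d n S : ℕ} {est : FirstStage d n}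
    (hest : ∀ A : Finset (Fin n), Measurable
      fun p : (A → Datum d) × (Fin d → ℝ) => est A p.1 p.2) (σ : Fin n → Fin S) (s : Fin S)
    (i : Fin n) :
    Measurable fun W : Fin n → Datum d => onCovs (crossFit est σ s W) (W i).2 := by
  have h1 : Measurable fun W : Fin n → Datum d =>
      fun j : {j // j ∈ Finset.univ.filter fun i => σ i ≠ s} => W j :=
    measurable_pi_lambda _ fun j => measurable_pi_apply _
  have h2 : Measurable fun W : Fin n → Datum d => covs (W i).2 :=
    measurable_covs.comp (measurable_snd.comp (measurable_pi_apply i))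
  exact (hest _).comp (h1.prodMk h2)

theorem measurable_sideWeight {n : ℕ} {k : ℝ → ℝ} (hk : Measurable k) (i : Fin n) :
    Measurable fun x : Fin n → ℝ => sideWeight k x i := by
  have hm : ∀ a : ℕ, Measurable fun x : Fin n → ℝ => ∑ j, k (x j) * x j ^ a := fun a =>
    Finset.measurable_sum _ fun j _ => (hk.comp (measurable_pi_apply j)).mul
      ((measurable_pi_apply j).pow_const a)
  -- Cramer's rule turns the matrix inverse into an explicit expression, valid also when the
  -- determinant is zero.
  have e : (fun x : Fin n → ℝ => sideWeight k x i) = fun x =>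
      ((∑ j, k (x j) * x j ^ 0) * (∑ j, k (x j) * x j ^ 2) - (∑ j, k (x j) * x j ^ 1) ^ 2)⁻¹ *
        ((∑ j, k (x j) * x j ^ 2) * k (x i) - (∑ j, k (x j) * x j ^ 1) * (k (x i) * x i)) := by
    ext x
    simp only [sideWeight, Matrix.inv_def, Matrix.det_fin_two, Matrix.adjugate_fin_two,
      Ring.inverse_eq_inv', Matrix.of_apply, Fin.val_zero, Fin.val_one, pow_zero, pow_one, mul_one,
      one_mul, one_pow, ← pow_two, Matrix.smul_mulVec, Pi.smul_apply, smul_eq_mul]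
    simp only [Matrix.mulVec, dotProduct, Fin.sum_univ_two, Matrix.of_apply, Matrix.cons_val_zero,
      Matrix.cons_val_one, Matrix.cons_val', Fin.val_zero, Fin.val_one, pow_zero, pow_one, mul_one]
    ring
  rw [e]
  have h1 : Measurable fun x : Fin n → ℝ => k (x i) := hk.comp (measurable_pi_apply i)
  exact (((hm 0).mul (hm 2)).sub ((hm 1).pow_const 2)).inv.mul
    (((hm 2).mul h1).sub ((hm 1).mul (h1.mul (measurable_pi_apply i))))

theorem measurable_kernPlus {K : ℝ → ℝ} (hK : Measurable K) (h : ℝ) : Measurable (kernPlus K h) :=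
  Measurable.ite measurableSet_Ici ((hK.comp (measurable_id.div_const h)).div_const h)
    measurable_const

theorem measurable_kernMinus {K : ℝ → ℝ} (hK : Measurable K) (h : ℝ) :
    Measurable (kernMinus K h) :=
  Measurable.ite measurableSet_Iio ((hK.comp (measurable_id.div_const h)).div_const h)
    measurable_const

theorem measurable_sharpEst {d n S : ℕ} {K : ℝ → ℝ} (hK : Measurable K) (h : ℝ) {y : Obs d → ℝ}
    (hy : Measurable y) {est : FirstStage d n}
    (hest : ∀ A : Finset (Fin n), Measurable
      fun p : (A → Datum d) × (Fin d → ℝ) => est A p.1 p.2) :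
    Measurable fun p : (Fin n → Fin S) × (Fin n → Datum d) => sharpEst K h y est p.1 p.2 := by
  -- There are finitely many splits, so the split may be fixed; the set of observations given to the
  -- first stage is then fixed too.
  refine measurable_from_prod_countable_right fun σ => ?_
  refine Finset.measurable_sum _ fun i _ => Measurable.mul ?_ ?_
  · have hx : Measurable fun W : Fin n → Datum d => fun j => (W j).1 :=
      measurable_pi_lambda _ fun j => measurable_fst.comp (measurable_pi_apply j)
    exact ((measurable_sideWeight (measurable_kernPlus hK h) i).comp hx).sub
      ((measurable_sideWeight (measurable_kernMinus hK h) i).comp hx)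
  · exact (hy.comp (measurable_snd.comp (measurable_pi_apply i))).sub
      (measurable_crossFit hest σ (σ i) i)

end Measurability

/-! ### Splitting the remainder; variance and Lyapunov conditions for the rows -/

section AsymptoticNormality

/-- Clipping R/a to [-e, e] leaves a coefficient of size at most e. Whatever is cut off exceeds e a,
and as |R| ≤ e(a + s) the excess is at most e s. With a = h² and s = (nh)^{-1/2} this divides the
remainder between bias and noise. -/
theorem abs_sub_clip_mul_le {R a e s : ℝ} (ha : 0 < a) (he : 0 ≤ e) (hs : 0 ≤ s)
    (hR : |R| ≤ e * (a + s)) :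
    |max (-e) (min e (R / a))| ≤ e ∧ |R - max (-e) (min e (R / a)) * a| ≤ e * s := by
  have hes : 0 ≤ e * s := mul_nonneg he hs
  obtain ⟨h1, h2⟩ := abs_le.1 hR
  refine ⟨abs_le.2 ⟨le_max_left _ _, max_le (by linarith) (min_le_left _ _)⟩, ?_⟩
  rcases le_total (R / a) e with h | h
  · rw [min_eq_right h]
    rcases le_total (-e) (R / a) with h' | h'
    · rw [max_eq_right h', div_mul_cancel₀ _ ha.ne', sub_self, abs_zero]
      exact hes
    · rw [max_eq_left h']
      rw [div_le_iff₀ ha] at h'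
      exact abs_le.2 ⟨by linarith, by linarith⟩
  · rw [min_eq_left h, max_eq_right (by linarith)]
    rw [le_div_iff₀ ha] at h
    exact abs_le.2 ⟨by linarith, by linarith⟩

variable {S : ℕ} {d : ℕ → ℕ} {PX : Measure ℝ} [IsProbabilityMeasure PX] {fX K : ℝ → ℝ} {h : ℕ → ℝ}
  {κ : ∀ n, Kernel ℝ (Obs (d n))} [∀ n, IsMarkovKernel (κ n)]
  {ρ : ∀ n, Measure (Fin n → Fin S)} [∀ n, IsProbabilityMeasure (ρ n)]

/-- The factor that standardizes a kernel-weighted sum; `f₀` is the density at the cutoff, `V` the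
asymptotic variance. -/
def rowScale (f₀ h V : ℝ) (n : ℕ) : ℝ := Real.sqrt (n * h) * (Real.sqrt V)⁻¹ * (n : ℝ)⁻¹ / f₀

/-- The factor in front of the error is at most a constant times (nh)^{-1/2} and vanishes off a
window of mass O(h). The n summands therefore contribute O(nh · (nh)^{-q/2}), which tends to 0
because q > 2. -/
theorem DesignAssumption.tendsto_row_lyapunov (hd : DesignAssumption PX fX K h)
    {e : ∀ n, Datum (d n) → ℝ} (he : ∀ n, Measurable (e n)) {q A V₀ : ℝ} (hq : 2 < q) (hA : 0 ≤ A)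
    (hqm : ∀ n, ∀ x ∈ PX.support, Integrable (fun w => |e n (x, w)| ^ q) (κ n x) ∧
      ∫ w, |e n (x, w)| ^ q ∂(κ n x) ≤ A)
    {V : ℕ → ℝ} (hV₀ : 0 < V₀) (hV : ∀ n, V₀ ≤ V n) :
    (∀ n, Integrable (fun w => |rowScale (fX 0) (h n) (V n) n *
      (rdKernel K (w.1 / h n) / h n * e n w)| ^ q) (PX ⊗ₘ κ n)) ∧
    Tendsto (fun n : ℕ => n * ∫ w, |rowScale (fX 0) (h n) (V n) n *
      (rdKernel K (w.1 / h n) / h n * e n w)| ^ q ∂(PX ⊗ₘ κ n)) atTop (𝓝 0) := by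
  have hf := hd.density_pos
  obtain ⟨b, hb⟩ := hd.rdKernel_windowed
  obtain ⟨F, hF, hF2⟩ := hd.exists_measure_Icc_le
  have hq0 : 0 < q := by linarith
  have hs0 : ∀ n, 0 ≤ rowScale (fX 0) (h n) (V n) n := fun n => by unfold rowScale; positivity
  have hb0 := hb.nonneg
  have key : ∀ n, Integrable (fun w => |rowScale (fX 0) (h n) (V n) n *
      (rdKernel K (w.1 / h n) / h n * e n w)| ^ q) (PX ⊗ₘ κ n) ∧
      ∫ w, |rowScale (fX 0) (h n) (V n) n * (rdKernel K (w.1 / h n) / h n * e n w)| ^ q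
        ∂(PX ⊗ₘ κ n) ≤ (rowScale (fX 0) (h n) (V n) n * (b / h n)) ^ q * A *
          PX.real (Icc (-h n) (h n)) := fun n => by
    have hh := hd.bandwidth_pos n
    have hm : Measurable fun w : Datum (d n) => |rowScale (fX 0) (h n) (V n) n *
        (rdKernel K (w.1 / h n) / h n * e n w)| ^ q := by
      have h1 : Measurable fun w : Datum (d n) => rdKernel K (w.1 / h n) :=
        hb.measurable.comp (measurable_fst.div_const _)
      exact (((h1.div_const _).mul (he n)).const_mul _).abs.pow_const q
    refine integrable_of_window hm (fun w => Real.rpow_nonneg (abs_nonneg _) _)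
      (fun x hx w => ?_) ?_
    · have : rdKernel K (x / h n) = 0 := hb.zero _ (by rwa [div_mem_Icc_iff hh])
      simp [this, Real.zero_rpow hq0.ne']
    · filter_upwards [PX.support_mem_ae] with x hx _
      obtain ⟨h1, h2⟩ := hqm n x hx
      have hsplit : ∀ w, |rowScale (fX 0) (h n) (V n) n *
          (rdKernel K (x / h n) / h n * e n (x, w))| ^ q =
          |rowScale (fX 0) (h n) (V n) n * (rdKernel K (x / h n) / h n)| ^ q *
            |e n (x, w)| ^ q := fun w => by
        rw [← Real.mul_rpow (abs_nonneg _) (abs_nonneg _), ← abs_mul, mul_assoc]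
      simp only [hsplit]
      refine ⟨h1.const_mul _, ?_⟩
      rw [integral_const_mul]
      have hle : |rowScale (fX 0) (h n) (V n) n * (rdKernel K (x / h n) / h n)| ≤
          rowScale (fX 0) (h n) (V n) n * (b / h n) := by
        rw [abs_mul, abs_of_nonneg (hs0 n), abs_div, abs_of_pos hh]
        exact mul_le_mul_of_nonneg_left (div_le_div_of_nonneg_right (hb.bound _) hh.le) (hs0 n)
      exact mul_le_mul (Real.rpow_le_rpow (abs_nonneg _) hle hq0.le) h2
        (integral_nonneg fun w => Real.rpow_nonneg (abs_nonneg _) _)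
        (Real.rpow_nonneg (mul_nonneg (hs0 n) (by positivity)) _)
  refine ⟨fun n => (key n).1, ?_⟩
  have hlim := (hd.tendsto_lyapunov hq).const_mul (((Real.sqrt V₀)⁻¹ * b / fX 0) ^ q * A * F)
  rw [mul_zero] at hlim
  refine tendsto_of_tendsto_of_tendsto_of_le_of_le' tendsto_const_nhds hlim
    (Eventually.of_forall fun n => mul_nonneg n.cast_nonneg
      (integral_nonneg fun w => Real.rpow_nonneg (abs_nonneg _) _)) ?_
  filter_upwards [hF2, eventually_gt_atTop 0] with n hn hn0
  have hh := hd.bandwidth_pos n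
  have hn' : (0 : ℝ) < n := by exact_mod_cast hn0
  have hV' := Real.sqrt_pos.2 hV₀
  have hsc : rowScale (fX 0) (h n) (V n) n * (b / h n) ≤
      ((Real.sqrt V₀)⁻¹ * b / fX 0) * (Real.sqrt (n * h n) / (n * h n)) := by
    have : (Real.sqrt (V n))⁻¹ ≤ (Real.sqrt V₀)⁻¹ := inv_anti₀ hV' (Real.sqrt_le_sqrt (hV n))
    calc _ = (Real.sqrt (V n))⁻¹ * (b / fX 0 * (Real.sqrt (n * h n) / (n * h n))) := by
          unfold rowScale; field_simp
      _ ≤ (Real.sqrt V₀)⁻¹ * (b / fX 0 * (Real.sqrt (n * h n) / (n * h n))) := by gcongr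
      _ = _ := by ring
  have hnn : 0 ≤ rowScale (fX 0) (h n) (V n) n * (b / h n) := mul_nonneg (hs0 n) (by positivity)
  have hpow := Real.rpow_le_rpow hnn hsc hq0.le
  rw [Real.mul_rpow (x := (Real.sqrt V₀)⁻¹ * b / fX 0) (by positivity) (by positivity)] at hpow
  calc _ ≤ n * ((rowScale (fX 0) (h n) (V n) n * (b / h n)) ^ q * A *
          PX.real (Icc (-h n) (h n))) := by gcongr; exact (key n).2
    _ ≤ n * ((((Real.sqrt V₀)⁻¹ * b / fX 0) ^ q * (Real.sqrt (n * h n) / (n * h n)) ^ q) * A *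
          (F * h n)) := by gcongr
    _ = _ := by ring

/-- Conditioning on X reduces the row variance to the local variance functional with prefactor 1/(V
f₀²). By the form of V this denominator is f₀ κ̄ (sp + sm), exactly the limit of that functional, so
the ratio tends to 1. -/
theorem DesignAssumption.tendsto_row_variance (hd : DesignAssumption PX fX K h)
    {e : ∀ n, Datum (d n) → ℝ} (he : ∀ n, Measurable (e n)) {A v₀ L δ : ℝ}
    (hsq : ∀ n, ∀ x ∈ PX.support, Integrable (fun w => e n (x, w) ^ 2) (κ n x) ∧
      ∫ w, e n (x, w) ^ 2 ∂(κ n x) ≤ A)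
    (hmean : ∀ n, ∀ x ∈ PX.support, ∫ w, e n (x, w) ∂(κ n x) = 0)
    {sp sm : ℕ → ℝ} (hv₀ : 0 < v₀) (hδ : 0 < δ) (hsp : ∀ n, v₀ ≤ sp n) (hsm : ∀ n, v₀ ≤ sm n)
    (hvp : ∀ n, ∀ x ∈ Ioo 0 δ, |∫ w, e n (x, w) ^ 2 ∂(κ n x) - sp n| ≤ L * |x|)
    (hvm : ∀ n, ∀ x ∈ Ioo (-δ) 0, |∫ w, e n (x, w) ^ 2 ∂(κ n x) - sm n| ≤ L * |x|)
    {V : ℕ → ℝ} (hV : ∀ n, V n = kappaBar K / fX 0 * (sp n + sm n)) :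
    (∀ n, MemLp (fun w => rowScale (fX 0) (h n) (V n) n *
      (rdKernel K (w.1 / h n) / h n * e n w)) 2 (PX ⊗ₘ κ n)) ∧
    (∀ n, ∫ w, rowScale (fX 0) (h n) (V n) n *
      (rdKernel K (w.1 / h n) / h n * e n w) ∂(PX ⊗ₘ κ n) = 0) ∧
    Tendsto (fun n : ℕ => n * ∫ w, (rowScale (fX 0) (h n) (V n) n *
      (rdKernel K (w.1 / h n) / h n * e n w)) ^ 2 ∂(PX ⊗ₘ κ n)) atTop (𝓝 1) := by
  have hf := hd.density_pos
  have hk := hd.kappaBar_pos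
  obtain ⟨b, hb⟩ := hd.rdKernel_windowed
  have hLp : ∀ n, MemLp (fun w : Datum (d n) => rdKernel K (w.1 / h n) / h n * e n w) 2
      (PX ⊗ₘ κ n) := fun n => (hb.memLp_mul (hd.bandwidth_pos n) (he n) (by
        filter_upwards [PX.support_mem_ae] with x hx _
        exact hsq n x hx)).1
  refine ⟨fun n => (hLp n).const_mul _, fun n => ?_, ?_⟩
  · rw [integral_const_mul, Measure.integral_compProd ((hLp n).integrable (by norm_num))]
    have : ∀ᵐ x ∂PX, ∫ w, rdKernel K (x / h n) / h n * e n (x, w) ∂(κ n x) = 0 := by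
      filter_upwards [PX.support_mem_ae] with x hx
      rw [integral_const_mul, hmean n x hx, mul_zero]
    rw [integral_congr_ae this, integral_zero, mul_zero]
  · have hsqI : ∀ n, Integrable (fun w : Datum (d n) =>
        (rdKernel K (w.1 / h n) / h n * e n w) ^ 2) (PX ⊗ₘ κ n) := fun n => (hLp n).integrable_sq
    have hsplit : ∀ n x, ∫ w, (rdKernel K (x / h n) / h n * e n (x, w)) ^ 2 ∂(κ n x) =
        (h n)⁻¹ * (rdKernel K (x / h n) ^ 2 / h n * ∫ w, e n (x, w) ^ 2 ∂(κ n x)) := fun n x => by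
      simp only [mul_pow, div_pow]
      rw [integral_const_mul]
      ring
    have hint : ∀ n, Integrable (fun x => rdKernel K (x / h n) ^ 2 / h n *
        ∫ w, e n (x, w) ^ 2 ∂(κ n x)) PX := fun n => by
      have hh := hd.bandwidth_pos n
      have h1 := ((Measure.integrable_compProd_iff (hsqI n).aestronglyMeasurable).1 (hsqI n)).2
      simp only [norm_pow, Real.norm_eq_abs, sq_abs] at h1
      simp only [hsplit] at h1
      have h2 := h1.const_mul (h n)
      simp only [mul_inv_cancel_left₀ hh.ne'] at h2
      exact h2
    have hlim := hd.tendsto_integral_rdKernel_sq hv₀ hδ hsp hsm hvp hvm hint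
    refine hlim.congr' ?_
    filter_upwards [eventually_gt_atTop 0] with n hn
    have hn' : (0 : ℝ) < n := by exact_mod_cast hn
    have hh := hd.bandwidth_pos n
    have hs : 0 < sp n + sm n := by linarith [hsp n, hsm n]
    have hVn : 0 < V n := by rw [hV]; positivity
    simp only [mul_pow (rowScale _ _ _ _)]
    rw [integral_const_mul, Measure.integral_compProd (hsqI n)]
    simp only [hsplit]
    rw [integral_const_mul, rowScale, div_pow, mul_pow, mul_pow, inv_pow, Real.sq_sqrt hVn.le,
      Real.sq_sqrt (by positivity), hV]
    field_simp

end AsymptoticNormality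

/-! ### Asymptotic normality of the fuzzy estimator -/

section MainResult

variable {S : ℕ} {d : ℕ → ℕ} {PX : Measure ℝ} {fX K : ℝ → ℝ} {h : ℕ → ℝ}
  {κ : ∀ n, Kernel ℝ (Obs (d n))} [∀ n, IsMarkovKernel (κ n)]
  {ρ : ∀ n, Measure (Fin n → Fin S)} [∀ n, IsProbabilityMeasure (ρ n)]
  {estY estT : ∀ n, FirstStage (d n) n} {ηY ηT : ∀ n, (Fin (d n) → ℝ) → ℝ}

theorem sum_row_score {d n S : ℕ} (K : ℝ → ℝ) (f₀ h V : ℝ) (κ : Kernel ℝ (Obs d))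
    (ηY ηT : (Fin d → ℝ) → ℝ) (p : (Fin n → Fin S) × (Fin n → Datum d)) :
    ∑ i, rowScale f₀ h V n * (rdKernel K ((p.2 i).1 / h) / h * score κ ηY ηT (p.2 i)) =
      Real.sqrt (n * h) * (Real.sqrt V)⁻¹ * ((rdLinear K f₀ h κ (adjusted outY ηY) p -
        fuzzyParam κ * rdLinear K f₀ h κ (adjusted outT ηT) p) / rdJump κ outT) := by
  simp only [rdLinear, linearPart, sampleAvg, rowScale, ← mul_sub, ← Finset.sum_sub_distrib,
    Finset.mul_sum, Finset.sum_div, score, rdKernel]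
  exact Finset.sum_congr rfl fun i _ => by ring

theorem measurable_linearPart {d n S : ℕ} {k : ℝ → ℝ} (hk : SideKernel k) (f₀ h : ℝ)
    {κ : Kernel ℝ (Obs d)} {m : Obs d → ℝ} (hm : Measurable m) :
    Measurable fun p : (Fin n → Fin S) × (Fin n → Datum d) => linearPart k f₀ h κ m p := by
  obtain ⟨b, hb⟩ := hk.equivKernel_windowed
  refine Measurable.const_mul (Finset.measurable_sum _ fun i _ => ?_) _
  have hi : Measurable fun p : (Fin n → Fin S) × (Fin n → Datum d) => p.2 i :=
    (measurable_pi_apply i).comp measurable_snd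
  exact (((hb.measurable.comp ((measurable_fst.comp hi).div_const h)).div_const h).div_const
    f₀).mul ((measurable_residual hm).comp hi)

theorem DesignAssumption.measurable_rdLinear (hd : DesignAssumption PX fX K h) {d n S : ℕ}
    (f₀ h' : ℝ) {κ : Kernel ℝ (Obs d)} {m : Obs d → ℝ} (hm : Measurable m) :
    Measurable fun p : (Fin n → Fin S) × (Fin n → Datum d) => rdLinear K f₀ h' κ m p :=
  (measurable_linearPart hd.sideKernel_kPlus f₀ h' hm).sub
    (measurable_linearPart hd.sideKernel_kMinus f₀ h' hm)

/-- The one-sided limits exist and the asymptotic variance is bounded away from zero. -/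
theorem DesignAssumption.asympVar_ge (hd : DesignAssumption PX fX K h) {d : ℕ}
    {κ : Kernel ℝ (Obs d)} {ηY ηT : (Fin d → ℝ) → ℝ} {C L : ℝ} (hC : 0 < C)
    (hU : RegularVariance PX C L κ (fuzzyU κ ηY ηT)) :
    0 < kappaBar K / fX 0 * (1 / C) ∧
      kappaBar K / fX 0 * (1 / C) ≤ asympVar K fX κ ηY ηT := by
  obtain ⟨δ, hδ, F, -, -, -, hsub⟩ := hd.exists_local
  obtain ⟨-, h1, h2, -⟩ := hU.limits hδ hsub
  have hk := hd.kappaBar_pos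
  have hf := hd.density_pos
  have hC' : 0 < 1 / C := by positivity
  refine ⟨by positivity, ?_⟩
  rw [asympVar]
  refine mul_le_mul_of_nonneg_left ?_ (by positivity)
  linarith

/-- The standardized estimator is asymptotically normal whenever it is asymptotically equivalent to
the standardized linear part. -/
theorem DesignAssumption.tendstoInDistribution_score [IsProbabilityMeasure PX]
    (hd : DesignAssumption PX fX K h)
    (hηY : ∀ n, Measurable (ηY n)) (hηT : ∀ n, Measurable (ηT n))
    (houtY : OutcomeAssumption PX κ fun n => adjusted outY (ηY n))
    (houtT : OutcomeAssumption PX κ fun n => adjusted outT (ηT n))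
    {c C : ℝ} (hc : 0 < c) (hjump : ∀ n, c ≤ |rdJump (κ n) outT| ∧ |fuzzyParam (κ n)| ≤ C)
    {CU LU : ℝ} (hCU : 0 < CU)
    (hvarU : ∀ n, RegularVariance PX CU LU (κ n) (fuzzyU (κ n) (ηY n) (ηT n)))
    {X : ∀ n, (Fin n → Fin S) × (Fin n → Datum (d n)) → ℝ} (hX : ∀ n, Measurable (X n))
    (hR : LittleOP (fun n => sampleLaw (ρ n) PX (κ n))
      (fun n p => X n p - Real.sqrt (n * h n) *
        (Real.sqrt (asympVar K fX (κ n) (ηY n) (ηT n)))⁻¹ *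
        ((rdLinear K (fX 0) (h n) (κ n) (adjusted outY (ηY n)) p -
          fuzzyParam (κ n) * rdLinear K (fX 0) (h n) (κ n) (adjusted outT (ηT n)) p) /
          rdJump (κ n) outT)) fun _ => 1) :
    TendstoInDistribution X atTop id (fun n => sampleLaw (ρ n) PX (κ n)) (gaussianReal 0 1) := by
  obtain ⟨CY, LY, qY, hCY, hqY, hoY⟩ := houtY
  obtain ⟨CT, LT, qT, hCT, hqT, hoT⟩ := houtT
  obtain ⟨δ, hδ, F, -, -, -, hsub⟩ := hd.exists_local
  -- One exponent valid for both outcomes, capped at 3 as the characteristic function bound requires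
  -- and still above 2.
  set q := min (min qY qT) 3 with hq
  have hq2 : 2 < q := lt_min (lt_min hqY hqT) (by norm_num)
  have hq3 : q ≤ 3 := min_le_right _ _
  have hqY' : q ≤ qY := (min_le_left _ _).trans (min_le_left _ _)
  have hqT' : q ≤ qT := (min_le_left _ _).trans (min_le_right _ _)
  have hC : 0 ≤ C := (abs_nonneg _).trans (hjump 0).2
  have hm := fun n => measurable_score (κ := κ n) (hηY n) (hηT n)
  have hsupp : ∀ x ∈ Ioo (-δ) δ, x ∈ PX.support := fun x hx => interior_subset (hsub hx)
  have hsqv := fun n x (hx : x ∈ PX.support) => integral_score_sq (κ := κ n) (hηY n) (hηT n)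
    ((hoY n).1.1 x hx) ((hoT n).1.1 x hx)
  have hlim := fun n => (hvarU n).limits hδ hsub
  have hge := fun n => hd.asympVar_ge hCU (hvarU n)
  have hlyap := hd.tendsto_row_lyapunov (κ := κ) hm hq2
    (A := (2 * (1 + C) / c) ^ q * ((1 + CY) + (1 + CT))) (by positivity)
    (fun n x hx => score_moment hc (by linarith) (hjump n).1 (hjump n).2 (hηY n) (hηT n)
      (hoY n).2.1 hqY' (hoT n).2.1 hqT' hx) (hge 0).1 (fun n => (hge n).2)
  have hvar := hd.tendsto_row_variance (κ := κ) hm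
    (A := (2 * (1 + C) / c) ^ (2 : ℝ) * ((1 + CY) + (1 + CT))) (fun n x hx => by
      have := score_moment hc zero_le_two (hjump n).1 (hjump n).2 (hηY n) (hηT n)
        (hoY n).2.1 hqY.le (hoT n).2.1 hqT.le hx
      simpa only [Real.rpow_two, sq_abs] using this)
    (fun n x hx => integral_score ((hoY n).1.1 x hx) ((hoT n).1.1 x hx))
    (sp := fun n => limPlus (condVar (κ n) (fuzzyU (κ n) (ηY n) (ηT n))))
    (sm := fun n => limMinus (condVar (κ n) (fuzzyU (κ n) (ηY n) (ηT n))))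
    (v₀ := 1 / CU) (by positivity) hδ (fun n => (hlim n).2.1) (fun n => (hlim n).2.2.1)
    (L := |LU|)
    (fun n x hx => by
      rw [hsqv n x (hsupp x (Ioo_pos_subset_right hδ hx))]
      exact (hlim n).2.2.2.1 x hx)
    (fun n x hx => by
      rw [hsqv n x (hsupp x (Ioo_neg_subset_left hδ hx))]
      exact (hlim n).2.2.2.2 x hx)
    (V := fun n => asympVar K fX (κ n) (ηY n) (ηT n)) (fun n => rfl)
  obtain ⟨b, hb⟩ := hd.rdKernel_windowed
  refine tendstoInDistribution_row_sum_add (fun n => PX ⊗ₘ κ n) _ (fun n => Prod.snd)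
    (fun n => measurePreserving_snd_sampleLaw n) hq2 hq3 (fun n => ?_)
    (Eventually.of_forall hvar.1) (Eventually.of_forall hlyap.1) (Eventually.of_forall hvar.2.1)
    hvar.2.2 hlyap.2 hX ?_
  · have h1 : Measurable fun w : Datum (d n) => rdKernel K (w.1 / h n) :=
      hb.measurable.comp (measurable_fst.div_const _)
    exact ((h1.div_const _).mul (hm n)).const_mul _
  · simpa only [sum_row_score] using hR

/-- The bias is the leading constant plus the clipped ratio of the remainder to h². It is random
because no relation between h² and (nh)^{-1/2} is assumed: the part of the remainder that is small
only relative to h² could survive standardization. -/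
theorem DesignAssumption.asymptotic_normality [IsProbabilityMeasure PX]
    (hd : DesignAssumption PX fX K h)
    (hestY : ∀ n (A : Finset (Fin n)), Measurable
      fun p : (A → Datum (d n)) × (Fin (d n) → ℝ) => estY n A p.1 p.2)
    (hestT : ∀ n (A : Finset (Fin n)), Measurable
      fun p : (A → Datum (d n)) × (Fin (d n) → ℝ) => estT n A p.1 p.2)
    (hfirstY : FirstStageAssumption PX h κ ρ estY ηY)
    (hfirstT : FirstStageAssumption PX h κ ρ estT ηT)
    (houtY : OutcomeAssumption PX κ fun n => adjusted outY (ηY n))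
    (houtT : OutcomeAssumption PX κ fun n => adjusted outT (ηT n))
    {c C : ℝ} (hc : 0 < c) (hjump : ∀ n, c ≤ |rdJump (κ n) outT| ∧ |fuzzyParam (κ n)| ≤ C)
    {CU LU : ℝ} (hCU : 0 < CU)
    (hvarU : ∀ n, RegularVariance PX CU LU (κ n) (fuzzyU (κ n) (ηY n) (ηT n))) :
    ∃ B : ∀ n, (Fin n → Fin S) × (Fin n → Datum (d n)) → ℝ,
      (∀ n, Measurable (B n)) ∧
      (∀ ε > 0, Tendsto (fun n => sampleLaw (ρ n) PX (κ n)
        {p | ε ≤ |B n p - biasLead K (κ n)|}) atTop (𝓝 0)) ∧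
      TendstoInDistribution
        (fun n p => Real.sqrt (n * h n) *
          (Real.sqrt (asympVar K fX (κ n) (ηY n) (ηT n)))⁻¹ *
          (fuzzyEst K (h n) (estY n) (estT n) p.1 p.2 - fuzzyParam (κ n) - B n p * h n ^ 2))
        atTop id (fun n => sampleLaw (ρ n) PX (κ n)) (gaussianReal 0 1) := by
  have hηY : ∀ n, Measurable (ηY n) := fun n => (hfirstY.admissible n).1
  have hηT : ∀ n, Measurable (ηT n) := fun n => (hfirstT.admissible n).1
  let G : ∀ n, (Fin n → Fin S) × (Fin n → Datum (d n)) → ℝ := fun n p =>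
    (rdLinear K (fX 0) (h n) (κ n) (adjusted outY (ηY n)) p -
      fuzzyParam (κ n) * rdLinear K (fX 0) (h n) (κ n) (adjusted outT (ηT n)) p) /
      rdJump (κ n) outT
  let R : ∀ n, (Fin n → Fin S) × (Fin n → Datum (d n)) → ℝ := fun n p =>
    fuzzyEst K (h n) (estY n) (estT n) p.1 p.2 - fuzzyParam (κ n) -
      (biasLead K (κ n) * h n ^ 2 + G n p)
  have hmest : ∀ n, Measurable fun p : (Fin n → Fin S) × (Fin n → Datum (d n)) =>
      fuzzyEst K (h n) (estY n) (estT n) p.1 p.2 := fun n =>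
    (measurable_sharpEst hd.kernel_measurable (h n) measurable_outY (hestY n)).div
      (measurable_sharpEst hd.kernel_measurable (h n) measurable_outT (hestT n))
  have hmG : ∀ n, Measurable (G n) := fun n =>
    ((hd.measurable_rdLinear _ _ (measurable_adjusted measurable_outY (hηY n))).sub
      ((hd.measurable_rdLinear _ _ (measurable_adjusted measurable_outT (hηT n))).const_mul
        _)).div_const _
  have hmR : ∀ n, Measurable (R n) := fun n =>
    ((hmest n).sub_const _).sub ((hmG n).const_add _)
  have hexp : LittleOP (fun n => sampleLaw (ρ n) PX (κ n)) R (totRate h) :=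
    hd.fuzzy_expansion hestY hestT hfirstY hfirstT houtY houtT hc hjump
  obtain ⟨e, he0, he, hwhp⟩ := hexp.exists_rate (totRate_nonneg h)
  let D : ∀ n, (Fin n → Fin S) × (Fin n → Datum (d n)) → ℝ := fun n p =>
    max (-e n) (min (e n) (R n p / h n ^ 2))
  have hD : ∀ n p, |D n p| ≤ e n := fun n p => abs_le.2
    ⟨le_max_left _ _, max_le (by linarith [he0 n]) (min_le_left _ _)⟩
  have hmD : ∀ n, Measurable (D n) := fun n =>
    measurable_const.max (measurable_const.min ((hmR n).div_const _))
  refine ⟨fun n p => biasLead K (κ n) + D n p, fun n => (hmD n).const_add _, fun ε hε => ?_, ?_⟩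
  -- The correction is bounded by the deterministic sequence e, so the event is empty once e n < ε.
  · refine tendsto_const_nhds.congr' ?_
    filter_upwards [he.eventually (gt_mem_nhds hε)] with n hn
    rw [eq_comm, ← measure_empty (μ := sampleLaw (ρ n) PX (κ n))]
    congr 1
    ext p
    simp only [mem_ofPred_eq, mem_empty_iff_false, iff_false, not_le, add_sub_cancel_left]
    exact (hD n p).trans_lt hn
  · refine hd.tendstoInDistribution_score hηY hηT houtY houtT hc hjump hCU hvarU (fun n => ?_) ?_
    · exact (((hmest n).sub_const _).sub (((hmD n).const_add _).mul_const _)).const_mul _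
    · have hV := fun n => hd.asympVar_ge hCU (hvarU n)
      set V₀ := kappaBar K / fX 0 * (1 / CU)
      have hV₀ := Real.sqrt_pos.2 (hV 0).1
      have hlim : Tendsto (fun n => (Real.sqrt V₀)⁻¹ * e n) atTop (𝓝 0) := by
        simpa using he.const_mul (Real.sqrt V₀)⁻¹
      -- After clipping, the remainder is at most e (nh)^{-1/2}. The standardizing factor is at most
      -- (nh)^{1/2} V₀^{-1/2}, so only a multiple of e remains.
      refine LittleOP.of_le_null hlim (fun _ => zero_le_one) (hwhp.mono_eventually ?_)
      filter_upwards [eventually_gt_atTop 0] with n hn p hp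
      have hn' : (0 : ℝ) < n := by exact_mod_cast hn
      have hh := hd.bandwidth_pos n
      have hs : 0 < Real.sqrt (n * h n) := Real.sqrt_pos.2 (by positivity)
      have hclip := (abs_sub_clip_mul_le (pow_pos hh 2) (he0 n) (sdRate_nonneg h n) hp).2
      have hVn : (Real.sqrt (asympVar K fX (κ n) (ηY n) (ηT n)))⁻¹ ≤ (Real.sqrt V₀)⁻¹ :=
        inv_anti₀ hV₀ (Real.sqrt_le_sqrt (hV n).2)
      have hid : Real.sqrt (n * h n) * (Real.sqrt (asympVar K fX (κ n) (ηY n) (ηT n)))⁻¹ *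
          (fuzzyEst K (h n) (estY n) (estT n) p.1 p.2 - fuzzyParam (κ n) -
            (biasLead K (κ n) + D n p) * h n ^ 2) -
          Real.sqrt (n * h n) * (Real.sqrt (asympVar K fX (κ n) (ηY n) (ηT n)))⁻¹ * G n p =
          Real.sqrt (n * h n) * (Real.sqrt (asympVar K fX (κ n) (ηY n) (ηT n)))⁻¹ *
            (R n p - D n p * h n ^ 2) := by
        simp only [R]; ring
      change |Real.sqrt (n * h n) * (Real.sqrt (asympVar K fX (κ n) (ηY n) (ηT n)))⁻¹ *
          (fuzzyEst K (h n) (estY n) (estT n) p.1 p.2 - fuzzyParam (κ n) -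
            (biasLead K (κ n) + D n p) * h n ^ 2) -
          Real.sqrt (n * h n) * (Real.sqrt (asympVar K fX (κ n) (ηY n) (ηT n)))⁻¹ * G n p| ≤ _
      rw [hid, abs_mul, abs_of_nonneg (by positivity)]
      calc _ ≤ Real.sqrt (n * h n) * (Real.sqrt V₀)⁻¹ * (e n * sdRate h n) := by gcongr
        _ = _ := by rw [sdRate]; field_simp

end MainResult

/-! ### Variance and covariance identities -/

section Covariances

variable {Ω : Type*} [mΩ : MeasurableSpace Ω] {P : Measure Ω} [IsProbabilityMeasure P]
  {X Y X' : Ω → ℝ}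

theorem variance_sub_eq (hX : MemLp X 2 P) (hY : MemLp Y 2 P) :
    Var[fun w => X w - Y w; P] = Var[X; P] - 2 * cov[X, Y; P] + Var[Y; P] := by
  have h : AEMeasurable (fun w => X w - Y w) P := (hX.sub hY).aestronglyMeasurable.aemeasurable
  rw [← covariance_self h,
    ← covariance_self hX.aestronglyMeasurable.aemeasurable,
    ← covariance_self hY.aestronglyMeasurable.aemeasurable,
    covariance_fun_sub_fun_sub hX hY hX hY, covariance_comm Y X]
  ring

/-- The variance of X - tY is a nonnegative quadratic in t, so its discriminant is not positive. -/
theorem sq_covariance_le (hX : MemLp X 2 P) (hY : MemLp Y 2 P) :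
    cov[X, Y; P] ^ 2 ≤ Var[X; P] * Var[Y; P] := by
  have h : ∀ t : ℝ, 0 ≤ Var[Y; P] * (t * t) + (-2 * cov[X, Y; P]) * t + Var[X; P] := fun t => by
    have h1 := variance_nonneg (fun w => X w - t * Y w) P
    rw [variance_sub_eq hX (hY.const_mul t), covariance_const_mul_right, variance_const_mul] at h1
    linarith
  have := discrim_le_zero h
  rw [discrim] at this
  linarith

theorem variance_le_eLpNorm_sq (hX : MemLp X 2 P) : Var[X; P] ≤ (eLpNorm X 2 P ^ 2).toReal := by
  refine (variance_le_expectation_sq hX.aestronglyMeasurable).trans (le_of_eq ?_)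
  have h := eLpNorm_nnreal_pow_eq_lintegral (f := X) (μ := P) (p := 2) (by norm_num)
  simp only [NNReal.coe_ofNat, ENNReal.coe_ofNat, ENNReal.rpow_ofNat] at h
  simp only [Pi.pow_apply]
  rw [h, integral_eq_lintegral_of_nonneg_ae (Eventually.of_forall fun w => sq_nonneg _)
    (hX.aestronglyMeasurable.pow 2)]
  congr 1
  refine lintegral_congr fun w => ?_
  rw [← ofReal_norm, ← ENNReal.ofReal_pow (norm_nonneg _), Real.norm_eq_abs, sq_abs]

/-- Only the conditional expectation given `m` matters for covariances with `m`-measurable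
variables. -/
theorem covariance_eq_of_condExp {m : MeasurableSpace Ω} (hm : m ≤ mΩ)
    (hX : MemLp X 2 P) (hY : MemLp Y 2 P) (hYm : StronglyMeasurable[m] Y)
    (hX' : X' =ᵐ[P] P[X | m]) :
    MemLp X' 2 P ∧ cov[X, Y; P] = cov[X', Y; P] := by
  have hL : MemLp X' 2 P := (memLp_congr_ae hX').2 (hX.condExp (m := m) (by norm_num))
  refine ⟨hL, ?_⟩
  rw [covariance_eq_sub hX hY, covariance_eq_sub hL hY, integral_congr_ae hX', integral_condExp hm]
  have h1 := condExp_mul_of_stronglyMeasurable_right hYm (hX.integrable_mul hY)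
    (hX.integrable (by norm_num))
  rw [← integral_condExp hm (f := X * Y), integral_congr_ae h1]
  congr 1
  refine integral_congr_ae ?_
  filter_upwards [hX'] with w hw
  simp [hw]

end Covariances

/-! ### From the outcome to the long regression -/

section LongRegression

variable {d : ℕ} {PX : Measure ℝ} {κ : Kernel ℝ (Obs d)} [IsMarkovKernel κ]

theorem stronglyMeasurable_onCovs {d : ℕ} {η : (Fin d → ℝ) → ℝ} (hη : Measurable η) :
    StronglyMeasurable[MeasurableSpace.comap covs inferInstance] (onCovs η : Obs d → ℝ) :=
  (hη.comp (comap_measurable covs)).stronglyMeasurable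

/-- Along a filter at the cutoff, covariances with the outcome converge to covariances with the
limit of the long regression. -/
theorem tendsto_condCov_long {l : Filter ℝ} (hl : l ≤ 𝓝 0) (hs : PX.support ∈ 𝓝 (0 : ℝ))
    {y : Obs d → ℝ} {μ : ℝ → (Fin d → ℝ) → ℝ} {μ' η : (Fin d → ℝ) → ℝ}
    (hy : ∀ x ∈ PX.support, MemLp y 2 (κ x))
    (hμ : ∀ x ∈ PX.support,
      onCovs (μ x) =ᵐ[κ x] (κ x)[y | MeasurableSpace.comap covs inferInstance])
    (hμ' : ∀ x ∈ PX.support, MemLp (onCovs μ') 2 (κ x))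
    (hlim : Tendsto (fun x => eLpNorm (onCovs (μ x - μ')) 2 (κ x)) l (𝓝 0))
    (hηm : Measurable η) (hη : ∀ x ∈ PX.support, MemLp (onCovs η) 2 (κ x))
    (hvar : ContinuousOn (condVar κ (onCovs η)) PX.support)
    (hcov : ContinuousOn (condCov κ (onCovs η) (onCovs μ')) PX.support) :
    Tendsto (condCov κ y (onCovs η)) l (𝓝 (condCov κ (onCovs η) (onCovs μ') 0)) := by
  have hsl : ∀ᶠ x in l, x ∈ PX.support := hl hs
  have hv := (hvar.continuousAt hs).tendsto.mono_left hl
  have hc := (hcov.continuousAt hs).tendsto.mono_left hl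
  -- The adjustment is a function of Z, so the outcome may be replaced by its regression on Z, and
  -- then by the fixed limit μ' plus a gap. The covariance with the gap vanishes by Cauchy–Schwarz,
  -- as the gap tends to 0 in mean square while the variance of η(Z) converges.
  have hgap : ∀ x ∈ PX.support, MemLp (onCovs (μ x - μ')) 2 (κ x) ∧
      condCov κ y (onCovs η) x = condCov κ (onCovs (μ x - μ')) (onCovs η) x +
        condCov κ (onCovs η) (onCovs μ') x := fun x hx => by
    obtain ⟨h1, h2⟩ := covariance_eq_of_condExp measurable_covs.comap_le (hy x hx) (hη x hx)
      (stronglyMeasurable_onCovs hηm) (hμ x hx)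
    refine ⟨h1.sub (hμ' x hx), ?_⟩
    have h3 := covariance_fun_sub_left h1 (hμ' x hx) (hη x hx)
    have e : onCovs (μ x - μ') = fun w : Obs d => onCovs (μ x) w - onCovs μ' w := rfl
    rw [condCov, condCov, condCov, h2, e, h3, covariance_comm (onCovs η)]
    ring
  have hsmall : Tendsto (fun x => condCov κ (onCovs (μ x - μ')) (onCovs η) x) l (𝓝 0) := by
    have h1 : Tendsto (fun x => (eLpNorm (onCovs (μ x - μ')) 2 (κ x) ^ 2).toReal) l (𝓝 0) := by
      have := (ENNReal.continuous_pow 2).tendsto 0 |>.comp hlim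
      rw [zero_pow two_ne_zero] at this
      exact (ENNReal.tendsto_toReal ENNReal.zero_ne_top).comp this
    have h2 := (h1.mul hv).sqrt
    rw [zero_mul, Real.sqrt_zero] at h2
    refine squeeze_zero_norm' ?_ h2
    filter_upwards [hsl] with x hx
    rw [Real.norm_eq_abs]
    refine Real.abs_le_sqrt ((sq_covariance_le (hgap x hx).1 (hη x hx)).trans ?_)
    exact mul_le_mul_of_nonneg_right (variance_le_eLpNorm_sq (hgap x hx).1) (variance_nonneg _ _)
  have := hsmall.add hc
  rw [zero_add] at this
  refine this.congr' ?_
  filter_upwards [hsl] with x hx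
  exact (hgap x hx).2.symm

theorem BoundedSecondMoment.memLp {d : ℕ} {PX : Measure ℝ} {κ : Kernel ℝ (Obs d)} {y : Obs d → ℝ}
    (h : BoundedSecondMoment PX κ y) (hy : Measurable y) {x : ℝ} (hx : x ∈ PX.support) :
    MemLp y 2 (κ x) := by
  obtain ⟨C, hC⟩ := h
  exact (memLp_two_iff_integrable_sq hy.aestronglyMeasurable).2 (hC x hx).1

end LongRegression

/-! ### The asymptotic variance as a function of the adjustment -/

section VarianceComparison

variable {d : ℕ} {PX : Measure ℝ} {κ : Kernel ℝ (Obs d)} [IsMarkovKernel κ]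
  {μYp μYm μTp μTm ηY ηT : (Fin d → ℝ) → ℝ}

/-- The adjustment `η_Y(Z) - θ η_T(Z)`. -/
def fuzzyAdj {d : ℕ} (κ : Kernel ℝ (Obs d)) (ηY ηT : (Fin d → ℝ) → ℝ) (w : Obs d) : ℝ :=
  onCovs ηY w - fuzzyParam κ * onCovs ηT w

theorem covariance_fuzzy {Ω : Type*} [MeasurableSpace Ω] {P : Measure Ω} [IsProbabilityMeasure P]
    {A B X Y : Ω → ℝ} (hA : MemLp A 2 P) (hB : MemLp B 2 P) (hX : MemLp X 2 P) (hY : MemLp Y 2 P)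
    (t : ℝ) : cov[fun w => A w - t * B w, fun w => X w - t * Y w; P] =
      cov[A, X; P] - t * cov[A, Y; P] - t * (cov[B, X; P] - t * cov[B, Y; P]) := by
  rw [covariance_fun_sub_fun_sub hA (hB.const_mul t) hX (hY.const_mul t)]
  simp only [covariance_const_mul_left, covariance_const_mul_right]
  ring

theorem condVar_fuzzyU {x : ℝ} (hY : MemLp (outY : Obs d → ℝ) 2 (κ x))
    (hT : MemLp (outT : Obs d → ℝ) 2 (κ x)) (hηY : MemLp (onCovs ηY) 2 (κ x))
    (hηT : MemLp (onCovs ηT) 2 (κ x)) :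
    condVar κ (fuzzyU κ ηY ηT) x = (rdJump κ outT)⁻¹ ^ 2 * (condVar κ (fuzzyOutcome κ) x -
      2 * condCov κ (fuzzyOutcome κ) (fuzzyAdj κ ηY ηT) x + condVar κ (fuzzyAdj κ ηY ηT) x) := by
  have e : fuzzyU κ ηY ηT = fun w =>
      (fuzzyOutcome κ w - fuzzyAdj κ ηY ηT w) * (rdJump κ outT)⁻¹ := by
    ext w
    simp only [fuzzyU, fuzzyOutcome, fuzzyAdj, div_eq_mul_inv]
  have h1 : MemLp (fuzzyOutcome κ) 2 (κ x) := hY.sub (hT.const_mul _)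
  have h2 : MemLp (fuzzyAdj κ ηY ηT) 2 (κ x) := hηY.sub (hηT.const_mul _)
  rw [condVar, e, variance_mul_const, variance_sub_eq h1 h2, mul_comm]
  rfl

theorem varPair.continuousOn_condVar (h : varPair PX κ μYp μYm μTp μTm ηY ηT) :
    ContinuousOn (condVar κ (fuzzyAdj κ ηY ηT)) PX.support := by
  obtain ⟨⟨-, hY, vY, -⟩, ⟨-, hT, vT, -⟩, hc⟩ := h
  refine ((vY.sub ((hc.const_mul (fuzzyParam κ)).const_mul 2)).add
    (vT.const_mul (fuzzyParam κ ^ 2))).congr fun x hx => ?_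
  change Var[fun w => onCovs ηY w - fuzzyParam κ * onCovs ηT w; κ x] = _
  rw [variance_sub_eq (hY x hx) ((hT x hx).const_mul _), covariance_const_mul_right,
    variance_const_mul]
  rfl

/-- The limit of the covariance of `Y - θ T` with the adjustment. -/
theorem varPair.tendsto_condCov {l : Filter ℝ} (hl : l ≤ 𝓝 0) (hs : PX.support ∈ 𝓝 (0 : ℝ))
    (h : varPair PX κ μYp μYm μTp μTm ηY ηT) {μY μT : (Fin d → ℝ) → ℝ}
    (hY : ∀ x ∈ PX.support, MemLp (outY : Obs d → ℝ) 2 (κ x))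
    (hT : ∀ x ∈ PX.support, MemLp (outT : Obs d → ℝ) 2 (κ x))
    (hμY : MemLp (onCovs μY) 2 (κ 0)) (hμT : MemLp (onCovs μT) 2 (κ 0))
    (limY : ∀ η ∈ varClass PX κ μYp μYm μTp μTm, Tendsto (condCov κ outY (onCovs η)) l
      (𝓝 (condCov κ (onCovs η) (onCovs μY) 0)))
    (limT : ∀ η ∈ varClass PX κ μYp μYm μTp μTm, Tendsto (condCov κ outT (onCovs η)) l
      (𝓝 (condCov κ (onCovs η) (onCovs μT) 0))) :
    Tendsto (condCov κ (fuzzyOutcome κ) (fuzzyAdj κ ηY ηT)) l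
      (𝓝 (condCov κ (fuzzyAdj κ μY μT) (fuzzyAdj κ ηY ηT) 0)) := by
  have h0 : (0 : ℝ) ∈ PX.support := mem_of_mem_nhds hs
  have hlim := ((limY ηY h.1).sub ((limY ηT h.2.1).const_mul (fuzzyParam κ))).sub
    (((limT ηY h.1).sub ((limT ηT h.2.1).const_mul (fuzzyParam κ))).const_mul (fuzzyParam κ))
  have e : condCov κ (fuzzyAdj κ μY μT) (fuzzyAdj κ ηY ηT) 0 =
      condCov κ (onCovs ηY) (onCovs μY) 0 - fuzzyParam κ * condCov κ (onCovs ηT) (onCovs μY) 0 -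
      fuzzyParam κ * (condCov κ (onCovs ηY) (onCovs μT) 0 -
        fuzzyParam κ * condCov κ (onCovs ηT) (onCovs μT) 0) := by
    have := covariance_fuzzy hμY hμT (h.1.2.1 0 h0) (h.2.1.2.1 0 h0) (fuzzyParam κ)
    simp only [condCov, covariance_comm (onCovs ηY), covariance_comm (onCovs ηT)]
    exact this
  rw [e]
  refine hlim.congr' ?_
  filter_upwards [hl hs] with x hx
  exact (covariance_fuzzy (hY x hx) (hT x hx) (h.1.2.1 x hx) (h.2.1.2.1 x hx) _).symm

/-- The one-sided limits of the conditional variance of `U(η_Y, η_T)` for a regular pair. -/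
theorem varPair.limits_condVar (h : varPair PX κ μYp μYm μTp μTm ηY ηT)
    (hs : PX.support ∈ 𝓝 (0 : ℝ)) (bY : BoundedSecondMoment PX κ outY)
    (bT : BoundedSecondMoment PX κ outT) (hD : HasOneSidedLimits (condVar κ (fuzzyOutcome κ)))
    (lY : IsLongLimit PX κ outY μYp μYm) (lT : IsLongLimit PX κ outT μTp μTm) :
    HasOneSidedLimits (condVar κ (fuzzyU κ ηY ηT)) ∧
    limPlus (condVar κ (fuzzyU κ ηY ηT)) = (rdJump κ outT)⁻¹ ^ 2 *
      (limPlus (condVar κ (fuzzyOutcome κ)) -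
        2 * condCov κ (fuzzyAdj κ μYp μTp) (fuzzyAdj κ ηY ηT) 0 +
        condVar κ (fuzzyAdj κ ηY ηT) 0) ∧
    limMinus (condVar κ (fuzzyU κ ηY ηT)) = (rdJump κ outT)⁻¹ ^ 2 *
      (limMinus (condVar κ (fuzzyOutcome κ)) -
        2 * condCov κ (fuzzyAdj κ μYm μTm) (fuzzyAdj κ ηY ηT) 0 +
        condVar κ (fuzzyAdj κ ηY ηT) 0) := by
  have h0 : (0 : ℝ) ∈ PX.support := mem_of_mem_nhds hs
  have mY := fun x (hx : x ∈ PX.support) => bY.memLp measurable_outY hx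
  have mT := fun x (hx : x ∈ PX.support) => bT.memLp measurable_outT hx
  obtain ⟨-, -, pY, μY, -, aY, -, -, cYp, cYm⟩ := lY
  obtain ⟨-, -, pT, μT, -, aT, -, -, cTp, cTm⟩ := lT
  have hv := (h.continuousOn_condVar.continuousAt hs).tendsto
  have heq : ∀ x ∈ PX.support, (rdJump κ outT)⁻¹ ^ 2 * (condVar κ (fuzzyOutcome κ) x -
      2 * condCov κ (fuzzyOutcome κ) (fuzzyAdj κ ηY ηT) x + condVar κ (fuzzyAdj κ ηY ηT) x) =
      condVar κ (fuzzyU κ ηY ηT) x := fun x hx =>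
    (condVar_fuzzyU (mY x hx) (mT x hx) (h.1.2.1 x hx) (h.2.1.2.1 x hx)).symm
  have lp : 𝓝[>] (0 : ℝ) ≤ 𝓝 0 := nhdsWithin_le_nhds
  have lm : 𝓝[<] (0 : ℝ) ≤ 𝓝 0 := nhdsWithin_le_nhds
  have hp := h.tendsto_condCov lp hs mY mT (pY 0 h0).1 (pT 0 h0).1
    (fun η hη => tendsto_condCov_long lp hs mY aY (fun x hx => (pY x hx).1) cYp hη.1 hη.2.1
      hη.2.2.1 hη.2.2.2.1)
    (fun η hη => tendsto_condCov_long lp hs mT aT (fun x hx => (pT x hx).1) cTp hη.1 hη.2.1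
      hη.2.2.1 hη.2.2.2.2.2.1)
  have hm := h.tendsto_condCov lm hs mY mT (pY 0 h0).2 (pT 0 h0).2
    (fun η hη => tendsto_condCov_long lm hs mY aY (fun x hx => (pY x hx).2) cYm hη.1 hη.2.1
      hη.2.2.1 hη.2.2.2.2.1)
    (fun η hη => tendsto_condCov_long lm hs mT aT (fun x hx => (pT x hx).2) cTm hη.1 hη.2.1
      hη.2.2.1 hη.2.2.2.2.2.2)
  refine HasOneSidedLimits.of_tendsto
    ((((hD.1.sub (hp.const_mul 2)).add (hv.mono_left lp)).const_mul _).congr' ?_)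
    ((((hD.2.sub (hm.const_mul 2)).add (hv.mono_left lm)).const_mul _).congr' ?_)
  · filter_upwards [lp hs] with x hx
    exact heq x hx
  · filter_upwards [lm hs] with x hx
    exact heq x hx

/-- The asymptotic variance as a function of the adjustment. -/
theorem varPair.asympVar_eq (h : varPair PX κ μYp μYm μTp μTm ηY ηT)
    (hs : PX.support ∈ 𝓝 (0 : ℝ)) (bY : BoundedSecondMoment PX κ outY)
    (bT : BoundedSecondMoment PX κ outT) (hD : HasOneSidedLimits (condVar κ (fuzzyOutcome κ)))
    (lY : IsLongLimit PX κ outY μYp μYm) (lT : IsLongLimit PX κ outT μTp μTm) (K fX : ℝ → ℝ) :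
    asympVar K fX κ ηY ηT = kappaBar K / (rdJump κ outT ^ 2 * fX 0) *
      (limPlus (condVar κ (fuzzyOutcome κ)) + limMinus (condVar κ (fuzzyOutcome κ)) -
        2 * condVar κ (fuzzyAdj κ (optAdj μYp μYm) (optAdj μTp μTm)) 0) +
      2 * kappaBar K / (rdJump κ outT ^ 2 * fX 0) *
        condVar κ (adjGap κ (optAdj μYp μYm) (optAdj μTp μTm) ηY ηT) 0 := by
  have h0 : (0 : ℝ) ∈ PX.support := mem_of_mem_nhds hs
  obtain ⟨-, e1, e2⟩ := h.limits_condVar hs bY bT hD lY lT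
  have mp : MemLp (fuzzyAdj κ μYp μTp) 2 (κ 0) :=
    (lY.2.2.1 0 h0).1.sub ((lT.2.2.1 0 h0).1.const_mul _)
  have mm : MemLp (fuzzyAdj κ μYm μTm) 2 (κ 0) :=
    (lY.2.2.1 0 h0).2.sub ((lT.2.2.1 0 h0).2.const_mul _)
  have mg : MemLp (fuzzyAdj κ ηY ηT) 2 (κ 0) :=
    (h.1.2.1 0 h0).sub ((h.2.1.2.1 0 h0).const_mul _)
  have eo : fuzzyAdj κ (optAdj μYp μYm) (optAdj μTp μTm) =
      fun w => (fuzzyAdj κ μYp μTp w + fuzzyAdj κ μYm μTm w) * (2 : ℝ)⁻¹ := by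
    ext w
    simp only [fuzzyAdj, onCovs, optAdj]
    ring
  have mo : MemLp (fuzzyAdj κ (optAdj μYp μYm) (optAdj μTp μTm)) 2 (κ 0) := by
    rw [eo]
    exact (mp.add mm).mul_const _
  have hgap : condVar κ (adjGap κ (optAdj μYp μYm) (optAdj μTp μTm) ηY ηT) 0 =
      condVar κ (fuzzyAdj κ (optAdj μYp μYm) (optAdj μTp μTm)) 0 -
      2 * condCov κ (fuzzyAdj κ (optAdj μYp μYm) (optAdj μTp μTm)) (fuzzyAdj κ ηY ηT) 0 +
      condVar κ (fuzzyAdj κ ηY ηT) 0 := variance_sub_eq mo mg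
  -- The two sides enter only through the sum of their long regressions, twice the optimal
  -- adjustment. This makes the total a perfect square in the gap, up to terms free of the pair.
  have hcov : condCov κ (fuzzyAdj κ μYp μTp) (fuzzyAdj κ ηY ηT) 0 +
      condCov κ (fuzzyAdj κ μYm μTm) (fuzzyAdj κ ηY ηT) 0 =
      2 * condCov κ (fuzzyAdj κ (optAdj μYp μYm) (optAdj μTp μTm)) (fuzzyAdj κ ηY ηT) 0 := by
    have := covariance_add_left mp mm mg
    rw [condCov, condCov, condCov, eo, covariance_mul_const_left, ← this]
    change _ = 2 * (cov[fuzzyAdj κ μYp μTp + fuzzyAdj κ μYm μTm, _; κ 0] * 2⁻¹)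
    ring
  rw [asympVar, e1, e2, hgap]
  linear_combination (-2 * (kappaBar K / (rdJump κ outT ^ 2 * fX 0))) * hcov

/-- The optimal pair is regular. -/
theorem varPair_optAdj (lT : IsLongLimit PX κ outT μTp μTm)
    (hY : optAdj μYp μYm ∈ varClass PX κ μYp μYm μTp μTm)
    (hT : optAdj μTp μTm ∈ varClass PX κ μYp μYm μTp μTm) :
    varPair PX κ μYp μYm μTp μTm (optAdj μYp μYm) (optAdj μTp μTm) := by
  -- Membership of the optimal adjustment for Y in the class already includes continuity of its
  -- covariances with both limits of the long regression of T; their average is the covariance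
  -- required.
  refine ⟨hY, hT, ((hY.2.2.2.2.2.1.add hY.2.2.2.2.2.2).mul_const (2 : ℝ)⁻¹).congr fun x hx => ?_⟩
  have e : onCovs (optAdj μTp μTm) =
      fun w : Obs d => (onCovs μTp + onCovs μTm) w * (2 : ℝ)⁻¹ := by
    ext w
    simp [onCovs, optAdj, div_eq_mul_inv]
  obtain ⟨h1, h2⟩ := lT.2.2.1 x hx
  rw [condCov, e, covariance_mul_const_right, covariance_add_right (hY.2.1 x hx) h1 h2]
  rfl

theorem condVar_adjGap_self {d : ℕ} (κ : Kernel ℝ (Obs d)) (ηY ηT : (Fin d → ℝ) → ℝ) (x : ℝ) :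
    condVar κ (adjGap κ ηY ηT ηY ηT) x = 0 := by
  have e : adjGap κ ηY ηT ηY ηT = 0 := by
    ext w
    simp [adjGap]
  rw [condVar, e, variance_zero]

end VarianceComparison

end

end FuzzyRD

/-! ### The main theorem -/

theorem mainTheorem11 {S : ℕ} {d : ℕ → ℕ}
    (PX : Measure ℝ) [IsProbabilityMeasure PX] (fX K : ℝ → ℝ) (h : ℕ → ℝ)
    (κ : ∀ n, Kernel ℝ (FuzzyRD.Obs (d n))) [∀ n, IsMarkovKernel (κ n)]
    (ρ : ∀ n, Measure (Fin n → Fin S)) [∀ n, IsProbabilityMeasure (ρ n)]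
    (hρ : ∀ n, ∀ᵐ σ ∂(ρ n), FuzzyRD.BalancedSplit σ)
    (estY estT : ∀ n, FuzzyRD.FirstStage (d n) n)
    (hestY : ∀ n (A : Finset (Fin n)), Measurable
      fun p : (A → FuzzyRD.Datum (d n)) × (Fin (d n) → ℝ) => estY n A p.1 p.2)
    (hestT : ∀ n (A : Finset (Fin n)), Measurable
      fun p : (A → FuzzyRD.Datum (d n)) × (Fin (d n) → ℝ) => estT n A p.1 p.2)
    (ηY ηT : ∀ n, (Fin (d n) → ℝ) → ℝ)
    (hdesign : FuzzyRD.DesignAssumption PX fX K h)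
    (hfirstY : FuzzyRD.FirstStageAssumption PX h κ ρ estY ηY)
    (hfirstT : FuzzyRD.FirstStageAssumption PX h κ ρ estT ηT)
    (houtY : FuzzyRD.OutcomeAssumption PX κ fun n => FuzzyRD.adjusted FuzzyRD.outY (ηY n))
    (houtT : FuzzyRD.OutcomeAssumption PX κ fun n => FuzzyRD.adjusted FuzzyRD.outT (ηT n))
    (hjump : ∃ c C : ℝ, 0 < c ∧ ∀ n, c ≤ |FuzzyRD.rdJump (κ n) FuzzyRD.outT| ∧
      |FuzzyRD.fuzzyParam (κ n)| ≤ C)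
    (hvarU : ∃ C L : ℝ, 0 < C ∧ ∀ n,
      FuzzyRD.RegularVariance PX C L (κ n) (FuzzyRD.fuzzyU (κ n) (ηY n) (ηT n))) :
    -- the one-sided limits in the definitions of the estimand, the bias and the variance exist
    (∀ n, FuzzyRD.HasOneSidedLimits (FuzzyRD.condMean (κ n) FuzzyRD.outY) ∧
      FuzzyRD.HasOneSidedLimits (FuzzyRD.condMean (κ n) FuzzyRD.outT) ∧
      FuzzyRD.HasOneSidedLimits
        (iteratedDeriv 2 (FuzzyRD.condMean (κ n) (FuzzyRD.fuzzyOutcome (κ n)))) ∧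
      FuzzyRD.HasOneSidedLimits
        (FuzzyRD.condVar (κ n) (FuzzyRD.fuzzyU (κ n) (ηY n) (ηT n))) ∧
      0 < FuzzyRD.asympVar K fX (κ n) (ηY n) (ηT n)) ∧
    -- part (i): asymptotic normality
    (∃ B : ∀ n, (Fin n → Fin S) × (Fin n → FuzzyRD.Datum (d n)) → ℝ,
      (∀ n, Measurable (B n)) ∧
      (∀ ε > 0, Tendsto (fun n => FuzzyRD.sampleLaw (ρ n) PX (κ n)
        {p | ε ≤ |B n p - FuzzyRD.biasLead K (κ n)|}) atTop (𝓝 0)) ∧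
      TendstoInDistribution
        (fun n p => Real.sqrt (n * h n) *
          (Real.sqrt (FuzzyRD.asympVar K fX (κ n) (ηY n) (ηT n)))⁻¹ *
          (FuzzyRD.fuzzyEst K (h n) (estY n) (estT n) p.1 p.2 - FuzzyRD.fuzzyParam (κ n)
            - B n p * h n ^ 2))
        atTop id (fun n => FuzzyRD.sampleLaw (ρ n) PX (κ n)) (gaussianReal 0 1)) ∧
    -- part (ii): comparison of the asymptotic variances
    (∀ n, ∀ μYp μYm μTp μTm : (Fin (d n) → ℝ) → ℝ,
      FuzzyRD.BoundedSecondMoment PX (κ n) FuzzyRD.outY →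
      FuzzyRD.BoundedSecondMoment PX (κ n) FuzzyRD.outT →
      FuzzyRD.HasOneSidedLimits (FuzzyRD.condVar (κ n) (FuzzyRD.fuzzyOutcome (κ n))) →
      FuzzyRD.IsLongLimit PX (κ n) FuzzyRD.outY μYp μYm →
      FuzzyRD.IsLongLimit PX (κ n) FuzzyRD.outT μTp μTm →
      FuzzyRD.optAdj μYp μYm ∈ FuzzyRD.varClass PX (κ n) μYp μYm μTp μTm →
      FuzzyRD.optAdj μTp μTm ∈ FuzzyRD.varClass PX (κ n) μYp μYm μTp μTm →
      (∀ ηY' ηT' : (Fin (d n) → ℝ) → ℝ, FuzzyRD.varPair PX (κ n) μYp μYm μTp μTm ηY' ηT' →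
        FuzzyRD.HasOneSidedLimits (FuzzyRD.condVar (κ n) (FuzzyRD.fuzzyU (κ n) ηY' ηT'))) ∧
      (∀ ηYa ηTa ηYb ηTb : (Fin (d n) → ℝ) → ℝ,
        FuzzyRD.varPair PX (κ n) μYp μYm μTp μTm ηYa ηTa →
        FuzzyRD.varPair PX (κ n) μYp μYm μTp μTm ηYb ηTb →
        FuzzyRD.asympVar K fX (κ n) ηYa ηTa - FuzzyRD.asympVar K fX (κ n) ηYb ηTb =
          2 * FuzzyRD.kappaBar K / (FuzzyRD.rdJump (κ n) FuzzyRD.outT ^ 2 * fX 0) *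
            (FuzzyRD.condVar (κ n) (FuzzyRD.adjGap (κ n) (FuzzyRD.optAdj μYp μYm)
                (FuzzyRD.optAdj μTp μTm) ηYa ηTa) 0 -
              FuzzyRD.condVar (κ n) (FuzzyRD.adjGap (κ n) (FuzzyRD.optAdj μYp μYm)
                (FuzzyRD.optAdj μTp μTm) ηYb ηTb) 0)) ∧
      -- the optimal pair belongs to the class and minimizes the asymptotic variance over it
      FuzzyRD.varPair PX (κ n) μYp μYm μTp μTm
        (FuzzyRD.optAdj μYp μYm) (FuzzyRD.optAdj μTp μTm) ∧
      (∀ ηY' ηT' : (Fin (d n) → ℝ) → ℝ, FuzzyRD.varPair PX (κ n) μYp μYm μTp μTm ηY' ηT' →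
        FuzzyRD.asympVar K fX (κ n) (FuzzyRD.optAdj μYp μYm) (FuzzyRD.optAdj μTp μTm) ≤
          FuzzyRD.asympVar K fX (κ n) ηY' ηT')) := by
  obtain ⟨c, C, hc, hj⟩ := hjump
  obtain ⟨CU, LU, hCU, hU⟩ := hvarU
  obtain ⟨δ, hδ, F, -, -, -, hsub⟩ := hdesign.exists_local
  have hs : PX.support ∈ 𝓝 (0 : ℝ) :=
    mem_of_superset (Ioo_mem_nhds (by linarith) hδ) (hsub.trans interior_subset)
  refine ⟨fun n => ?_, hdesign.asymptotic_normality hestY hestT hfirstY hfirstT houtY houtT hc hj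
    hCU hU, ?_⟩
  · obtain ⟨CY, LY, qY, -, -, hoY⟩ := houtY
    obtain ⟨CT, LT, qT, -, -, hoT⟩ := houtT
    have aY := hfirstY.admissible n
    have aT := hfirstT.admissible n
    have hV := hdesign.asympVar_ge hCU (hU n)
    exact ⟨(FuzzyRD.limits_adjusted aY (hoY n).1 hδ hsub).1,
      (FuzzyRD.limits_adjusted aT (hoT n).1 hδ hsub).1,
      (FuzzyRD.limits_fuzzyOutcome aY aT (hoY n).1 (hoT n).1 hδ hsub).1,
      ((hU n).limits hδ hsub).1, hV.1.trans_le hV.2⟩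
  · intro n μYp μYm μTp μTm bY bT hD lY lT hoY hoT
    have hopt := FuzzyRD.varPair_optAdj lT hoY hoT
    refine ⟨fun ηY' ηT' hp => (hp.limits_condVar hs bY bT hD lY lT).1,
      fun ηYa ηTa ηYb ηTb ha hb => ?_, hopt, fun ηY' ηT' hp => ?_⟩
    · rw [ha.asympVar_eq hs bY bT hD lY lT, hb.asympVar_eq hs bY bT hD lY lT]
      ring
    -- For the optimal pair the gap is identically zero, so its variance term disappears, and any
    -- other pair adds a nonnegative multiple of a variance.
    · rw [hp.asympVar_eq hs bY bT hD lY lT, hopt.asympVar_eq hs bY bT hD lY lT,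
        FuzzyRD.condVar_adjGap_self, mul_zero]
      have hk := hdesign.kappaBar_pos
      have hf := hdesign.density_pos
      have hv : 0 ≤ FuzzyRD.condVar (κ n) (FuzzyRD.adjGap (κ n) (FuzzyRD.optAdj μYp μYm)
        (FuzzyRD.optAdj μTp μTm) ηY' ηT') 0 := variance_nonneg _ _
      gcongr
      positivity
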